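/- Let $s\ge 1$ be an integer and let $(\Omega,\mathcal F,P)$ be a probability space with expectation $\mathbb E$. Random matrices. Let $(f_{r;i,j})_{1\le r\le s;\ i,j\ge1}$ be an independent family of complex standard Gaussian random variables on $\Omega$, i.e. all the real and imaginary parts $\Re f_{r;i,j},\Im f_{r;i,j}$ together form an independent family of real Gaussian random variables with mean $0$ and variance $1/2$. Put $G_r^{(M,N)}=[f_{r;i,j}]_{1\le i\le M,\,1\le j\le N}$, $G_r^{(N)}=\frac1{\sqrt N}G_r^{(N,N)}$ and $W_r^{(M,N)}=\frac1N\bigl(G_r^{(M,N)}\bigr)^*G_r^{(M,N)}$. For every $N\ge1$ let $U_1^{(N)},\dots,U_s^{(N)}$ be random $N\times N$ permutation matrices on $\Omega$, each of them uniformly distributed over the $N!$ permutation matrices, such that for every $N\ge1$ the $2s$ random matrices $U_1^{(N)},\dots,U_s^{(N)},G_1^{(N)},\dots,G_s^{(N)}$ are independent, and for all $M,N\ge1$ the $2s$ random matrices $U_1^{(N)},\dots,U_s^{(N)},W_1^{(M,N)},\dots,W_s^{(M,N)}$ are independent. Write $\mathrm{tr}^{(N)}=\frac1N\mathrm{Tr}$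 for the normalized trace of $N\times N$ matrices. Limit elements. Let $(\mathcal A,\varphi)$ be a tracial non-commutative $*$-probability space, i.e. $\mathcal A$ is a unital complex $*$-algebra and $\varphi:\mathcal A\to\mathbb C$ is a unital, tracial, positive linear functional. A permutation $\tau$ of $\{1,\dots,n\}$ is non-crossing if $\#(\tau)+\#(\tau^{-1}\gamma_n)=n+1$, where $\gamma_n=(1,2,\dots,n)$ and $\#$ counts cycles, including fixed points. The non-crossing cumulants $k_n:\mathcal A^n\to\mathbb C$ $(n\ge1)$ are defined recursively by $$\varphi(A_1\cdots A_n)=\sum_{\tau}\ \prod_{(a_1,\dots,a_p)}k_p(A_{a_1},\dots,A_{a_p}),$$ where $\tau$ runs over the non-crossing permutations of $\{1,\dots,n\}$ and $(a_1,\dots,a_p)$ over the cycles of $\tau$, each written with its smallest element first. An element $U$ is a Haar unitary if $U^*U=UU^*=1$ and $\varphi(U^n)=0$ for all $n\in\mathbb Z\setminus\{0\}$; $G$ is standard circular if $k_2(G,G^*)=k_2(G^*,G)=1$ and all other cumulants with arguments in $\{G,G^*\}$ vanish; $W$ is free Poisson of parameter $c>0$ if $W^*=W$ and $k_n(W,\dots,W)=c$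 for all $n\ge1$. A family $(x_i)_{i\in I}$ in $\mathcal A$ is $*$-free if, with $\mathcal A_i$ the unital $*$-subalgebra generated by $x_i$, one has $\varphi(A_1\cdots A_n)=0$ whenever $n\ge1$, $A_k\in\mathcal A_{i_k}$ and $\varphi(A_k)=0$ for $1\le k\le n$, and $i_k\ne i_{k+1}$ for $1\le k<n$. Fix $c>0$ and elements $U_r,G_r,W_r\in\mathcal A$ $(1\le r\le s)$ such that each $U_r$ is a Haar unitary, each $G_r$ is standard circular, each $W_r$ is free Poisson of parameter $c$, and the two families of $2s$ elements $(U_1,\dots,U_s,G_1,\dots,G_s)$ and $(U_1,\dots,U_s,W_1,\dots,W_s)$ are $*$-free. Theorem. (1) As $N\to\infty$, the families $\bigl(U_r^{(N)},G_r^{(N)}\bigr)_{r=1}^s$ converge in $*$-distribution to $(U_r,G_r)_{r=1}^s$: for every monomial $\alpha$ in the $2s$ letters and their adjoints, the normalized traces of the random matrices $\alpha^{(N)}$ obtained by replacing $U_r,G_r$ by $U_r^{(N)},G_r^{(N)}$ are integrable and $$\lim_{N\to\infty}\mathbb E\bigl(\mathrm{tr}^{(N)}\alpha^{(N)}\bigr)=\varphi(\alpha).$$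 (2) As $M,N\to\infty$ with $M/N\to c$, the families $\bigl(U_r^{(N)},W_r^{(M,N)}\bigr)_{r=1}^s$ converge in $*$-distribution to $(U_r,W_r)_{r=1}^s$: for every monomial $\beta$ in the $2s$ letters and their adjoints, and for all sequences $(M_q),(N_q)$ of natural numbers with $M_q\to\infty$, $N_q\to\infty$ and $M_q/N_q\to c$, the normalized traces of the random matrices $\beta^{(M_q,N_q)}$ obtained by replacing $U_r,W_r$ by $U_r^{(N_q)},W_r^{(M_q,N_q)}$ are integrable and $$\lim_{q\to\infty}\mathbb E\bigl(\mathrm{tr}^{(N_q)}\beta^{(M_q,N_q)}\bigr)=\varphi(\beta).$$ In particular, both families are asymptotically $*$-free, i.e. they converge in $*$-distribution to families that are $*$-free. -/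

import Mathlib

open MeasureTheory ProbabilityTheory Filter Topology

noncomputable section

namespace FreePerm

/-! ### Non-crossing permutations -/

/-- The number of cycles of a permutation, fixed points counted as cycles of length one. -/
def numCycles {n : ℕ} (τ : Equiv.Perm (Fin n)) : ℕ :=
  Nat.card (Quotient (Equiv.Perm.SameCycle.setoid τ))

/-- `τ` is non-crossing if `#(τ) + #(τ⁻¹ γ_n) = n + 1`, where `γ_n = (1, 2, …, n)`. -/
def IsNonCrossing {n : ℕ} (τ : Equiv.Perm (Fin n)) : Prop :=
  numCycles τ + numCycles (τ⁻¹ * finRotate n) = n + 1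

open Classical in
/-- The set of the smallest elements of the cycles of `τ`, one for each cycle. -/
def cycleMins {n : ℕ} (τ : Equiv.Perm (Fin n)) : Finset (Fin n) :=
  Finset.univ.filter fun a => ∀ b, τ.SameCycle a b → a ≤ b

/-- The cycle of `τ` through `a`, listed as `[a, τ a, τ² a, …]`, each element once. -/
def cycleList {n : ℕ} (τ : Equiv.Perm (Fin n)) (a : Fin n) : List (Fin n) :=
  List.iterate τ a (Function.minimalPeriod τ a)

theorem numCycles_eq_one {n : ℕ} {τ : Equiv.Perm (Fin n)} {a : Fin n}
    (h : ∀ b, τ.SameCycle a b) : numCycles τ = 1 := by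
  rw [numCycles, Nat.card_eq_one_iff_unique]
  refine ⟨⟨fun x y => ?_⟩, ⟨Quotient.mk _ a⟩⟩
  induction x using Quotient.inductionOn with | _ x =>
  induction y using Quotient.inductionOn with | _ y =>
  exact Quotient.sound ((h x).symm.trans (h y))

theorem numCycles_eq_iff {n : ℕ} {τ : Equiv.Perm (Fin n)} : numCycles τ = n ↔ τ = 1 := by
  have hsurj : Function.Surjective
      (Quotient.mk (Equiv.Perm.SameCycle.setoid τ)) := Quotient.mk_surjective
  constructor
  · intro h
    have hb := (Nat.bijective_iff_surjective_and_card _).2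
      ⟨hsurj, by rw [Nat.card_fin]; exact h.symm⟩
    ext x
    have : τ x = x := hb.1 (Quotient.sound
      (Equiv.Perm.sameCycle_apply_left.2 (Equiv.Perm.SameCycle.refl τ x)))
    simp [this]
  · rintro rfl
    have hinj : Function.Injective
        (Quotient.mk (Equiv.Perm.SameCycle.setoid (1 : Equiv.Perm (Fin n)))) := by
      intro x y hxy
      exact Equiv.Perm.sameCycle_one.1 (Quotient.exact hxy)
    exact (Nat.card_eq_of_bijective _ ⟨hinj, hsurj⟩).symm.trans (Nat.card_fin n)

/-- A non-crossing permutation other than `γ_n` has only cycles of length less than `n`. -/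
theorem length_cycleList_lt {n : ℕ} {τ : Equiv.Perm (Fin n)} (hτ : IsNonCrossing τ)
    (hne : τ ≠ finRotate n) (a : Fin n) : (cycleList τ a).length < n := by
  rw [cycleList, List.length_iterate]
  have hle : Function.minimalPeriod τ a ≤ n := by
    simpa using Function.minimalPeriod_le_card (f := τ) (x := a)
  refine lt_of_le_of_ne hle fun heq => hne ?_
  have hinj : Function.Injective (fun i : Fin n => τ^[(i : ℕ)] a) := by
    intro i j hij
    refine Fin.ext (Function.iterate_injOn_Iio_minimalPeriod (f := τ) (x := a) ?_ ?_ hij)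
    · rw [heq]; exact i.2
    · rw [heq]; exact j.2
  have hone : numCycles τ = 1 := by
    refine numCycles_eq_one (a := a) fun b => ?_
    obtain ⟨i, hi⟩ := (Finite.injective_iff_surjective.1 hinj) b
    refine ⟨(i : ℕ), ?_⟩
    rw [zpow_natCast, ← Equiv.Perm.iterate_eq_pow]
    exact hi
  have h1 : τ⁻¹ * finRotate n = 1 := by
    rw [← numCycles_eq_iff]
    unfold IsNonCrossing at hτ
    omega
  exact (inv_mul_eq_one.1 h1)

/-! ### Non-commutative probability spaces -/

section

variable {A : Type*} [Ring A] [Algebra ℂ A]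

open Classical in
/-- The non-crossing cumulants `k_n (A_1, …, A_n)` of a linear functional `φ`, as a function of
the list `[A_1, …, A_n]`. They are defined by recursion on the length of the list: the
moment-cumulant formula `φ (A_1 ⋯ A_n) = ∑_{τ non-crossing} k_τ (A_1, …, A_n)`, where `k_τ` is the
product of the cumulants along the cycles of `τ`, is solved for the summand
`k_n (A_1, …, A_n)` which belongs to `τ = γ_n`. (The value at the empty list is immaterial.) -/
def freeCumulant (φ : A →ₗ[ℂ] ℂ) (l : List A) : ℂ :=
  φ l.prod - ∑ τ : {τ : Equiv.Perm (Fin l.length) // IsNonCrossing τ ∧ τ ≠ finRotate l.length},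
    ∏ a ∈ cycleMins τ.1, freeCumulant φ ((cycleList τ.1 a).map l.get)
termination_by l.length
decreasing_by
  rw [List.length_map]
  exact length_cycleList_lt τ.2.1 τ.2.2 a

/-- The cumulant `k_τ` along the cycles of a permutation `τ`, each cycle being listed from its
smallest element. -/
def permCumulant (φ : A →ₗ[ℂ] ℂ) (l : List A) (τ : Equiv.Perm (Fin l.length)) : ℂ :=
  ∏ a ∈ cycleMins τ, freeCumulant φ ((cycleList τ a).map l.get)

theorem finRotate_iterate_zero {n k : ℕ} (hk : k < n + 1) :
    (finRotate (n + 1))^[k] 0 = ⟨k, hk⟩ := by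
  induction k with
  | zero => rfl
  | succ k ih =>
    rw [Function.iterate_succ_apply', ih (by omega)]
    exact finRotate_of_lt (by omega)

theorem finRotate_sameCycle_zero {n : ℕ} (b : Fin (n + 1)) :
    (finRotate (n + 1)).SameCycle 0 b := by
  refine ⟨(b : ℕ), ?_⟩
  rw [zpow_natCast, ← Equiv.Perm.iterate_eq_pow, finRotate_iterate_zero b.2]

theorem cycleMins_finRotate (n : ℕ) : cycleMins (finRotate (n + 1)) = {0} := by
  ext a
  simp only [cycleMins, Finset.mem_filter, Finset.mem_univ, true_and, Finset.mem_singleton]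
  constructor
  · intro h
    exact Fin.le_zero_iff.1 (h 0 (finRotate_sameCycle_zero a).symm)
  · rintro rfl b _
    exact Fin.zero_le b

theorem cycleList_finRotate (n : ℕ) : cycleList (finRotate (n + 1)) 0 = List.finRange (n + 1) := by
  have hp : Function.minimalPeriod (finRotate (n + 1)) 0 = n + 1 := by
    have hle : Function.minimalPeriod (finRotate (n + 1)) 0 ≤ n + 1 := by
      simpa using Function.minimalPeriod_le_card (f := finRotate (n + 1)) (x := 0)
    refine le_antisymm hle (not_lt.1 fun hlt => ?_)
    have h0 := Function.iterate_minimalPeriod (f := finRotate (n + 1)) (x := 0)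
    rw [finRotate_iterate_zero hlt] at h0
    have hpos : 0 < Function.minimalPeriod (finRotate (n + 1)) 0 :=
      Function.minimalPeriod_pos_of_mem_periodicPts
        ((finRotate (n + 1)).injective.mem_periodicPts 0)
    have := congrArg Fin.val h0
    simp only [Fin.val_zero] at this
    omega
  rw [cycleList, hp]
  refine List.ext_getElem (by simp) fun k h1 h2 => ?_
  rw [List.getElem_iterate, List.getElem_finRange]
  exact finRotate_iterate_zero (by simpa using h1)

theorem permCumulant_finRotate (φ : A →ₗ[ℂ] ℂ) {l : List A} (hl : l ≠ []) :
    permCumulant φ l (finRotate l.length) = freeCumulant φ l := by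
  obtain ⟨x, t, rfl⟩ := List.exists_cons_of_ne_nil hl
  change ∏ a ∈ cycleMins (finRotate (t.length + 1)),
    freeCumulant φ ((cycleList (finRotate (t.length + 1)) a).map (x :: t).get) = _
  rw [cycleMins_finRotate, Finset.prod_singleton, cycleList_finRotate]
  congr 1
  exact List.map_get_finRange (x :: t)

theorem isNonCrossing_finRotate {n : ℕ} (hn : n ≠ 0) : IsNonCrossing (finRotate n) := by
  obtain ⟨n, rfl⟩ := Nat.exists_eq_succ_of_ne_zero hn
  rw [IsNonCrossing, inv_mul_cancel, numCycles_eq_iff.2 rfl,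
    numCycles_eq_one finRotate_sameCycle_zero, add_comm]

open Classical in
/-- The moment-cumulant formula. -/
theorem moment_cumulant (φ : A →ₗ[ℂ] ℂ) {l : List A} (hl : l ≠ []) :
    φ l.prod = ∑ τ : Equiv.Perm (Fin l.length) with IsNonCrossing τ, permCumulant φ l τ := by
  have hmem : finRotate l.length ∈
      Finset.univ.filter fun τ : Equiv.Perm (Fin l.length) => IsNonCrossing τ := by
    simpa using isNonCrossing_finRotate (by simpa using hl)
  rw [← Finset.add_sum_erase _ _ hmem, permCumulant_finRotate φ hl, freeCumulant,
    sub_add_eq_add_sub, eq_sub_iff_add_eq, add_right_inj]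
  refine (Finset.sum_subtype _ (fun τ => ?_) (permCumulant φ l)).symm
  simp [and_comm]

end

section

variable {A : Type*} [Ring A] [StarRing A] [Algebra ℂ A]

/-- `φ` is a unital tracial positive linear functional on the unital `*`-algebra `A`. -/
structure IsTracialState (φ : A →ₗ[ℂ] ℂ) : Prop where
  map_one : φ 1 = 1
  tracial : ∀ a b, φ (a * b) = φ (b * a)
  nonneg : ∀ a, 0 ≤ (φ (star a * a)).re ∧ (φ (star a * a)).im = 0

/-- Freeness of a family of unital subalgebras: products of centred elements of which any two
neighbours come from different subalgebras are centred. -/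
def IsFree {ι : Type*} (φ : A →ₗ[ℂ] ℂ) (B : ι → Subalgebra ℂ A) : Prop :=
  ∀ (n : ℕ) (j : Fin (n + 1) → ι) (a : Fin (n + 1) → A),
    (∀ i, a i ∈ B (j i)) → (∀ i, φ (a i) = 0) →
    (∀ i : Fin n, j i.castSucc ≠ j i.succ) →
    φ (List.ofFn a).prod = 0

/-- `*`-freeness of a family of elements: the unital `*`-subalgebras that they generate
are free. -/
def IsStarFree [StarModule ℂ A] {ι : Type*} (φ : A →ₗ[ℂ] ℂ) (x : ι → A) : Prop :=
  IsFree φ fun i => (StarAlgebra.adjoin ℂ {x i}).toSubalgebra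

/-- Haar unitaries: unitary elements `U` with `φ (U ^ n) = 0` for all integers `n ≠ 0`
(where `U ^ (-n) = (U*) ^ n`). -/
structure IsHaarUnitary (φ : A →ₗ[ℂ] ℂ) (U : A) : Prop where
  star_mul_self : star U * U = 1
  mul_star_self : U * star U = 1
  map_pow : ∀ n : ℕ, n ≠ 0 → φ (U ^ n) = 0
  map_star_pow : ∀ n : ℕ, n ≠ 0 → φ (star U ^ n) = 0

/-- `x` or its adjoint, according to a Boolean exponent (`true` stands for the adjoint). -/
def starIf {B : Type*} [Star B] (x : B) (ε : Bool) : B := if ε then star x else x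

/-- Standard circular elements: among the cumulants in `G` and `G*`, those of `(G, G*)` and
`(G*, G)` are one and all others vanish. -/
def IsStandardCircular (φ : A →ₗ[ℂ] ℂ) (G : A) : Prop :=
  ∀ ε : List Bool, ε ≠ [] → freeCumulant φ (ε.map (starIf G)) =
    if ε = [false, true] ∨ ε = [true, false] then 1 else 0

/-- Free Poisson elements of parameter `c`. -/
def IsFreePoisson (φ : A →ₗ[ℂ] ℂ) (c : ℝ) (W : A) : Prop :=
  star W = W ∧ ∀ n : ℕ, 1 ≤ n → freeCumulant φ (List.replicate n W) = c

end

/-- The monomial in the elements `x i` and their adjoints that is given by a word: the letter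
`(i, false)` stands for `x i` and `(i, true)` for its adjoint. -/
def starMonomial {ι B : Type*} [Monoid B] [Star B] (x : ι → B) (w : List (ι × Bool)) : B :=
  (w.map fun p => starIf (x p.1) p.2).prod

/-! ### Random matrices -/

/-- Complex matrices carry the product (that is, entrywise) σ-algebra. -/
instance matrixMeasurableSpace {m n : Type*} : MeasurableSpace (Matrix m n ℂ) :=
  inferInstanceAs (MeasurableSpace (m → n → ℂ))

/-- The normalized trace of an `N × N` matrix. -/
def normTrace {N : ℕ} (X : Matrix (Fin N) (Fin N) ℂ) : ℂ := (1 / (N : ℂ)) * X.trace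

/-- The matrix of a permutation: its `(i, j)`-entry is `1` if `σ j = i` and `0` otherwise. -/
def permMat {N : ℕ} (σ : Equiv.Perm (Fin N)) : Matrix (Fin N) (Fin N) ℂ :=
  Matrix.of fun i j => if σ j = i then 1 else 0

variable {Ω : Type*} [MeasurableSpace Ω]

/-- Uniformly distributed random permutation matrices. -/
structure IsUniformPermMatrix {N : ℕ} (P : Measure Ω)
    (U : Ω → Matrix (Fin N) (Fin N) ℂ) : Prop where
  measurable : Measurable U
  mem : ∀ ω, ∃ σ : Equiv.Perm (Fin N), U ω = permMat σ
  uniform : ∀ σ : Equiv.Perm (Fin N), P.real (U ⁻¹' {permMat σ}) = 1 / (N.factorial : ℝ)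

/-- Independent families of complex standard Gaussian random variables: the real and imaginary
parts together are independent real Gaussian random variables with mean `0` and
variance `1 / 2`. -/
structure IsIndepComplexGaussian {Λ : Type*} (P : Measure Ω) (f : Λ → Ω → ℂ) : Prop where
  measurable : ∀ i, Measurable (f i)
  map_re : ∀ i, P.map (fun ω => (f i ω).re) = gaussianReal 0 (1 / 2)
  map_im : ∀ i, P.map (fun ω => (f i ω).im) = gaussianReal 0 (1 / 2)
  indep : iIndepFun (Sum.elim (fun i ω => (f i ω).re) (fun i ω => (f i ω).im)) P

/-- The random `M × N` matrices `G_r^(M,N)`, the upper left corners of the infinite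
arrays `f r`. -/
def cornerMatrix {s : ℕ} (f : Fin s × ℕ × ℕ → Ω → ℂ) (M N : ℕ) (r : Fin s) (ω : Ω) :
    Matrix (Fin M) (Fin N) ℂ :=
  Matrix.of fun i j => f (r, i, j) ω

/-- The normalized square Gaussian matrices `G_r^(N) = N^(-1/2) G_r^(N,N)`. -/
def gaussianMatrix {s : ℕ} (f : Fin s × ℕ × ℕ → Ω → ℂ) (N : ℕ) (r : Fin s) (ω : Ω) :
    Matrix (Fin N) (Fin N) ℂ :=
  ((1 / Real.sqrt N : ℝ) : ℂ) • cornerMatrix f N N r ω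

/-- The complex Wishart matrices `W_r^(M,N) = N⁻¹ (G_r^(M,N))* G_r^(M,N)`. -/
def wishartMatrix {s : ℕ} (f : Fin s × ℕ × ℕ → Ω → ℂ) (M N : ℕ) (r : Fin s) (ω : Ω) :
    Matrix (Fin N) (Fin N) ℂ :=
  (1 / (N : ℂ)) • ((cornerMatrix f M N r ω).conjTranspose * cornerMatrix f M N r ω)

section

variable {A : Type*} [Ring A] [StarRing A] [Algebra ℂ A] {ι : Type*}

/-- Convergence in `*`-distribution (in expectation), as `q → ∞`, of the families
`(X q i)_i` of random `N q × N q` matrices to the family `(x i)_i` in `(A, φ)`. -/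
def ConvergesInStarDistribution (P : Measure Ω) (φ : A →ₗ[ℂ] ℂ) (N : ℕ → ℕ)
    (X : (q : ℕ) → ι → Ω → Matrix (Fin (N q)) (Fin (N q)) ℂ) (x : ι → A) : Prop :=
  ∀ w : List (ι × Bool),
    (∀ q, Integrable (fun ω => normTrace (starMonomial (fun i => X q i ω) w)) P) ∧
    Tendsto (fun q => ∫ ω, normTrace (starMonomial (fun i => X q i ω) w) ∂P) atTop
      (𝓝 (φ (starMonomial x w)))

/-- Asymptotic `*`-freeness of the families `(X q i)_i`, with limit family `(x i)_i`: they converge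
in `*`-distribution to `(x i)_i` and this family is `*`-free. -/
def IsAsymptoticallyStarFree [StarModule ℂ A] (P : Measure Ω) (φ : A →ₗ[ℂ] ℂ) (N : ℕ → ℕ)
    (X : (q : ℕ) → ι → Ω → Matrix (Fin (N q)) (Fin (N q)) ℂ) (x : ι → A) : Prop :=
  ConvergesInStarDistribution P φ N X x ∧ IsStarFree φ x

end

end FreePerm

end

/-! The proof compares two solutions of one system of loop (Schwinger–Dyson) equations. For fixed
permutations, Gaussian integration by parts expresses the expected product of normalized traces of
words, one of which starts with a Gaussian or Wishart letter, through such expectations with fewer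
letters of this kind: the derivative cuts the word in two or, with weight `N⁻²`, glues it to another
word (`traceMoment_cons`). Being linear, the equations survive averaging over the permutations.
Induction on the number of these letters shows that all moments converge, that they factorize over
the words in the limit, and that the limits satisfy the equations without the gluing term
(`LoopSequence.tendsto`, `LoopSequence.satisfiesOne`). The limiting equations, cyclic invariance and
the values at words in the permutation matrices alone determine the limit
(`LoopData.SatisfiesOne.unique`).

The induction starts from words in the permutation matrices, whose normalized traces are proportions
of fixed points. By a switching argument a nontrivial reduced word has a bounded mean number of
fixed points (`sum_card_fixed_mul_le`). Hence the limit is `1` or `0` according to whether the word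
is trivial in the free group, and this is the value of `φ` at free Haar unitaries.

It remains to see that the `*`-free family satisfies the same limiting equations. Freeness reduces
this to words in a single circular or free Poisson element (`IsFree.loop_equation`): written with a
free difference quotient, the equation is linear in the word, and at alternating products of centred
polynomials its terms vanish. For a single element the equation is borrowed from the matrices.
Wick's formula writes the moments of one matrix as sums over permutations of powers of `N`
determined by cycle numbers. The sums converge and their coefficients are positive, so no term can
grow, and the terms of order one are those of the non-crossing permutations (`eq_sum_of_tendsto`).
This is the moment-cumulant formula for the limit element, so its moments are the matrix limits and
inherit their loop equation. -/

noncomputable section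

namespace FreePerm

/-! ### Loop equations -/

section Loop

variable {L : Type*}

/-- The factorizations `Q = p.1 ++ y :: p.2` of a word for which the letter `y` satisfies `Y`. -/
def splits (Y : L → Bool) : List L → List (List L × List L)
  | [] => []
  | a :: Q => (if Y a then [([], Q)] else []) ++ (splits Y Q).map fun p => (a :: p.1, p.2)

/-- The factorizations of one word out of a list of words, together with the list of the
remaining words. -/
def splitsList (Y : L → Bool) : List (List L) → List ((List L × List L) × List (List L))
  | [] => []
  | Q :: S => (splits Y Q).map (fun p => (p, S)) ++
      (splitsList Y S).map fun p => (p.1, Q :: p.2)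

/-- The combinatorial data of a system of loop equations: the set `X` of the letters to which they
apply and, for each of them, the set `Y x` of the letters at which words are split and the word
`η x` that is inserted there. -/
structure LoopData (L : Type*) where
  X : L → Bool
  Y : L → L → Bool
  η : L → List L
  X_of_Y : ∀ x y, X x → Y x y → X y
  countP_η : ∀ x, X x → (η x).countP X ≤ 1

/-- The loop equations for a function of lists of words. -/
def LoopData.Satisfies (D : LoopData L) (κ : L → ℂ) (δ : ℂ) (T : List (List L) → ℂ) : Prop :=
  ∀ x Q S, D.X x → T ((x :: Q) :: S) = κ x * T (Q :: S) +
    ((splits (D.Y x) Q).map fun p => T ((D.η x ++ p.1) :: p.2 :: S)).sum +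
    δ * ((splitsList (D.Y x) S).map fun p =>
      T ((D.η x ++ (Q ++ (p.1.2 ++ p.1.1))) :: p.2)).sum

/-- The loop equations for a multiplicative function of lists of words. -/
def LoopData.SatisfiesOne (D : LoopData L) (κ : L → ℂ) (ℓ : List L → ℂ) : Prop :=
  ∀ x Q, D.X x → ℓ (x :: Q) = κ x * ℓ Q +
    ((splits (D.Y x) Q).map fun p => ℓ (D.η x ++ p.1) * ℓ p.2).sum

/-- The number of letters in `D.X` of a list of words. -/
def LoopData.weight (D : LoopData L) (S : List (List L)) : ℕ := (S.map (List.countP D.X)).sum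

@[simp] theorem LoopData.weight_cons (D : LoopData L) (Q : List L) (S : List (List L)) :
    D.weight (Q :: S) = Q.countP D.X + D.weight S := by simp [weight]

@[simp] theorem LoopData.weight_nil (D : LoopData L) : D.weight [] = 0 := by simp [weight]

theorem countP_splits {X Y : L → Bool} (h : ∀ y, Y y → X y) {Q : List L} :
    ∀ p ∈ splits Y Q, p.1.countP X + p.2.countP X + 1 = Q.countP X := by
  induction Q with
  | nil => simp [splits]
  | cons a Q ih =>
    intro p hp
    simp only [splits, List.mem_append, List.mem_map] at hp
    rcases hp with hp | ⟨p', hp', rfl⟩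
    · split_ifs at hp with ha
      · simp only [List.mem_singleton] at hp
        subst hp
        simp [h a ha]
      · simp at hp
    · have := ih p' hp'
      simp only [List.countP_cons]
      omega

theorem LoopData.weight_splitsList (D : LoopData L) {Y : L → Bool} (h : ∀ y, Y y → D.X y)
    {S : List (List L)} :
    ∀ p ∈ splitsList Y S, p.1.1.countP D.X + p.1.2.countP D.X + D.weight p.2 + 1
      = D.weight S := by
  induction S with
  | nil => simp [splitsList]
  | cons Q S ih =>
    intro p hp
    simp only [splitsList, List.mem_append, List.mem_map] at hp
    rcases hp with ⟨p', hp', rfl⟩ | ⟨p', hp', rfl⟩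
    · have := countP_splits h p' hp'
      simp only [weight_cons]
      omega
    · have := ih p' hp'
      simp only [weight_cons]
      omega

theorem tendsto_list_sum_map {α : Type*} (l : List α) {f : ℕ → α → ℂ} {g : α → ℂ}
    (h : ∀ a ∈ l, Tendsto (fun q => f q a) atTop (𝓝 (g a))) :
    Tendsto (fun q => (l.map (f q)).sum) atTop (𝓝 (l.map g).sum) := by
  induction l with
  | nil => simp
  | cons a l ih =>
    simp only [List.map_cons, List.sum_cons]
    exact (h a (by simp)).add (ih fun b hb => h b (by simp [hb]))

variable {D : LoopData L} {κ : ℕ → L → ℂ} {κ' : L → ℂ} {δ : ℕ → ℂ} {T : ℕ → List (List L) → ℂ}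

/-- A sequence of functions of lists of words that satisfies loop equations whose second order
term tends to zero. -/
structure LoopSequence (D : LoopData L) (κ : ℕ → L → ℂ) (κ' : L → ℂ) (δ : ℕ → ℂ)
    (T : ℕ → List (List L) → ℂ) : Prop where
  tendsto_κ : ∀ x, Tendsto (fun q => κ q x) atTop (𝓝 (κ' x))
  tendsto_δ : Tendsto δ atTop (𝓝 0)
  loop : ∀ᶠ q in atTop, D.Satisfies (κ q) (δ q) (T q)
  perm : ∀ q S S', S.Perm S' → T q S = T q S'
  rotate : ∀ q P Q S, T q ((P ++ Q) :: S) = T q ((Q ++ P) :: S)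

/-- The limit of the values at single words. -/
def limitOne (T : ℕ → List (List L) → ℂ) (Q : List L) : ℂ := limUnder atTop fun q => T q [Q]

/-- Every term on the right of the loop equation contains at most `n` letters from `X`: a split
consumes one letter of `X` and `η` puts back at most one. So all of them converge; the gluing terms
have a finite limit and are removed by `δ → 0`, and the remaining terms share the factor of the
untouched words `S`. -/
theorem LoopSequence.tendsto_cons (h : LoopSequence D κ κ' δ T) {ℓ : List L → ℂ} {n : ℕ}
    (ih : ∀ S, D.weight S ≤ n → Tendsto (fun q => T q S) atTop (𝓝 (S.map ℓ).prod))
    {x : L} {Q : List L} {S : List (List L)} (hx : D.X x)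
    (hw : Q.countP D.X + D.weight S ≤ n) :
    Tendsto (fun q => T q ((x :: Q) :: S)) atTop (𝓝 ((κ' x * ℓ Q +
      ((splits (D.Y x) Q).map fun p => ℓ (D.η x ++ p.1) * ℓ p.2).sum) * (S.map ℓ).prod)) := by
  have hη := D.countP_η x hx
  have h1 : Tendsto (fun q => κ q x * T q (Q :: S)) atTop (𝓝 (κ' x * (ℓ Q * (S.map ℓ).prod))) := by
    refine (h.tendsto_κ x).mul ?_
    simpa using ih (Q :: S) (by simpa using hw)
  have h2 : Tendsto (fun q => ((splits (D.Y x) Q).map fun p =>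
      T q ((D.η x ++ p.1) :: p.2 :: S)).sum) atTop (𝓝 ((splits (D.Y x) Q).map fun p =>
        ℓ (D.η x ++ p.1) * ℓ p.2 * (S.map ℓ).prod).sum) := by
    refine tendsto_list_sum_map _ fun p hp => ?_
    have := countP_splits (D.X_of_Y x · hx) p hp
    simpa [mul_assoc] using ih ((D.η x ++ p.1) :: p.2 :: S) (by
      simp only [LoopData.weight_cons, List.countP_append]; omega)
  have h3 : Tendsto (fun q => δ q * ((splitsList (D.Y x) S).map fun p =>
      T q ((D.η x ++ (Q ++ (p.1.2 ++ p.1.1))) :: p.2)).sum) atTop (𝓝 (0 *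
        ((splitsList (D.Y x) S).map fun p =>
          (((D.η x ++ (Q ++ (p.1.2 ++ p.1.1))) :: p.2).map ℓ).prod).sum)) := by
    refine h.tendsto_δ.mul (tendsto_list_sum_map _ fun p hp => ih _ ?_)
    have := D.weight_splitsList (D.X_of_Y x · hx) p hp
    simp only [LoopData.weight_cons, List.countP_append]
    omega
  have h4 := (h1.add h2).add h3
  rw [zero_mul, add_zero, List.sum_map_mul_right, ← mul_assoc, ← add_mul] at h4
  refine h4.congr' ?_
  filter_upwards [h.loop] with q hq
  exact (hq x Q S hx).symm

/-- A word with a letter in `X` can be rotated so that it begins with such a letter. -/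
theorem exists_append_cons_of_countP_pos {X : L → Bool} {Q : List L} (h : 0 < Q.countP X) :
    ∃ P x R, X x ∧ Q = P ++ x :: R := by
  obtain ⟨x, hx, hX⟩ := List.countP_pos_iff.1 h
  obtain ⟨P, R, rfl⟩ := List.append_of_mem hx
  exact ⟨P, x, R, hX, rfl⟩

/-- Induction on the number of letters from `X`. Some word contains such a letter; symmetry in the
words and cyclic invariance bring it to the front, where the loop equation applies. -/
theorem LoopSequence.tendsto_of_weight_le (h : LoopSequence D κ κ' δ T)
    (h0 : ∀ S, D.weight S = 0 →
      Tendsto (fun q => T q S) atTop (𝓝 (S.map (limitOne T)).prod)) (n : ℕ) :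
    ∀ S, D.weight S ≤ n → Tendsto (fun q => T q S) atTop (𝓝 (S.map (limitOne T)).prod) := by
  induction n with
  | zero => exact fun S hS => h0 S (by omega)
  | succ n ih =>
    intro S hS
    by_cases hS0 : D.weight S = 0
    · exact h0 S hS0
    obtain ⟨Q, hQ, hQ0⟩ : ∃ Q ∈ S, 0 < Q.countP D.X := by
      by_contra! hcon
      refine hS0 (List.sum_eq_zero fun a ha => ?_)
      obtain ⟨Q, hQ, rfl⟩ := List.mem_map.1 ha
      have := hcon Q hQ
      omega
    obtain ⟨P, x, R, hx, rfl⟩ := exists_append_cons_of_countP_pos hQ0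
    obtain ⟨S', hS'⟩ : ∃ S', ((P ++ x :: R) :: S').Perm S := by
      obtain ⟨S₁, S₂, rfl⟩ := List.append_of_mem hQ
      exact ⟨S₁ ++ S₂, List.perm_middle.symm⟩
    have hw : D.weight S = D.weight ((P ++ x :: R) :: S') :=
      ((hS'.map (List.countP D.X)).sum_eq).symm
    have hcount : (R ++ P).countP D.X + D.weight S' ≤ n := by
      rw [LoopData.weight_cons, List.countP_append, List.countP_cons] at hw
      simp only [hx, if_true] at hw
      rw [List.countP_append]
      omega
    have key := h.tendsto_cons ih hx hcount
    have key1 := h.tendsto_cons (S := []) ih hx (Q := R ++ P)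
      (by simp only [LoopData.weight_nil]; omega)
    have hT : ∀ q S', T q ((P ++ x :: R) :: S') = T q ((x :: (R ++ P)) :: S') := fun q S' =>
      h.rotate q P (x :: R) S'
    -- `limitOne` is a `limUnder`, which says nothing before convergence is known. The case without
    -- further words supplies it and identifies the first factor of the limit in `key`.
    have hl : limitOne T (P ++ x :: R) = κ' x * limitOne T (R ++ P) +
        ((splits (D.Y x) (R ++ P)).map fun p =>
          limitOne T (D.η x ++ p.1) * limitOne T p.2).sum := by
      refine Tendsto.limUnder_eq ?_
      simp_rw [hT]
      simpa using key1
    rw [← hl] at key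
    have hprod : (S.map (limitOne T)).prod
        = limitOne T (P ++ x :: R) * (S'.map (limitOne T)).prod := by
      rw [← (hS'.map (limitOne T)).prod_eq, List.map_cons, List.prod_cons]
    rw [hprod]
    refine key.congr fun q => ?_
    rw [← hT, h.perm q _ _ hS']

/-- If the values at lists of words without letters in `X` factorize in the limit, then so do
those at all lists of words, and the limits satisfy the loop equations. -/
theorem LoopSequence.tendsto (h : LoopSequence D κ κ' δ T)
    (h0 : ∀ S, D.weight S = 0 →
      Tendsto (fun q => T q S) atTop (𝓝 (S.map (limitOne T)).prod)) (S : List (List L)) :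
    Tendsto (fun q => T q S) atTop (𝓝 (S.map (limitOne T)).prod) :=
  h.tendsto_of_weight_le h0 _ S le_rfl

theorem LoopSequence.satisfiesOne (h : LoopSequence D κ κ' δ T)
    (h0 : ∀ S, D.weight S = 0 →
      Tendsto (fun q => T q S) atTop (𝓝 (S.map (limitOne T)).prod)) :
    D.SatisfiesOne κ' (limitOne T) := by
  intro x Q hx
  refine Tendsto.limUnder_eq ?_
  simpa using h.tendsto_cons (S := []) (fun S _ => h.tendsto h0 S) (n := Q.countP D.X) hx (by simp)

theorem LoopSequence.limitOne_rotate (h : LoopSequence D κ κ' δ T) (P Q : List L) :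
    limitOne T (P ++ Q) = limitOne T (Q ++ P) := by
  simp only [limitOne, h.rotate]

/-- The loop equations determine a cyclically invariant function from its values at the words
without letters in `X`. -/
theorem LoopData.SatisfiesOne.unique {ℓ ℓ' : List L → ℂ} (h : D.SatisfiesOne κ' ℓ)
    (h' : D.SatisfiesOne κ' ℓ') (hr : ∀ P Q, ℓ (P ++ Q) = ℓ (Q ++ P))
    (hr' : ∀ P Q, ℓ' (P ++ Q) = ℓ' (Q ++ P))
    (h0 : ∀ Q : List L, Q.countP D.X = 0 → ℓ Q = ℓ' Q) (Q : List L) : ℓ Q = ℓ' Q := by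
  induction hn : Q.countP D.X using Nat.strong_induction_on generalizing Q with
  | _ n ih =>
    rcases Nat.eq_zero_or_pos n with rfl | hpos
    · exact h0 Q hn
    obtain ⟨P, x, R, hx, rfl⟩ := exists_append_cons_of_countP_pos (hn ▸ hpos)
    have hη := D.countP_η x hx
    have hn' : (R ++ P).countP D.X < n := by
      rw [← hn]
      simp only [List.countP_append, List.countP_cons, hx, if_true]
      omega
    rw [hr, hr', List.cons_append, h _ _ hx, h' _ _ hx, ih _ hn' _ rfl]
    congr 2
    refine List.map_congr_left fun p hp => ?_
    have := countP_splits (D.X_of_Y x · hx) p hp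
    rw [ih _ (by rw [List.countP_append]; omega) (D.η x ++ p.1) rfl, ih _ (by omega) p.2 rfl]

end Loop

/-! ### Loop equations for matrices over a commutative ring -/

section MatrixLoop

variable {L R : Type*} [CommRing R] {N : ℕ}

/-- The product of the matrices `X l` along a word. -/
def wordMatrix (X : L → Matrix (Fin N) (Fin N) R) (Q : List L) : Matrix (Fin N) (Fin N) R :=
  (Q.map X).prod

theorem wordMatrix_append (X : L → Matrix (Fin N) (Fin N) R) (P Q : List L) :
    wordMatrix X (P ++ Q) = wordMatrix X P * wordMatrix X Q := by
  simp [wordMatrix]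

theorem wordMatrix_cons (X : L → Matrix (Fin N) (Fin N) R) (l : L) (Q : List L) :
    wordMatrix X (l :: Q) = X l * wordMatrix X Q := by
  simp [wordMatrix]

theorem sum_mul_wordMatrix (X : L → Matrix (Fin N) (Fin N) R) (P Q : List L) :
    ∑ i, ∑ j, wordMatrix X P j i * wordMatrix X Q i j = (wordMatrix X (P ++ Q)).trace := by
  rw [wordMatrix_append, Matrix.trace, Finset.sum_comm]
  simp [Matrix.mul_apply]

variable [Algebra ℂ R]

/-- The normalized trace of the matrix of a word. -/
def wordTrace (X : L → Matrix (Fin N) (Fin N) R) (Q : List L) : R :=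
  (N : ℂ)⁻¹ • (wordMatrix X Q).trace

/-- The functional `E` at the product of the normalized traces of several words. -/
def traceMoment (E : R →ₗ[ℂ] ℂ) (X : L → Matrix (Fin N) (Fin N) R) (S : List (List L)) : ℂ :=
  E (S.map (wordTrace X)).prod

theorem wordTrace_append_comm (X : L → Matrix (Fin N) (Fin N) R) (P Q : List L) :
    wordTrace X (P ++ Q) = wordTrace X (Q ++ P) := by
  rw [wordTrace, wordTrace, wordMatrix_append, wordMatrix_append, Matrix.trace_mul_comm]

theorem traceMoment_perm (E : R →ₗ[ℂ] ℂ) (X : L → Matrix (Fin N) (Fin N) R)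
    {S S' : List (List L)} (h : S.Perm S') : traceMoment E X S = traceMoment E X S' := by
  rw [traceMoment, traceMoment, (h.map _).prod_eq]

theorem traceMoment_rotate (E : R →ₗ[ℂ] ℂ) (X : L → Matrix (Fin N) (Fin N) R)
    (P Q : List L) (S : List (List L)) :
    traceMoment E X ((P ++ Q) :: S) = traceMoment E X ((Q ++ P) :: S) := by
  simp only [traceMoment, List.map_cons, wordTrace_append_comm X P Q]

theorem sum_list_sum_map {α ι M : Type*} [AddCommMonoid M] (s : Finset ι) (l : List α)
    (f : ι → α → M) : ∑ i ∈ s, (l.map (f i)).sum = (l.map fun a => ∑ i ∈ s, f i a).sum := by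
  induction l with
  | nil => simp
  | cons a l ih => simp [Finset.sum_add_distrib, ih]

variable {X : L → Matrix (Fin N) (Fin N) R} {Y : L → Bool} {η : List L}
  {𝒟 : Fin N → Fin N → Derivation ℂ R R}

/-- The derivation replaces a letter in `Y` by the matrix `η E_{ji}`, with `E_{ji}` a matrix unit.
By the Leibniz rule it cuts the word there, and the two pieces become separate matrix entries. -/
theorem derivation_wordMatrix (h𝒟 : ∀ i j l a b, 𝒟 i j (X l a b) =
      if Y l then wordMatrix X η a j * (1 : Matrix (Fin N) (Fin N) R) i b else 0)
    (i j a b : Fin N) (Q : List L) :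
    𝒟 i j (wordMatrix X Q a b) = ((splits Y Q).map fun p =>
      wordMatrix X (p.1 ++ η) a j * wordMatrix X p.2 i b).sum := by
  induction Q generalizing a b with
  | nil =>
    have : wordMatrix X [] a b = algebraMap ℂ R (if a = b then 1 else 0) := by
      simp only [wordMatrix, List.map_nil, List.prod_nil, Matrix.one_apply]
      split_ifs <;> simp
    rw [this, Derivation.map_algebraMap]
    simp [splits]
  | cons l Q ih =>
    rw [wordMatrix_cons, Matrix.mul_apply, map_sum]
    simp only [Derivation.leibniz, ih, h𝒟, smul_eq_mul, Finset.sum_add_distrib, splits,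
      List.map_append, List.sum_append, List.map_map]
    rw [add_comm]
    congr 1
    · split_ifs with hl
      · simp only [List.map_cons, List.map_nil, List.sum_cons, List.sum_nil, add_zero,
          List.nil_append]
        rw [Finset.sum_eq_single i]
        · simp [mul_comm]
        · intro c _ hc
          simp [Matrix.one_apply_ne hc.symm]
        · simp
      · simp
    · simp_rw [← List.sum_map_mul_left]
      rw [sum_list_sum_map]
      congr 1
      refine List.map_congr_left fun p _ => ?_
      simp only [Function.comp_apply, List.cons_append, wordMatrix_cons, Matrix.mul_apply,
        Finset.sum_mul, mul_assoc]

/-- The trace joins the outer ends of the two pieces, so one open word with free indices `i`, `j`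
remains. -/
theorem derivation_wordTrace (h𝒟 : ∀ i j l a b, 𝒟 i j (X l a b) =
      if Y l then wordMatrix X η a j * (1 : Matrix (Fin N) (Fin N) R) i b else 0)
    (i j : Fin N) (Q : List L) :
    𝒟 i j (wordTrace X Q) = ((splits Y Q).map fun p =>
      (N : ℂ)⁻¹ • wordMatrix X (p.2 ++ (p.1 ++ η)) i j).sum := by
  rw [wordTrace, Derivation.map_smul, Matrix.trace, map_sum]
  simp only [Matrix.diag_apply, derivation_wordMatrix h𝒟]
  rw [sum_list_sum_map, List.smul_sum, List.map_map]
  congr 1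
  refine List.map_congr_left fun p _ => ?_
  rw [wordMatrix_append, Matrix.mul_apply, Function.comp_apply]
  congr 1
  exact Finset.sum_congr rfl fun a _ => mul_comm _ _

theorem derivation_prod_wordTrace (h𝒟 : ∀ i j l a b, 𝒟 i j (X l a b) =
      if Y l then wordMatrix X η a j * (1 : Matrix (Fin N) (Fin N) R) i b else 0)
    (i j : Fin N) (S : List (List L)) :
    𝒟 i j (S.map (wordTrace X)).prod = ((splitsList Y S).map fun p =>
      (N : ℂ)⁻¹ • (wordMatrix X (p.1.2 ++ (p.1.1 ++ η)) i j *
        (p.2.map (wordTrace X)).prod)).sum := by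
  induction S with
  | nil => simp [splitsList]
  | cons Q S ih =>
    rw [List.map_cons, List.prod_cons, Derivation.leibniz, ih, derivation_wordTrace h𝒟, splitsList,
      List.map_append, List.sum_append, add_comm, List.map_map, List.map_map, smul_eq_mul,
      smul_eq_mul, ← List.sum_map_mul_left, ← List.sum_map_mul_left]
    congr 2
    · refine List.map_congr_left fun p _ => ?_
      simp only [Function.comp_apply, mul_smul_comm, mul_comm]
    · refine List.map_congr_left fun p _ => ?_
      simp only [Function.comp_apply, mul_smul_comm, List.map_cons, List.prod_cons]
      congr 1
      ring

/-- Integration by parts with respect to the matrix `X x` implies the loop equations. -/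
theorem traceMoment_cons (hN : N ≠ 0) {E : R →ₗ[ℂ] ℂ} {x : L} {κ : ℂ}
    (hE : ∀ i j p, E (X x i j * p) =
      κ * E ((1 : Matrix (Fin N) (Fin N) R) i j * p) + (N : ℂ)⁻¹ * E (𝒟 i j p))
    (h𝒟 : ∀ i j l a b, 𝒟 i j (X l a b) =
      if Y l then wordMatrix X η a j * (1 : Matrix (Fin N) (Fin N) R) i b else 0)
    (Q : List L) (S : List (List L)) :
    traceMoment E X ((x :: Q) :: S) = κ * traceMoment E X (Q :: S) +
      ((splits Y Q).map fun p => traceMoment E X ((η ++ p.1) :: p.2 :: S)).sum +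
      ((N : ℂ) ^ 2)⁻¹ * ((splitsList Y S).map fun p =>
        traceMoment E X ((η ++ (Q ++ (p.1.2 ++ p.1.1))) :: p.2)).sum := by
  have hN' : (N : ℂ) ≠ 0 := Nat.cast_ne_zero.2 hN
  set t := (S.map (wordTrace X)).prod with ht
  have h0 : traceMoment E X ((x :: Q) :: S) =
      (N : ℂ)⁻¹ * ∑ i, ∑ j, E (X x i j * (wordMatrix X Q j i * t)) := by
    simp only [traceMoment, List.map_cons, List.prod_cons, wordTrace, wordMatrix_cons]
    rw [smul_mul_assoc, map_smul, smul_eq_mul, Matrix.trace]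
    simp only [Matrix.diag_apply, Matrix.mul_apply, Finset.sum_mul, map_sum, mul_assoc]
    rfl
  have h1 : ∑ i, ∑ j, E ((1 : Matrix (Fin N) (Fin N) R) i j * (wordMatrix X Q j i * t)) =
      N * traceMoment E X (Q :: S) := by
    simp only [traceMoment, List.map_cons, List.prod_cons, wordTrace]
    rw [smul_mul_assoc, map_smul, smul_eq_mul, mul_inv_cancel_left₀ hN', Matrix.trace,
      Finset.sum_mul, map_sum]
    refine Finset.sum_congr rfl fun i _ => ?_
    rw [Finset.sum_eq_single i]
    · simp [ht]
    · intro j _ hj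
      simp [Matrix.one_apply_ne hj.symm]
    · simp
  -- The sums over `i` and `j` close both pieces of the cut word to traces. Normalizing these gives
  -- `N²`, which cancels one `N⁻¹` from the trace and one from the integration by parts.
  have h2 : ∑ i, ∑ j, E (t * 𝒟 i j (wordMatrix X Q j i)) = (N : ℂ) ^ 2 *
      ((splits Y Q).map fun p => traceMoment E X ((η ++ p.1) :: p.2 :: S)).sum := by
    simp only [derivation_wordMatrix h𝒟, ← List.sum_map_mul_left, map_list_sum, List.map_map]
    simp_rw [sum_list_sum_map]
    congr 1
    refine List.map_congr_left fun p _ => ?_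
    simp only [Function.comp_apply, ← map_sum, traceMoment, List.map_cons, List.prod_cons]
    rw [wordTrace_append_comm, ← smul_eq_mul, ← map_smul]
    congr 1
    simp only [wordTrace, smul_mul_assoc, mul_smul_comm, smul_smul]
    rw [show (N : ℂ) ^ 2 * ((N : ℂ)⁻¹ * (N : ℂ)⁻¹) = 1 by field_simp, one_smul, Matrix.trace,
      Matrix.trace, ← mul_assoc, Finset.sum_mul_sum, mul_comm, Finset.mul_sum, Finset.sum_comm]
    refine Finset.sum_congr rfl fun i _ => ?_
    rw [Finset.mul_sum]
    rfl
  -- Here another trace is cut open and glued to `Q`. Only one trace arises and its normalization is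
  -- already contained in the derivative, so both prefactors `N⁻¹` survive.
  have h3 : ∑ i, ∑ j, E (wordMatrix X Q j i * 𝒟 i j t) =
      ((splitsList Y S).map fun p =>
        traceMoment E X ((η ++ (Q ++ (p.1.2 ++ p.1.1))) :: p.2)).sum := by
    simp only [ht, derivation_prod_wordTrace h𝒟, ← List.sum_map_mul_left, map_list_sum,
      List.map_map]
    simp_rw [sum_list_sum_map]
    congr 1
    refine List.map_congr_left fun p _ => ?_
    simp only [Function.comp_apply, ← map_sum, traceMoment, List.map_cons, List.prod_cons]
    rw [wordTrace_append_comm]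
    congr 1
    simp only [mul_smul_comm, ← Finset.smul_sum, ← mul_assoc, ← Finset.sum_mul,
      sum_mul_wordMatrix, wordTrace, smul_mul_assoc, List.append_assoc]
  rw [h0]
  simp only [hE, Derivation.leibniz, smul_eq_mul, map_add, Finset.sum_add_distrib,
    ← Finset.mul_sum, h1, mul_add, h2, h3]
  field_simp
  ring

end MatrixLoop

/-! ### Integration by parts for Gaussian random variables -/

section Moments

variable {Ω : Type*} [MeasurableSpace Ω] {P : Measure Ω}

/-- Functions that belong to `L^p` for all finite `p`. -/
def HasAllMoments (P : Measure Ω) (f : Ω → ℂ) : Prop :=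
  ∀ p : ENNReal, p ≠ ⊤ → MemLp f p P

theorem HasAllMoments.mul {f g : Ω → ℂ} (hf : HasAllMoments P f) (hg : HasAllMoments P g) :
    HasAllMoments P fun ω => f ω * g ω := by
  intro p hp
  have h2 : 2 * p ≠ ⊤ := ENNReal.mul_ne_top (by simp) hp
  have : ENNReal.HolderTriple (2 * p) (2 * p) p := ⟨by
    rw [ENNReal.mul_inv (by simp) (by simp), ← add_mul, ENNReal.inv_two_add_inv_two, one_mul]⟩
  exact (hg _ h2).mul' (hf _ h2)

theorem HasAllMoments.add {f g : Ω → ℂ} (hf : HasAllMoments P f) (hg : HasAllMoments P g) :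
    HasAllMoments P fun ω => f ω + g ω := fun p hp => (hf p hp).add (hg p hp)

theorem hasAllMoments_const [IsFiniteMeasure P] (c : ℂ) : HasAllMoments P fun _ => c :=
  fun _ _ => memLp_const c

theorem HasAllMoments.integrable {f : Ω → ℂ} (hf : HasAllMoments P f) : Integrable f P :=
  memLp_one_iff_integrable.1 (hf 1 (by simp))

theorem hasAllMoments_mvPolynomial [IsFiniteMeasure P] {V : Type*} {x : V → Ω → ℂ}
    (hx : ∀ v, HasAllMoments P (x v)) (p : MvPolynomial V ℂ) :
    HasAllMoments P fun ω => MvPolynomial.aeval (fun v => x v ω) p := by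
  induction p using MvPolynomial.induction_on with
  | C a => simpa using hasAllMoments_const a
  | add p q hp hq => simpa using hp.add hq
  | mul_X p v hp => simpa using hp.mul (hx v)

theorem iteratedDeriv_id_mul {f : ℝ → ℝ} (hf : ContDiff ℝ ⊤ f) (n : ℕ) :
    iteratedDeriv n (fun t => t * f t) =
      fun t => t * iteratedDeriv n f t + n * iteratedDeriv (n - 1) f t := by
  have hd : ∀ k, Differentiable ℝ (iteratedDeriv k f) := fun k =>
    hf.differentiable_iteratedDeriv k (WithTop.natCast_lt_top k)
  induction n with
  | zero => ext t; simp
  | succ n ih =>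
    rw [iteratedDeriv_succ, ih]
    ext t
    have h1 : HasDerivAt (fun t => t * iteratedDeriv n f t)
        (1 * iteratedDeriv n f t + t * iteratedDeriv (n + 1) f t) t := by
      have := (hd n t).hasDerivAt
      rw [← iteratedDeriv_succ] at this
      exact (hasDerivAt_id t).mul this
    have h2 : HasDerivAt (fun t => (n : ℝ) * iteratedDeriv (n - 1) f t)
        (n * iteratedDeriv n f t) t := by
      rcases Nat.eq_zero_or_pos n with rfl | hn
      · simpa using hasDerivAt_const t (0 : ℝ)
      · have := (hd (n - 1) t).hasDerivAt
        rw [← iteratedDeriv_succ, Nat.sub_add_cancel hn] at this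
        exact this.const_mul _
    rw [show deriv (fun t => t * iteratedDeriv n f t + n * iteratedDeriv (n - 1) f t) t = _ from
      (h1.add h2).deriv]
    rw [Nat.add_sub_cancel]
    push_cast
    ring

/-- The moments are the derivatives at zero of `m(t) = exp(v t² / 2)`, and `m' = v t m`;
differentiate this `n` times at `0`. For `n = 0` the truncated exponent is harmless because its
coefficient vanishes. -/
theorem integral_pow_succ_gaussianReal (v : NNReal) (n : ℕ) :
    ∫ x, x ^ (n + 1) ∂gaussianReal 0 v = v * n * ∫ x, x ^ (n - 1) ∂gaussianReal 0 v := by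
  have h0 : (0 : ℝ) ∈ interior (integrableExpSet id (gaussianReal 0 v)) := by simp
  have hm : ∀ k : ℕ, ∫ x, x ^ k ∂gaussianReal 0 v
      = iteratedDeriv k (fun t : ℝ => Real.exp (v * t ^ 2 / 2)) 0 := by
    intro k
    have := iteratedDeriv_mgf_zero h0 k
    rw [mgf_id_gaussianReal] at this
    simpa using this.symm
  rw [hm, hm, iteratedDeriv_succ']
  have hd : deriv (fun t : ℝ => Real.exp (v * t ^ 2 / 2))
      = fun t => (v : ℝ) * (t * Real.exp (v * t ^ 2 / 2)) := by
    ext t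
    have h1 : HasDerivAt (fun t : ℝ => v * t ^ 2 / 2) (v * t) t := by
      have := ((hasDerivAt_pow 2 t).const_mul (v : ℝ)).div_const 2
      exact this.congr_deriv (by simp; ring)
    rw [h1.exp.deriv]
    ring
  have hsm : ContDiff ℝ ⊤ fun t : ℝ => Real.exp (v * t ^ 2 / 2) := by fun_prop
  have hc : iteratedDeriv n (fun t : ℝ => (v : ℝ) * (t * Real.exp (v * t ^ 2 / 2))) 0
      = v * iteratedDeriv n (fun t : ℝ => t * Real.exp (v * t ^ 2 / 2)) 0 := by
    rw [iteratedDeriv_const_mul_field]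
  rw [hd, hc, iteratedDeriv_id_mul hsm]
  simp
  ring

end Moments

section Stein

open MvPolynomial

variable {Ω : Type*} [MeasurableSpace Ω] {P : Measure Ω} {V : Type*} {x : V → Ω → ℝ} {v : NNReal}

theorem hasAllMoments_of_gaussian {y : Ω → ℝ} (hm : Measurable y)
    (hy : P.map y = gaussianReal 0 v) : HasAllMoments P fun ω => (y ω : ℂ) := by
  intro p hp
  have h : MemLp id p (P.map y) := by rw [hy]; exact memLp_id_gaussianReal' p hp
  exact ((memLp_map_measure_iff (by fun_prop) hm.aemeasurable).1 h).ofReal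

/-- Independence factorizes the integral. The set `s` may exceed the support, the additional factors
being `1`, so that two monomials that differ in one variable can be compared over the same product.
-/
theorem integral_monomial (hm : ∀ i, Measurable (x i)) (hx : ∀ i, P.map (x i) = gaussianReal 0 v)
    (hi : iIndepFun x P) (s : Finset V) (m : V →₀ ℕ) (hs : m.support ⊆ s) :
    ∫ ω, aeval (fun i => (x i ω : ℂ)) (monomial m (1 : ℂ)) ∂P
      = ∏ i ∈ s, ((∫ y, y ^ m i ∂gaussianReal 0 v : ℝ) : ℂ) := by
  have h1 : ∀ ω, aeval (fun i => (x i ω : ℂ)) (monomial m (1 : ℂ))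
      = ((∏ i : s, x i ω ^ m i : ℝ) : ℂ) := by
    intro ω
    rw [aeval_monomial, map_one, one_mul, Finsupp.prod_of_support_subset _ hs _ (by simp)]
    push_cast
    rw [Finset.prod_coe_sort s fun i => (x i ω : ℂ) ^ m i]
  simp_rw [h1]
  rw [integral_complex_ofReal, (hi.precomp (g := fun i : s => (i : V)) Subtype.val_injective
    ).integral_fun_prod_comp (f := fun (i : s) (y : ℝ) => y ^ m i) (fun i => (hm i).aemeasurable)
      (fun i => by fun_prop), ← Finset.prod_coe_sort s]
  push_cast
  refine Finset.prod_congr rfl fun i _ => ?_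
  rw [← hx i, integral_map (hm i).aemeasurable (by fun_prop)]

variable [IsProbabilityMeasure P]

/-- Integration by parts for polynomials in independent centred real Gaussian variables. -/
theorem integral_X_mul (hm : ∀ i, Measurable (x i)) (hx : ∀ i, P.map (x i) = gaussianReal 0 v)
    (hi : iIndepFun x P) (j : V) (p : MvPolynomial V ℂ) :
    ∫ ω, aeval (fun i => (x i ω : ℂ)) (X j * p) ∂P
      = v * ∫ ω, aeval (fun i => (x i ω : ℂ)) (pderiv j p) ∂P := by
  classical
  have hint : ∀ p : MvPolynomial V ℂ, Integrable (fun ω => aeval (fun i => (x i ω : ℂ)) p) P :=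
    fun p => (hasAllMoments_mvPolynomial
      (fun i => hasAllMoments_of_gaussian (hm i) (hx i)) p).integrable
  induction p using MvPolynomial.induction_on' with
  | add p q hp hq =>
    rw [mul_add, map_add]
    simp_rw [map_add (aeval _)]
    rw [integral_add (hint _) (hint _), integral_add (hint _) (hint _), hp, hq, mul_add]
  | monomial m a =>
    have h1 : X j * monomial m a = a • monomial (m + Finsupp.single j 1) (1 : ℂ) := by
      rw [X, monomial_mul, smul_monomial]
      simp [add_comm]
    have h2 : pderiv j (monomial m a)
        = (a * m j) • monomial (m - Finsupp.single j 1) (1 : ℂ) := by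
      rw [pderiv_monomial, smul_monomial]
      simp
    have hs : m.support ⊆ insert j m.support := Finset.subset_insert _ _
    rw [h1, h2]
    simp only [map_smul, smul_eq_mul]
    rw [integral_const_mul, integral_const_mul,
      integral_monomial hm hx hi (insert j m.support) _ ?_,
      integral_monomial hm hx hi (insert j m.support) _ ?_,
      ← Finset.mul_prod_erase _ _ (Finset.mem_insert_self j _),
      ← Finset.mul_prod_erase _ _ (Finset.mem_insert_self j _)]
    · have hprod : ∀ m' : V →₀ ℕ, (∀ i, i ≠ j → m' i = m i) →
          ∏ i ∈ (insert j m.support).erase j, ((∫ y, y ^ m' i ∂gaussianReal 0 v : ℝ) : ℂ)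
          = ∏ i ∈ (insert j m.support).erase j, ((∫ y, y ^ m i ∂gaussianReal 0 v : ℝ) : ℂ) :=
        fun m' h => Finset.prod_congr rfl fun i hi => by rw [h i (Finset.ne_of_mem_erase hi)]
      rw [hprod (m + Finsupp.single j 1) (fun i hi => by simp [hi.symm]),
        hprod (m - Finsupp.single j 1) (fun i hi => by simp [hi.symm])]
      simp only [Finsupp.add_apply, Finsupp.single_eq_same, Finsupp.tsub_apply]
      -- All variables other than `j` give equal factors on both sides, and the one-dimensional
      -- recursion remains. If `m j = 0`, the coefficient of the truncated power is zero.
      rw [integral_pow_succ_gaussianReal]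
      push_cast
      ring
    · exact (Finsupp.support_tsub).trans hs
    · refine Finsupp.support_add.trans (Finset.union_subset hs ?_)
      exact Finsupp.support_single_subset.trans (by simp)

end Stein

/-! ### Polynomials in complex Gaussian variables -/

section ComplexGaussian

open MvPolynomial

variable {Λ : Type*}

/-- `I` or `-I`, the coefficient of the imaginary part in a variable or its conjugate. -/
def imUnit (ε : Bool) : ℂ := if ε then -Complex.I else Complex.I

/-- The complex variable with index `a` (for `ε = false`) or its conjugate, as a polynomial in
its real and imaginary part. -/
def cvar (a : Λ) (ε : Bool) : MvPolynomial (Λ ⊕ Λ) ℂ := X (.inl a) + C (imUnit ε) * X (.inr a)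

/-- The Wirtinger derivative with respect to the conjugate of `cvar a ε`. -/
def cderiv (a : Λ) (ε : Bool) :
    Derivation ℂ (MvPolynomial (Λ ⊕ Λ) ℂ) (MvPolynomial (Λ ⊕ Λ) ℂ) :=
  (1 / 2 : ℂ) • (pderiv (.inl a) + imUnit ε • pderiv (.inr a))

theorem cderiv_cvar_self (a : Λ) (ε : Bool) : cderiv a ε (cvar a (!ε)) = 1 := by
  classical
  simp only [cderiv, cvar, Derivation.smul_apply, Derivation.add_apply, map_add, pderiv_C_mul,
    smul_add, smul_eq_C_mul,
    pderiv_X_self, pderiv_X_of_ne (show Sum.inr a ≠ Sum.inl a by simp),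
    pderiv_X_of_ne (show Sum.inl a ≠ Sum.inr a by simp), mul_zero, add_zero, zero_add, mul_one]
  rw [← C_1, ← C_mul, ← C_mul, ← C_add]
  cases ε <;> norm_num [imUnit]

theorem cderiv_cvar_of_ne {a b : Λ} {ε ε' : Bool} (h : ¬(a = b ∧ ε' = !ε)) :
    cderiv a ε (cvar b ε') = 0 := by
  classical
  by_cases hab : a = b
  · subst hab
    have hε : ε' = ε := by cases ε <;> cases ε' <;> simp_all
    subst hε
    simp only [cderiv, cvar, Derivation.smul_apply, Derivation.add_apply, map_add, pderiv_C_mul,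
      smul_add, smul_eq_C_mul,
      pderiv_X_self, pderiv_X_of_ne (show Sum.inr a ≠ Sum.inl a by simp),
      pderiv_X_of_ne (show Sum.inl a ≠ Sum.inr a by simp), mul_zero, add_zero, zero_add, mul_one]
    rw [← C_mul, ← C_mul, ← C_add, ← C_0]
    cases ε' <;> norm_num [imUnit]
  · have h1 : (Sum.inl b : Λ ⊕ Λ) ≠ Sum.inl a := by simpa using Ne.symm hab
    have h2 : (Sum.inr b : Λ ⊕ Λ) ≠ Sum.inr a := by simpa using Ne.symm hab
    simp only [cderiv, cvar, Derivation.smul_apply, Derivation.add_apply, map_add, pderiv_C_mul,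
      pderiv_X_of_ne h1, pderiv_X_of_ne h2, pderiv_X_of_ne (show Sum.inr b ≠ Sum.inl a by simp),
      pderiv_X_of_ne (show Sum.inl b ≠ Sum.inr a by simp), mul_zero, add_zero, smul_zero]

theorem cderiv_cvar [DecidableEq Λ] (a b : Λ) (ε ε' : Bool) :
    cderiv a ε (cvar b ε') = if a = b ∧ ε' = !ε then 1 else 0 := by
  split_ifs with h
  · obtain ⟨rfl, rfl⟩ := h
    exact cderiv_cvar_self a ε
  · exact cderiv_cvar_of_ne h

variable {Ω : Type*} {f : Λ → Ω → ℂ}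

/-- Evaluation of polynomials at the values of a family of complex random variables. -/
def evalAt (f : Λ → Ω → ℂ) (ω : Ω) : MvPolynomial (Λ ⊕ Λ) ℂ →ₐ[ℂ] ℂ :=
  aeval fun i => ((Sum.elim (fun i ω => (f i ω).re) (fun i ω => (f i ω).im) i ω : ℝ) : ℂ)

theorem evalAt_cvar_false (ω : Ω) (a : Λ) : evalAt f ω (cvar a false) = f a ω := by
  simp [evalAt, cvar, imUnit, mul_comm Complex.I]

theorem evalAt_cvar_true (ω : Ω) (a : Λ) : evalAt f ω (cvar a true) = star (f a ω) := by
  rw [Complex.ext_iff]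
  simp [evalAt, cvar, imUnit]

variable [MeasurableSpace Ω] {P : Measure Ω}

theorem IsIndepComplexGaussian.measurable_elim (hf : IsIndepComplexGaussian P f) (i : Λ ⊕ Λ) :
    Measurable (Sum.elim (fun i ω => (f i ω).re) (fun i ω => (f i ω).im) i) := by
  rcases i with i | i
  · exact Complex.measurable_re.comp (hf.measurable i)
  · exact Complex.measurable_im.comp (hf.measurable i)

theorem IsIndepComplexGaussian.map_elim (hf : IsIndepComplexGaussian P f) (i : Λ ⊕ Λ) :
    P.map (Sum.elim (fun i ω => (f i ω).re) (fun i ω => (f i ω).im) i)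
      = gaussianReal 0 (1 / 2) := by
  rcases i with i | i
  · exact hf.map_re i
  · exact hf.map_im i

variable [IsProbabilityMeasure P]

theorem IsIndepComplexGaussian.hasAllMoments_evalAt (hf : IsIndepComplexGaussian P f)
    (p : MvPolynomial (Λ ⊕ Λ) ℂ) : HasAllMoments P fun ω => evalAt f ω p :=
  hasAllMoments_mvPolynomial
    (fun i => hasAllMoments_of_gaussian (hf.measurable_elim i) (hf.map_elim i)) p

/-- The expectation of polynomials in complex Gaussian variables. -/
def gaussianExp (hf : IsIndepComplexGaussian P f) : MvPolynomial (Λ ⊕ Λ) ℂ →ₗ[ℂ] ℂ where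
  toFun p := ∫ ω, evalAt f ω p ∂P
  map_add' p q := by
    simp only [map_add]
    exact integral_add (hf.hasAllMoments_evalAt p).integrable (hf.hasAllMoments_evalAt q).integrable
  map_smul' c p := by
    simp only [map_smul, smul_eq_mul, RingHom.id_apply]
    exact integral_const_mul _ _

theorem gaussianExp_one (hf : IsIndepComplexGaussian P f) : gaussianExp hf 1 = 1 := by
  simp [gaussianExp]

/-- Integration by parts for polynomials in independent complex Gaussian variables. -/
theorem gaussianExp_cvar_mul (hf : IsIndepComplexGaussian P f) (a : Λ) (ε : Bool)
    (p : MvPolynomial (Λ ⊕ Λ) ℂ) :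
    gaussianExp hf (cvar a ε * p) = gaussianExp hf (cderiv a ε p) := by
  -- The variance `1 / 2` is exactly the prefactor of the Wirtinger derivative, so no constant
  -- remains in the complex formula.
  have h : ∀ i p, gaussianExp hf (X i * p) = (1 / 2 : ℂ) * gaussianExp hf (pderiv i p) := by
    intro i p
    have := integral_X_mul hf.measurable_elim hf.map_elim hf.indep i p
    simpa [gaussianExp, evalAt] using this
  have h1 : cvar a ε * p = X (.inl a) * p + imUnit ε • (X (.inr a) * p) := by
    rw [cvar, smul_eq_C_mul]
    ring
  rw [h1, map_add, map_smul, h, h, cderiv]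
  simp only [Derivation.smul_apply, Derivation.add_apply, map_smul, map_add, smul_eq_mul]
  ring

end ComplexGaussian

/-! ### The polynomial models of the random matrices -/

section Models

open MvPolynomial

/-- The letters: `(.inl r, ε)` stands for the permutation matrix `U_r` or its adjoint and
`(.inr r, ε)` for the Gaussian or Wishart matrix with index `r` or its adjoint. -/
abbrev Letter (s : ℕ) := (Fin s ⊕ Fin s) × Bool

/-- Polynomials in the real and imaginary parts of the Gaussian variables. -/
abbrev GaussPoly (s : ℕ) := MvPolynomial ((Fin s × ℕ × ℕ) ⊕ (Fin s × ℕ × ℕ)) ℂ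

variable {s N : ℕ}

/-- The index of the variable at the place `(i, j)` of a Gaussian matrix or of its adjoint. -/
def entryIndex (r : Fin s) (ε : Bool) (i j : ℕ) : Fin s × ℕ × ℕ :=
  if ε then (r, j, i) else (r, i, j)

/-- Permutation matrices as constant matrices of polynomials. -/
def permPoly (σ : Fin s → Equiv.Perm (Fin N)) (r : Fin s) (ε : Bool) :
    Matrix (Fin N) (Fin N) (GaussPoly s) :=
  (starIf (permMat (σ r)) ε).map C

/-- The permutation matrices of `σ` and the normalized Gaussian matrices. -/
def circularModel (N : ℕ) (σ : Fin s → Equiv.Perm (Fin N)) :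
    Letter s → Matrix (Fin N) (Fin N) (GaussPoly s)
  | (.inl r, ε) => permPoly σ r ε
  | (.inr r, ε) => Matrix.of fun i j =>
      ((1 / Real.sqrt N : ℝ) : ℂ) • cvar (entryIndex r ε i j) ε

/-- The permutation matrices of `σ` and the Wishart matrices. -/
def wishartModel (M N : ℕ) (σ : Fin s → Equiv.Perm (Fin N)) :
    Letter s → Matrix (Fin N) (Fin N) (GaussPoly s)
  | (.inl r, ε) => permPoly σ r ε
  | (.inr r, _) => Matrix.of fun i j =>
      (N : ℂ)⁻¹ • ∑ k : Fin M, cvar (r, (k : ℕ), (i : ℕ)) true * cvar (r, (k : ℕ), (j : ℕ)) false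

/-- The loop equations of the Gaussian matrices. -/
def circularLoop (s : ℕ) : LoopData (Letter s) where
  X l := l.1.isRight
  Y x l := decide (l = (x.1, !x.2))
  η _ := []
  X_of_Y := by
    intro x y hx hy
    simp only [decide_eq_true_eq] at hy
    simpa [hy] using hx
  countP_η := by simp

/-- The loop equations of the Wishart matrices. -/
def wishartLoop (s : ℕ) : LoopData (Letter s) where
  X l := l.1.isRight
  Y x l := decide (l.1 = x.1)
  η x := [x]
  X_of_Y := by
    intro x y hx hy
    simp only [decide_eq_true_eq] at hy
    simpa [hy] using hx
  countP_η x _ := List.countP_le_length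

/-- The coefficient of the first order term in the loop equations of the Wishart matrices. -/
def wishartCoeff (c : ℂ) (_ : Letter s) : ℂ := c

variable {Ω : Type*} [MeasurableSpace Ω] {P : Measure Ω} [IsProbabilityMeasure P]
  {f : Fin s × ℕ × ℕ → Ω → ℂ}

theorem derivation_permPoly (D : Derivation ℂ (GaussPoly s) (GaussPoly s))
    (σ : Fin s → Equiv.Perm (Fin N)) (r : Fin s) (ε : Bool) (a b : Fin N) :
    D (permPoly σ r ε a b) = 0 := by
  rw [permPoly, Matrix.map_apply, ← algebraMap_eq, Derivation.map_algebraMap]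

/-- Integration by parts in an entry of a Gaussian letter differentiates with respect to its
conjugate, so only the adjoint letter with the same index is hit, and nothing is inserted at the
cut. Writing `1/√N = N⁻¹ √N` provides the prefactor `N⁻¹`, while the `√N` put into the derivation
cancels the scaling of the entry that it hits. -/
theorem circularModel_satisfies (hf : IsIndepComplexGaussian P f) (hN : N ≠ 0)
    (σ : Fin s → Equiv.Perm (Fin N)) :
    (circularLoop s).Satisfies 0 ((N : ℂ) ^ 2)⁻¹
      (traceMoment (gaussianExp hf) (circularModel N σ)) := by
  rintro ⟨r | r, ε⟩ Q S hx
  · simp [circularLoop] at hx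
  have hsq : ((1 / Real.sqrt N : ℝ) : ℂ) = (N : ℂ)⁻¹ * ((Real.sqrt N : ℝ) : ℂ) := by
    rw [← Complex.ofReal_natCast, ← Complex.ofReal_inv, ← Complex.ofReal_mul, one_div,
      Complex.ofReal_inj]
    have h1 : Real.sqrt N * Real.sqrt N = N := Real.mul_self_sqrt (Nat.cast_nonneg N)
    have h2 : Real.sqrt N ≠ 0 := by
      rw [Real.sqrt_ne_zero']
      exact_mod_cast Nat.pos_of_ne_zero hN
    have h3 : (N : ℝ) ≠ 0 := Nat.cast_ne_zero.2 hN
    field_simp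
    rw [sq, h1]
  have hsq1 : ((Real.sqrt N : ℝ) : ℂ) * ((1 / Real.sqrt N : ℝ) : ℂ) = 1 := by
    rw [← Complex.ofReal_mul, mul_one_div_cancel, Complex.ofReal_one]
    rw [Real.sqrt_ne_zero']
    exact_mod_cast Nat.pos_of_ne_zero hN
  refine traceMoment_cons (κ := 0) (Y := (circularLoop s).Y (Sum.inr r, ε)) (η := [])
    (𝒟 := fun i j => ((Real.sqrt N : ℝ) : ℂ) • cderiv (entryIndex r ε i j) ε) hN ?_ ?_ Q S
  · intro i j p
    simp only [circularModel, Matrix.of_apply, smul_mul_assoc, map_smul, gaussianExp_cvar_mul,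
      Derivation.smul_apply, smul_eq_mul, zero_mul, zero_add]
    rw [hsq, mul_assoc]
  · rintro i j ⟨r' | r', ε'⟩ a b
    · rw [circularModel, derivation_permPoly, if_neg (by simp [circularLoop])]
    · have h1 : ((((Real.sqrt N : ℝ) : ℂ) • cderiv (entryIndex r ε i j) ε :
          Derivation ℂ (GaussPoly s) (GaussPoly s)) (circularModel N σ (Sum.inr r', ε') a b)) =
          if entryIndex r ε i j = entryIndex r' ε' a b ∧ ε' = !ε then 1 else 0 := by
        rw [circularModel, Matrix.of_apply, Derivation.smul_apply, Derivation.map_smul, smul_smul,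
          hsq1, one_smul, cderiv_cvar]
      rw [h1]
      simp only [circularLoop, decide_eq_true_eq, Prod.mk.injEq, Sum.inr.injEq, wordMatrix,
        List.map_nil, List.prod_nil, Matrix.one_apply, mul_ite, mul_one, mul_zero, ← ite_and]
      refine if_congr ?_ rfl rfl
      cases ε <;> cases ε' <;> simp [entryIndex, Fin.val_inj] <;> grind

theorem derivation_sum_apply {ι R : Type*} [CommRing R] [Algebra ℂ R] (t : Finset ι)
    (D : ι → Derivation ℂ R R) (p : R) : (∑ k ∈ t, D k) p = ∑ k ∈ t, D k p := by
  classical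
  induction t using Finset.induction_on with
  | empty => simp
  | insert k t hk ih => rw [Finset.sum_insert hk, Finset.sum_insert hk, Derivation.add_apply, ih]

/-- In `W_{ij} = N⁻¹ ∑ₖ conj(g_{ki}) g_{kj}` the conjugated factor is integrated by parts. If the
derivative meets `g_{kj}`, it yields the term with `M/N`. Otherwise the operator `∑ₖ g_{kj}
∂/∂g_{ki}` acts on the remaining factors; it maps `W_{ab}` to `W_{aj}` if `b = i` and to zero if
not, so the Wishart letter itself is inserted at the cut. -/
theorem wishartModel_satisfies (hf : IsIndepComplexGaussian P f) (M : ℕ) (hN : N ≠ 0)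
    (σ : Fin s → Equiv.Perm (Fin N)) :
    (wishartLoop s).Satisfies (wishartCoeff (M / N)) ((N : ℂ) ^ 2)⁻¹
      (traceMoment (gaussianExp hf) (wishartModel M N σ)) := by
  rintro ⟨r | r, ε⟩ Q S hx
  · simp [wishartLoop] at hx
  refine traceMoment_cons (κ := M / N) (Y := (wishartLoop s).Y (Sum.inr r, ε))
    (η := [(Sum.inr r, ε)])
    (𝒟 := fun i j => ∑ k : Fin M, cvar (r, (k : ℕ), (j : ℕ)) false •
      cderiv (r, (k : ℕ), (i : ℕ)) true) hN ?_ ?_ Q S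
  · intro i j p
    simp only [wishartModel, Matrix.of_apply, smul_mul_assoc, map_smul, Finset.sum_mul, map_sum,
      mul_assoc, gaussianExp_cvar_mul _ _ true, Derivation.leibniz, smul_eq_mul, map_add,
      Finset.sum_add_distrib, derivation_sum_apply, Derivation.smul_apply]
    rw [mul_add, add_comm]
    congr 1
    simp only [cderiv_cvar, Matrix.one_apply]
    by_cases hij : i = j
    · subst hij
      simp
      ring
    · have : (i : ℕ) ≠ j := fun h => hij (Fin.ext h)
      simp [this, hij]
  · rintro i j ⟨r' | r', ε'⟩ a b
    · rw [wishartModel, derivation_permPoly, if_neg (by simp [wishartLoop])]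
    · simp only [wishartModel, Matrix.of_apply, Derivation.map_smul, map_sum, Derivation.leibniz,
        derivation_sum_apply, Derivation.smul_apply, smul_eq_mul, cderiv_cvar,
        wishartLoop, decide_eq_true_eq, Sum.inr.injEq, wordMatrix, List.map_cons, List.map_nil,
        List.prod_cons, List.prod_nil, mul_one, Matrix.one_apply]
      by_cases hr : r' = r
      · subst hr
        by_cases hib : i = b
        · subst hib
          simp only [Prod.mk.injEq, Fin.val_inj, true_and, and_true, Bool.not_true, if_true,
            Bool.true_eq_false, and_false, if_false, mul_zero, mul_one]
          congr 1
          refine Finset.sum_congr rfl fun k _ => ?_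
          rw [Finset.sum_eq_single k]
          · simp [mul_comm]
          · intro k' _ hk'
            simp [hk']
          · simp
        · have : (i : ℕ) ≠ b := fun h => hib (Fin.ext h)
          simp [this, hib]
      · simp [Ne.symm hr, hr]

/-- The average over all families of permutations. -/
def permAverage (s N : ℕ) (F : (Fin s → Equiv.Perm (Fin N)) → ℂ) : ℂ :=
  ((N.factorial : ℂ) ^ s)⁻¹ * ∑ σ, F σ

theorem list_sum_map_permAverage {α : Type*} (l : List α)
    (F : α → (Fin s → Equiv.Perm (Fin N)) → ℂ) :
    (l.map fun a => permAverage s N (F a)).sum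
      = permAverage s N fun σ => (l.map fun a => F a σ).sum := by
  simp only [permAverage]
  rw [List.sum_map_mul_left, sum_list_sum_map]

/-- The equations are linear because they concern expectations of products of traces and not
products of expectations; factorization appears only in the limit. -/
theorem satisfies_permAverage {L : Type*} {D : LoopData L} {κ : L → ℂ} {δ : ℂ}
    {T : (Fin s → Equiv.Perm (Fin N)) → List (List L) → ℂ} (h : ∀ σ, D.Satisfies κ δ (T σ)) :
    D.Satisfies κ δ fun S => permAverage s N fun σ => T σ S := by
  intro x Q S hx
  simp only [list_sum_map_permAverage]
  simp only [h _ x Q S hx]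
  simp only [permAverage, Finset.sum_add_distrib, ← Finset.mul_sum]
  ring

/-- The averaged trace moments of the Gaussian model. -/
def circularMoment (hf : IsIndepComplexGaussian P f) (N : ℕ) (S : List (List (Letter s))) : ℂ :=
  permAverage s N fun σ => traceMoment (gaussianExp hf) (circularModel N σ) S

/-- The averaged trace moments of the Wishart model. -/
def wishartMoment (hf : IsIndepComplexGaussian P f) (M N : ℕ) (S : List (List (Letter s))) : ℂ :=
  permAverage s N fun σ => traceMoment (gaussianExp hf) (wishartModel M N σ) S

theorem tendsto_inv_sq {N : ℕ → ℕ} (hN : Tendsto N atTop atTop) :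
    Tendsto (fun q => ((N q : ℂ) ^ 2)⁻¹) atTop (𝓝 0) := by
  have h := (tendsto_inv_atTop_nhds_zero_nat (𝕜 := ℂ)).comp hN
  have := h.pow 2
  simpa using this

theorem circularMoment_loopSequence (hf : IsIndepComplexGaussian P f) :
    LoopSequence (circularLoop s) (fun _ => 0) 0 (fun N => ((N : ℂ) ^ 2)⁻¹)
      (circularMoment hf) where
  tendsto_κ _ := tendsto_const_nhds
  tendsto_δ := tendsto_inv_sq tendsto_id
  loop := by
    filter_upwards [eventually_ne_atTop 0] with N hN
    exact satisfies_permAverage fun σ => circularModel_satisfies hf hN σ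
  perm q S S' h := by simp only [circularMoment, traceMoment_perm _ _ h]
  rotate q P Q S := by simp only [circularMoment, traceMoment_rotate _ _ P Q]

theorem wishartMoment_loopSequence (hf : IsIndepComplexGaussian P f) {M N : ℕ → ℕ} {c : ℝ}
    (hN : Tendsto N atTop atTop)
    (hMN : Tendsto (fun q => (M q : ℝ) / (N q : ℝ)) atTop (𝓝 c)) :
    LoopSequence (wishartLoop s) (fun q => wishartCoeff (M q / N q)) (wishartCoeff c)
      (fun q => ((N q : ℂ) ^ 2)⁻¹) (fun q => wishartMoment hf (M q) (N q)) where
  tendsto_κ _ := by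
    have := (Complex.continuous_ofReal.tendsto c).comp hMN
    simpa [wishartCoeff, Function.comp_def] using this
  tendsto_δ := tendsto_inv_sq hN
  loop := by
    filter_upwards [hN.eventually_ne_atTop 0] with q hq
    exact satisfies_permAverage fun σ => wishartModel_satisfies hf _ hq σ
  perm q S S' h := by simp only [wishartMoment, traceMoment_perm _ _ h]
  rotate q P Q S := by simp only [wishartMoment, traceMoment_rotate _ _ P Q]

end Models

/-! ### The Wick formula -/

section Wick

variable {Λ Ω : Type*} [MeasurableSpace Ω] {P : Measure Ω} [IsProbabilityMeasure P]
  {f : Λ → Ω → ℂ}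

theorem derivation_prod {ι R : Type*} [CommRing R] [Algebra ℂ R] [DecidableEq ι]
    (D : Derivation ℂ R R) (t : Finset ι) (y : ι → R) :
    D (∏ i ∈ t, y i) = ∑ i ∈ t, D (y i) * ∏ j ∈ t.erase i, y j := by
  induction t using Finset.induction_on with
  | empty => simp
  | insert k t hk ih =>
    rw [Finset.prod_insert hk, Derivation.leibniz, ih, Finset.sum_insert hk,
      Finset.erase_insert hk, smul_eq_mul, smul_eq_mul, add_comm, mul_comm, Finset.mul_sum]
    congr 1
    refine Finset.sum_congr rfl fun i hi => ?_
    have hik : i ≠ k := fun h => hk (h ▸ hi)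
    rw [Finset.erase_insert_of_ne hik.symm, Finset.prod_insert (by simp [hk])]
    ring

/-- Integrating one conjugate by parts differentiates with respect to the unconjugated variable,
which does not occur. -/
theorem gaussianExp_prod_cvar_true (hf : IsIndepComplexGaussian P f) {κ : Type*} [Fintype κ]
    [Nonempty κ] (b : κ → Λ) : gaussianExp hf (∏ l, cvar (b l) true) = 0 := by
  classical
  rw [← Finset.mul_prod_erase _ _ (Finset.mem_univ (Classical.arbitrary κ)), gaussianExp_cvar_mul,
    derivation_prod, Finset.sum_eq_zero, map_zero]
  intro i _
  rw [cderiv_cvar_of_ne (by simp), zero_mul]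

/-- The Wick formula for complex Gaussian variables. -/
theorem gaussianExp_prod_cvar (hf : IsIndepComplexGaussian P f) {ι κ : Type*} [Fintype ι]
    [Fintype κ] (a : ι → Λ) (b : κ → Λ) :
    gaussianExp hf ((∏ k, cvar (a k) false) * ∏ l, cvar (b l) true)
      = Nat.card {e : ι ≃ κ // ∀ k, b (e k) = a k} := by
  classical
  revert a
  refine Fintype.induction_empty_option (P := fun ι _ => ∀ (κ : Type _) [Fintype κ] (b : κ → Λ)
    (a : ι → Λ), gaussianExp hf ((∏ k, cvar (a k) false) * ∏ l, cvar (b l) true)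
      = Nat.card {e : ι ≃ κ // ∀ k, b (e k) = a k}) ?_ ?_ ?_ ι κ b
  · intro ι ι' _ u ih κ _ b a
    let _ := Fintype.ofEquiv ι' u.symm
    rw [← Equiv.prod_comp u fun k => cvar (a k) false]
    have := ih κ b (a ∘ u)
    simp only [Function.comp_apply] at this
    convert! this using 2
    refine Nat.card_congr ((Equiv.equivCongr u.symm (Equiv.refl κ)).subtypeEquiv fun e => ?_)
    constructor
    · intro h k
      simpa using h (u k)
    · intro h k
      simpa using h (u.symm k)
  · intro κ _ b a
    rw [Finset.univ_eq_empty, Finset.prod_empty, one_mul]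
    rcases isEmpty_or_nonempty κ with h | h
    · have : Nat.card {e : PEmpty ≃ κ // ∀ k, b (e k) = a k} = 1 := by
        rw [Nat.card_eq_one_iff_unique]
        exact ⟨⟨fun x y => by ext k; exact k.elim⟩,
          ⟨⟨Equiv.equivOfIsEmpty _ _, fun k => k.elim⟩⟩⟩
      rw [this, Nat.cast_one, Finset.univ_eq_empty, Finset.prod_empty, gaussianExp_one]
    · have : IsEmpty {e : PEmpty ≃ κ // ∀ k, b (e k) = a k} :=
        ⟨fun e => (e.1.symm h.some).elim⟩
      rw [Nat.card_of_isEmpty, Nat.cast_zero, gaussianExp_prod_cvar_true]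
  -- Integration by parts in the factor `none` selects its partner `l`. The other factors are
  -- indexed by `ι` and `κ` without `l`, which is why the induction over `ι` treats all `κ` at once.
  · intro ι _ ih κ _ b a
    rw [Fintype.prod_option, mul_assoc, gaussianExp_cvar_mul, Derivation.leibniz]
    have h0 : cderiv (a none) false (∏ k : ι, cvar (a (some k)) false) = 0 := by
      rw [derivation_prod, Finset.sum_eq_zero]
      intro i _
      rw [cderiv_cvar_of_ne (by simp), zero_mul]
    rw [h0, smul_zero, add_zero, derivation_prod, smul_eq_mul, Finset.mul_sum, map_sum]
    have h1 : ∀ l : κ, gaussianExp hf ((∏ k : ι, cvar (a (some k)) false) *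
        (cderiv (a none) false (cvar (b l) true) * ∏ j ∈ Finset.univ.erase l, cvar (b j) true))
        = Nat.card {e : {e : Option ι ≃ κ // e none = l} // ∀ k, b (e.1 k) = a k} := by
      intro l
      have hprod : ∏ j ∈ Finset.univ.erase l, cvar (b j) true
          = ∏ j : {j : κ // j ≠ l}, cvar (b j) true :=
        Finset.prod_subtype _ (by simp) _
      by_cases hl : a none = b l
      · rw [hl, show true = !false from rfl, cderiv_cvar_self, one_mul]
        have := ih {j : κ // j ≠ l} (fun j => b j) (fun k => a (some k))
        rw [show (!false) = true from rfl, hprod, this]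
        congr 1
        refine (Nat.card_congr ((Equiv.optionSubtype l).subtypeEquiv fun e => ?_)).symm
        rw [Option.forall]
        refine (and_iff_right (by rw [e.2, hl])).trans ?_
        rfl
      · rw [cderiv_cvar_of_ne (by simp [hl]), zero_mul, mul_zero, map_zero]
        have : IsEmpty {e : {e : Option ι ≃ κ // e none = l} // ∀ k, b (e.1 k) = a k} :=
          ⟨fun e => hl (by rw [← e.2 none, e.1.2])⟩
        rw [Nat.card_of_isEmpty, Nat.cast_zero]
    simp_rw [h1]
    rw [← Nat.cast_sum, ← Nat.card_sigma]
    congr 1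
    refine Nat.card_congr
      { toFun := fun e => ⟨e.2.1.1, e.2.2⟩
        invFun := fun e => ⟨e.1 none, ⟨⟨e.1, rfl⟩, e.2⟩⟩
        left_inv := ?_
        right_inv := fun e => rfl }
    rintro ⟨l, ⟨⟨e, rfl⟩, he⟩⟩
    rfl

end Wick

/-! ### Traces of products as sums over closed paths -/

section CyclicTrace

variable {R ι : Type*} [CommRing R] [Fintype ι] [DecidableEq ι]

theorem prod_ofFn_apply {m : ℕ} (X : Fin (m + 1) → Matrix ι ι R) (a b : ι) :
    (List.ofFn X).prod a b = ∑ j : Fin m → ι, ∏ k : Fin (m + 1),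
      X k (Fin.cons (α := fun _ => ι) a j k) (Fin.snoc (α := fun _ => ι) j b k) := by
  induction m generalizing a with
  | zero =>
    simp only [List.ofFn_succ, List.ofFn_zero, List.prod_cons, List.prod_nil, mul_one]
    rw [Fintype.sum_unique, Fin.prod_univ_succ]
    simp [Fin.snoc]
  | succ m ih =>
    rw [List.ofFn_succ, List.prod_cons, Matrix.mul_apply,
      ← (Fin.consEquiv fun _ : Fin (m + 1) => ι).sum_comp, Fintype.sum_prod_type]
    refine Finset.sum_congr rfl fun c _ => ?_
    rw [ih, Finset.mul_sum]
    refine Finset.sum_congr rfl fun j _ => ?_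
    rw [Fin.prod_univ_succ (n := m + 1)]
    simp only [Fin.consEquiv, Equiv.coe_fn_mk, ← Fin.cons_snoc_eq_snoc_cons, Fin.cons_zero,
      Fin.cons_succ]

/-- The trace of a product of matrices as a sum over closed paths. -/
theorem trace_prod_ofFn {m : ℕ} (X : Fin (m + 1) → Matrix ι ι R) :
    (List.ofFn X).prod.trace = ∑ i : Fin (m + 1) → ι, ∏ k, X k (i k) (i (finRotate _ k)) := by
  rw [Matrix.trace, ← (Fin.consEquiv fun _ : Fin (m + 1) => ι).sum_comp, Fintype.sum_prod_type]
  refine Finset.sum_congr rfl fun a _ => ?_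
  rw [Matrix.diag_apply, prod_ofFn_apply]
  refine Finset.sum_congr rfl fun j _ => Finset.prod_congr rfl fun k _ => ?_
  rw [Fin.snoc_eq_cons_rotate]
  rfl

end CyclicTrace

/-! ### Counting index functions by cycles -/

section Count

variable {n : ℕ}

theorem card_invariant (N : ℕ) (τ : Equiv.Perm (Fin n)) :
    Nat.card {i : Fin n → Fin N // ∀ k, i (τ k) = i k} = N ^ numCycles τ := by
  have e : {i : Fin n → Fin N // ∀ k, i (τ k) = i k} ≃
      (Quotient (Equiv.Perm.SameCycle.setoid τ) → Fin N) :=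
    { toFun := fun i => Quotient.lift i.1 (by
        rintro a b ⟨k, rfl⟩
        have h1 : ∀ (m : ℕ) a, i.1 ((τ ^ m) a) = i.1 a := by
          intro m
          induction m with
          | zero => simp
          | succ m ih => intro a; rw [pow_succ', Equiv.Perm.mul_apply, i.2, ih]
        obtain ⟨m, rfl | rfl⟩ := k.eq_nat_or_neg
        · rw [zpow_natCast, h1]
        · rw [zpow_neg, zpow_natCast, ← h1 m ((τ ^ m)⁻¹ a), Equiv.Perm.eq_inv_iff_eq.1 rfl])
      invFun := fun g => ⟨fun k => g (Quotient.mk _ k), fun k => by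
        refine congrArg g (Quotient.sound' ?_)
        exact (Equiv.Perm.sameCycle_apply_left.2 (Equiv.Perm.SameCycle.refl τ k))⟩
      left_inv := fun i => rfl
      right_inv := fun g => by
        ext x
        induction x using Quotient.inductionOn
        rfl }
  rw [Nat.card_congr e, Nat.card_fun, Nat.card_fin, numCycles]

/-- The condition on `i` says that `i ∘ π` is invariant under `π⁻¹ γ`, that is, constant on its
cycles. -/
theorem card_intertwining (N : ℕ) (π γ : Equiv.Perm (Fin n)) :
    Nat.card {i : Fin n → Fin N // ∀ k, i (π k) = i (γ k)} = N ^ numCycles (π⁻¹ * γ) := by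
  rw [← card_invariant]
  refine Nat.card_congr ((Equiv.arrowCongr π.symm (Equiv.refl (Fin N))).subtypeEquiv fun i => ?_)
  simp [eq_comm]

end Count

/-! ### Exact moments of a single Gaussian or Wishart matrix -/

section Pairings

/-- Pairings of places with opposite exponents. -/
def IsPairing {ι : Type*} (e : ι → Bool) (π : Equiv.Perm ι) : Prop :=
  (∀ k, π (π k) = k) ∧ ∀ k, e (π k) = !e k

/-- The involution that belongs to a bijection between the places with exponent `false` and the
others. -/
def pairingFun {ι : Type*} (e : ι → Bool) (u : {k // e k = false} ≃ {k // ¬e k = false})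
    (k : ι) : ι :=
  if h : e k = false then (u ⟨k, h⟩ : ι) else (u.symm ⟨k, h⟩ : ι)

theorem pairingFun_involutive {ι : Type*} (e : ι → Bool)
    (u : {k // e k = false} ≃ {k // ¬e k = false}) : Function.Involutive (pairingFun e u) := by
  intro k
  by_cases h : e k = false
  · have := (u ⟨k, h⟩).2
    simp [pairingFun, h, this]
  · have := (u.symm ⟨k, h⟩).2
    simp [pairingFun, h, this]

/-- A pairing is a bijection between the places with exponent `false` and the others. -/
def pairingEquiv {ι : Type*} (e : ι → Bool) :
    {π : Equiv.Perm ι // IsPairing e π} ≃ ({k // e k = false} ≃ {k // ¬e k = false}) where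
  toFun π :=
    { toFun := fun k => ⟨π.1 k, by rw [π.2.2, k.2]; simp⟩
      invFun := fun k => ⟨π.1 k, by rw [π.2.2]; simpa using k.2⟩
      left_inv := fun k => Subtype.ext (π.2.1 k)
      right_inv := fun k => Subtype.ext (π.2.1 k) }
  invFun u :=
    ⟨(pairingFun_involutive e u).toPerm, by
      refine ⟨fun k => pairingFun_involutive e u k, fun k => ?_⟩
      rw [Function.Involutive.coe_toPerm, pairingFun]
      split_ifs with h
      · simpa [h] using (u ⟨k, h⟩).2
      · simpa [h] using (u.symm ⟨k, h⟩).2⟩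
  left_inv π := by
    ext k
    simp [pairingFun]
  right_inv u := by
    ext k
    simp [pairingFun, k.2]

theorem entryIndex_not_eq_iff {s : ℕ} (r : Fin s) (b : Bool) (x y x' y' : ℕ) :
    entryIndex r (!b) x y = entryIndex r b x' y' ↔ x = y' ∧ y = x' := by
  cases b <;> simp [entryIndex, and_comm]

/-- Each cycle consists of two places whose exponents differ, so a place is determined by its cycle
and its exponent. -/
theorem two_mul_numCycles {n : ℕ} {e : Fin n → Bool} {π : Equiv.Perm (Fin n)}
    (h : IsPairing e π) : numCycles π * 2 = n := by
  have hsame : ∀ k l, π.SameCycle k l → l = k ∨ l = π k := by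
    rintro k l ⟨m, rfl⟩
    have hsq : π ^ (2 : ℤ) = 1 := by
      ext k
      simp [zpow_ofNat, pow_two, h.1]
    obtain ⟨j, rfl | rfl⟩ := m.even_or_odd'
    · left; rw [zpow_mul, hsq]; simp
    · right; rw [zpow_add, zpow_mul, hsq]; simp
  have hb : Function.Bijective fun k : Fin n =>
      ((Quotient.mk (Equiv.Perm.SameCycle.setoid π) k, e k) : _ × Bool) := by
    constructor
    · intro k l hkl
      simp only [Prod.mk.injEq] at hkl
      rcases hsame k l (Quotient.exact hkl.1) with rfl | rfl
      · rfl
      · have := hkl.2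
        rw [h.2] at this
        simp at this
    · rintro ⟨x, b⟩
      induction x using Quotient.inductionOn with | _ k =>
      by_cases hb : e k = b
      · exact ⟨k, by simp [hb]⟩
      · refine ⟨π k, ?_⟩
        simp only [Prod.mk.injEq, h.2]
        refine ⟨Quotient.sound' ?_, by cases b <;> simp_all⟩
        exact Equiv.Perm.sameCycle_apply_left.2 (Equiv.Perm.SameCycle.refl π k)
  have := Nat.card_eq_of_bijective _ hb
  rw [Nat.card_fin, Nat.card_prod] at this
  simpa [numCycles] using this.symm

theorem cast_natCard_subtype {α : Type*} [Fintype α] (p : α → Prop) [DecidablePred p] :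
    (Nat.card {a // p a} : ℂ) = ∑ a, if p a then 1 else 0 := by
  rw [Nat.card_eq_fintype_card, Fintype.card_subtype, Finset.sum_boole]

end Pairings

section Exact

variable {s N : ℕ} {Ω : Type*} [MeasurableSpace Ω] {P : Measure Ω} [IsProbabilityMeasure P]
  {f : Fin s × ℕ × ℕ → Ω → ℂ}

/-- The Wick formula for words. -/
theorem gaussianExp_prod_cvar_pairing {Λ : Type*} {f : Λ → Ω → ℂ}
    (hf : IsIndepComplexGaussian P f) {ι : Type*} [Fintype ι] (a : ι → Λ) (e : ι → Bool) :
    gaussianExp hf (∏ k, cvar (a k) (e k))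
      = Nat.card {π : Equiv.Perm ι // IsPairing e π ∧ ∀ k, a (π k) = a k} := by
  classical
  rw [← Fintype.prod_subtype_mul_prod_subtype (fun k => e k = false)]
  have h1 : ∀ k : {k // e k = false}, cvar (a k) (e k) = cvar (a k) false := fun k => by rw [k.2]
  have h2 : ∀ k : {k // ¬e k = false}, cvar (a k) (e k) = cvar (a k) true := fun k => by
    have := k.2
    rw [Bool.not_eq_false] at this
    rw [this]
  rw [Finset.prod_congr rfl fun k _ => h1 k, Finset.prod_congr rfl fun k _ => h2 k,
    gaussianExp_prod_cvar hf (fun k : {k // e k = false} => a k)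
      (fun k : {k // ¬e k = false} => a k)]
  congr 1
  rw [Nat.card_congr (Equiv.subtypeSubtypeEquivSubtypeInter (IsPairing e)
    fun π => ∀ k, a (π k) = a k).symm]
  refine (Nat.card_congr ((pairingEquiv e).subtypeEquiv fun π => ?_)).symm
  constructor
  · intro h k
    exact h k
  · intro h k
    by_cases hk : e k = false
    · exact h ⟨k, hk⟩
    · have := h ⟨π.1 k, by rw [π.2.2]; simpa using hk⟩
      simp only [pairingEquiv, Equiv.coe_fn_mk, π.2.1] at this
      exact this.symm

-- Wick's formula sums over pairings `π`, and equality of the paired variables means `i ∘ π = i ∘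
-- γ`, which leaves `N ^ #(π⁻¹γ)` index functions. The scalings contribute `N ^ (-(m+1)/2) = N ^
-- (-#π)`, the normalized trace one more `N⁻¹`. The coefficient `1` is displayed to fit
-- `eq_sum_of_tendsto`.
open Classical in
theorem traceMoment_circular (hf : IsIndepComplexGaussian P f) (hN : N ≠ 0)
    (σ : Fin s → Equiv.Perm (Fin N)) (r : Fin s) {m : ℕ} (e : Fin (m + 1) → Bool) :
    traceMoment (gaussianExp hf) (circularModel N σ) [List.ofFn fun k => (Sum.inr r, e k)]
      = ((∑ π : Equiv.Perm (Fin (m + 1)) with IsPairing e π,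
        (1 : ℝ) * ((N : ℝ) ^ numCycles (π⁻¹ * finRotate (m + 1)) / (N : ℝ) ^ (numCycles π + 1)) : ℝ)
          : ℂ) := by
  have hpair : ∀ (i : Fin (m + 1) → Fin N) (π : Equiv.Perm (Fin (m + 1))), IsPairing e π →
      ((∀ k, entryIndex r (e (π k)) (i (π k)) (i (finRotate _ (π k)))
        = entryIndex r (e k) (i k) (i (finRotate _ k))) ↔
        ∀ k, i (π k) = i (finRotate _ k)) := by
    intro i π hπ
    simp only [hπ.2, entryIndex_not_eq_iff, Fin.val_inj]
    refine ⟨fun h k => (h k).1, fun h k => ⟨h k, ?_⟩⟩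
    have := h (π k)
    rwa [hπ.1, eq_comm] at this
  have hsqrt : ∀ π : Equiv.Perm (Fin (m + 1)), IsPairing e π →
      ((1 / Real.sqrt N : ℝ) : ℂ) ^ (m + 1) = ((N : ℂ) ^ numCycles π)⁻¹ := by
    intro π hπ
    have h2 := two_mul_numCycles hπ
    rw [show ((1 / Real.sqrt N : ℝ) : ℂ) ^ (m + 1)
        = ((1 / Real.sqrt N : ℝ) : ℂ) ^ (2 * numCycles π) by congr 1; omega, pow_mul,
          ← Complex.ofReal_pow, div_pow, one_pow,
      Real.sq_sqrt (Nat.cast_nonneg N)]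
    simp
  simp only [traceMoment, List.map_cons, List.map_nil, List.prod_cons, List.prod_nil, mul_one,
    wordTrace, wordMatrix, List.map_ofFn, map_smul, smul_eq_mul]
  rw [trace_prod_ofFn, map_sum]
  simp only [Function.comp_apply, circularModel, Matrix.of_apply]
  have hsm : ∀ i : Fin (m + 1) → Fin N, ∏ k, ((1 / Real.sqrt N : ℝ) : ℂ) •
      cvar (entryIndex r (e k) (i k) (i (finRotate _ k))) (e k)
      = ((1 / Real.sqrt N : ℝ) : ℂ) ^ (m + 1) •
        ∏ k, cvar (entryIndex r (e k) (i k) (i (finRotate _ k))) (e k) := by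
    intro i
    rw [Finset.prod_smul]
    simp
  simp_rw [hsm, map_smul, smul_eq_mul, gaussianExp_prod_cvar_pairing, cast_natCard_subtype]
  rw [← Finset.mul_sum, Finset.sum_comm, Finset.sum_filter,
    Complex.ofReal_sum, Finset.mul_sum, Finset.mul_sum]
  refine Finset.sum_congr rfl fun π _ => ?_
  by_cases hπ : IsPairing e π
  · simp only [hπ, true_and, if_true, hpair _ π hπ]
    rw [← cast_natCard_subtype, card_intertwining, hsqrt π hπ]
    have : (N : ℂ) ≠ 0 := Nat.cast_ne_zero.2 hN
    push_cast
    field_simp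
    ring
  · simp [hπ]

-- A matching `τ` of conjugated with unconjugated factors forces the inner indices to be constant on
-- the cycles of `τ` and the outer ones to satisfy `i ∘ τ = i ∘ γ`. This gives `M ^ #τ * N ^
-- #(τ⁻¹γ)`; the first factor is written as `(M/N) ^ #τ * N ^ #τ` to obtain a coefficient that
-- converges.
open Classical in
theorem traceMoment_wishart (hf : IsIndepComplexGaussian P f) (M : ℕ) (hN : N ≠ 0)
    (σ : Fin s → Equiv.Perm (Fin N)) (r : Fin s) {m : ℕ} (e : Fin (m + 1) → Bool) :
    traceMoment (gaussianExp hf) (wishartModel M N σ) [List.ofFn fun k => (Sum.inr r, e k)]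
      = ((∑ τ : Equiv.Perm (Fin (m + 1)), ((M : ℝ) / N) ^ numCycles τ *
        ((N : ℝ) ^ (numCycles τ + numCycles (τ⁻¹ * finRotate (m + 1))) / (N : ℝ) ^ (m + 1 + 1)) : ℝ)
          : ℂ) := by
  simp only [traceMoment, List.map_cons, List.map_nil, List.prod_cons, List.prod_nil, mul_one,
    wordTrace, wordMatrix, List.map_ofFn, map_smul, smul_eq_mul]
  rw [trace_prod_ofFn, map_sum]
  simp only [Function.comp_apply, wishartModel, Matrix.of_apply]
  have hsm : ∀ i : Fin (m + 1) → Fin N, ∏ k, ((N : ℂ)⁻¹ • ∑ l : Fin M,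
      cvar (r, (l : ℕ), (i k : ℕ)) true * cvar (r, (l : ℕ), (i (finRotate _ k) : ℕ)) false)
      = (N : ℂ)⁻¹ ^ (m + 1) • ∑ l : Fin (m + 1) → Fin M,
        (∏ k, cvar (r, (l k : ℕ), (i (finRotate _ k) : ℕ)) false) *
          ∏ k, cvar (r, (l k : ℕ), (i k : ℕ)) true := by
    intro i
    rw [Finset.prod_smul, Finset.prod_const, Finset.card_univ, Fintype.card_fin,
      Finset.prod_univ_sum, Fintype.piFinset_univ]
    congr 1
    refine Finset.sum_congr rfl fun l _ => ?_
    rw [Finset.prod_mul_distrib, mul_comm]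
  simp_rw [hsm, map_smul, smul_eq_mul, map_sum, gaussianExp_prod_cvar, cast_natCard_subtype]
  have hiff : ∀ (i : Fin (m + 1) → Fin N) (l : Fin (m + 1) → Fin M) (τ : Equiv.Perm (Fin (m + 1))),
      (if ∀ k, ((r, (l (τ k) : ℕ), (i (τ k) : ℕ)) : Fin s × ℕ × ℕ)
        = (r, (l k : ℕ), (i (finRotate _ k) : ℕ)) then (1 : ℂ) else 0)
      = (if ∀ k, l (τ k) = l k then 1 else 0) *
        if ∀ k, i (τ k) = i (finRotate _ k) then 1 else 0 := by
    intro i l τ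
    simp only [Prod.mk.injEq, Fin.val_inj, true_and, forall_and, ite_and, mul_ite, mul_one,
      mul_zero]
    split_ifs <;> rfl
  simp_rw [hiff]
  rw [← Finset.mul_sum]
  have hcomm : ∑ i : Fin (m + 1) → Fin N, ∑ l : Fin (m + 1) → Fin M,
      ∑ τ : Equiv.Perm (Fin (m + 1)), (if ∀ k, l (τ k) = l k then (1 : ℂ) else 0) *
        (if ∀ k, i (τ k) = i (finRotate _ k) then 1 else 0)
      = ∑ τ : Equiv.Perm (Fin (m + 1)), (M : ℂ) ^ numCycles τ *
        (N : ℂ) ^ numCycles (τ⁻¹ * finRotate (m + 1)) := by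
    have h1 : ∀ i : Fin (m + 1) → Fin N, ∑ l : Fin (m + 1) → Fin M,
        ∑ τ : Equiv.Perm (Fin (m + 1)), (if ∀ k, l (τ k) = l k then (1 : ℂ) else 0) *
          (if ∀ k, i (τ k) = i (finRotate _ k) then 1 else 0)
        = ∑ τ : Equiv.Perm (Fin (m + 1)), (M : ℂ) ^ numCycles τ *
          (if ∀ k, i (τ k) = i (finRotate _ k) then 1 else 0) := by
      intro i
      rw [Finset.sum_comm]
      refine Finset.sum_congr rfl fun τ _ => ?_
      rw [← Finset.sum_mul, ← cast_natCard_subtype, card_invariant, Nat.cast_pow]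
    rw [Finset.sum_congr rfl fun i _ => h1 i, Finset.sum_comm]
    refine Finset.sum_congr rfl fun τ _ => ?_
    rw [← Finset.mul_sum, ← cast_natCard_subtype, card_intertwining, Nat.cast_pow]
  rw [hcomm]
  push_cast
  rw [Finset.mul_sum, Finset.mul_sum]
  refine Finset.sum_congr rfl fun τ _ => ?_
  have : (N : ℂ) ≠ 0 := Nat.cast_ne_zero.2 hN
  rw [div_pow, pow_add (N : ℂ) (numCycles τ), inv_pow]
  field_simp
  ring

end Exact

/-! ### The leading term of a genus expansion -/

section GenusLimit

/-- If a sum of terms `a_τ(q) N_q ^ b_τ / N_q ^ d_τ` with positive limits of the coefficients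
converges, then its limit is the contribution of the terms with `b_τ = d_τ`. -/
theorem eq_sum_of_tendsto {ι : Type*} {t : Finset ι} {a : ι → ℕ → ℝ} {α : ι → ℝ} {N : ℕ → ℕ}
    {b d : ι → ℕ} {ℓ : ℂ} (ha : ∀ τ, Tendsto (a τ) atTop (𝓝 (α τ))) (hα : ∀ τ, 0 < α τ)
    (hN : Tendsto N atTop atTop)
    (h : Tendsto (fun q => ((∑ τ ∈ t, a τ q * ((N q : ℝ) ^ b τ / (N q : ℝ) ^ d τ) : ℝ) : ℂ)) atTop
      (𝓝 ℓ)) :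
    ℓ = ((∑ τ ∈ t with b τ = d τ, α τ : ℝ) : ℂ) := by
  have hNr : Tendsto (fun q => (N q : ℝ)) atTop atTop := tendsto_natCast_atTop_atTop.comp hN
  have hre : Tendsto (fun q => ∑ τ ∈ t, a τ q * ((N q : ℝ) ^ b τ / (N q : ℝ) ^ d τ)) atTop
      (𝓝 ℓ.re) := (Complex.continuous_re.tendsto ℓ).comp h
  -- This replaces a proof of the genus inequality for permutations: since all coefficients are
  -- eventually positive, nothing can cancel a growing term, and one such term would contradict the
  -- assumed convergence.
  have hle : ∀ τ ∈ t, b τ ≤ d τ := by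
    intro τ hτ
    by_contra! hlt
    have hpos : ∀ᶠ q in atTop, ∀ τ' ∈ t, 0 < a τ' q :=
      (Filter.eventually_all_finset t).2 fun τ' _ => (ha τ').eventually (lt_mem_nhds (hα τ'))
    have hbig : Tendsto (fun q => a τ q * (N q : ℝ)) atTop atTop :=
      (ha τ).pos_mul_atTop (hα τ) hNr
    refine not_tendsto_nhds_of_tendsto_atTop (tendsto_atTop_mono' _ ?_ hbig) _ hre
    filter_upwards [hpos, hN.eventually_ge_atTop 1] with q hq hq1
    have h1 : (1 : ℝ) ≤ N q := by exact_mod_cast hq1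
    calc a τ q * (N q : ℝ) ≤ a τ q * ((N q : ℝ) ^ b τ / (N q : ℝ) ^ d τ) := by
          refine mul_le_mul_of_nonneg_left ?_ (hq τ hτ).le
          rw [le_div_iff₀ (by positivity), ← pow_succ']
          exact pow_le_pow_right₀ h1 hlt
      _ ≤ _ := Finset.single_le_sum
          (f := fun τ => a τ q * ((N q : ℝ) ^ b τ / (N q : ℝ) ^ d τ))
          (fun τ' hτ' => mul_nonneg (hq τ' hτ').le (by positivity)) hτ
  have hlim : Tendsto (fun q => ∑ τ ∈ t, a τ q * ((N q : ℝ) ^ b τ / (N q : ℝ) ^ d τ)) atTop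
      (𝓝 (∑ τ ∈ t, if b τ = d τ then α τ else 0)) := by
    refine tendsto_finsetSum _ fun τ hτ => ?_
    split_ifs with hbd
    · refine (ha τ).congr' ?_
      filter_upwards [hN.eventually_ge_atTop 1] with q hq
      rw [hbd, div_self (by positivity), mul_one]
    · have hlt := lt_of_le_of_ne (hle τ hτ) hbd
      have h0 : Tendsto (fun q => (N q : ℝ) ^ b τ / (N q : ℝ) ^ d τ) atTop (𝓝 0) :=
        (tendsto_pow_div_pow_atTop_zero hlt).comp hNr
      simpa using (ha τ).mul h0
  rw [Finset.sum_filter]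
  exact tendsto_nhds_unique h ((Complex.continuous_ofReal.tendsto _).comp hlim)

end GenusLimit

/-! ### Moments of circular and free Poisson elements -/

section Cumulants

variable {A : Type*} [Ring A] [Algebra ℂ A]

open Classical in
/-- The moment-cumulant formula for elements that are indexed by `Fin n`. -/
theorem moment_cumulant_ofFn (φ : A →ₗ[ℂ] ℂ) {m : ℕ} (y : Fin (m + 1) → A) :
    φ (List.ofFn y).prod = ∑ τ : Equiv.Perm (Fin (m + 1)) with IsNonCrossing τ,
      ∏ a ∈ cycleMins τ, freeCumulant φ ((cycleList τ a).map y) := by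
  have key : ∀ (n : ℕ) (l : List A) (h : n = l.length), l ≠ [] →
      φ l.prod = ∑ τ : Equiv.Perm (Fin n) with IsNonCrossing τ,
        ∏ a ∈ cycleMins τ, freeCumulant φ ((cycleList τ a).map fun k => l.get (Fin.cast h k)) := by
    rintro n l rfl hl
    exact moment_cumulant φ hl
  have hget : ∀ k : Fin (m + 1), (List.ofFn y).get (Fin.cast (by simp) k) = y k := fun k => by
    rw [List.get_eq_getElem, List.getElem_ofFn]
    rfl
  rw [key (m + 1) (List.ofFn y) (by simp) (by simp)]
  simp_rw [hget]

variable {n : ℕ}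

theorem exists_cycleMins_sameCycle (τ : Equiv.Perm (Fin n)) (k : Fin n) :
    ∃ a ∈ cycleMins τ, τ.SameCycle a k := by
  classical
  have hne : (Finset.univ.filter fun b => τ.SameCycle k b).Nonempty :=
    ⟨k, by simp [Equiv.Perm.SameCycle.refl]⟩
  refine ⟨_, ?_, (Finset.mem_filter.1 (Finset.min'_mem _ hne)).2.symm⟩
  simp only [cycleMins, Finset.mem_filter, Finset.mem_univ, true_and]
  intro b hb
  refine Finset.min'_le _ _ ?_
  simp only [Finset.mem_filter, Finset.mem_univ, true_and]
  exact (Finset.mem_filter.1 (Finset.min'_mem _ hne)).2.trans hb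

theorem card_cycleMins (τ : Equiv.Perm (Fin n)) : (cycleMins τ).card = numCycles τ := by
  rw [numCycles, ← Nat.card_eq_finsetCard]
  refine Nat.card_eq_of_bijective
    (fun a : cycleMins τ => Quotient.mk (Equiv.Perm.SameCycle.setoid τ) (a : Fin n)) ⟨?_, ?_⟩
  · rintro ⟨a, ha⟩ ⟨b, hb⟩ hab
    have h : τ.SameCycle a b := Quotient.exact hab
    simp only [cycleMins, Finset.mem_filter, Finset.mem_univ, true_and] at ha hb
    exact Subtype.ext (le_antisymm (ha b h) (hb a h.symm))
  · intro x
    induction x using Quotient.inductionOn with | _ k =>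
    obtain ⟨a, ha, hak⟩ := exists_cycleMins_sameCycle τ k
    exact ⟨⟨a, ha⟩, Quotient.sound' hak⟩

theorem minimalPeriod_perm_pos (τ : Equiv.Perm (Fin n)) (a : Fin n) :
    0 < Function.minimalPeriod τ a :=
  Function.minimalPeriod_pos_of_mem_periodicPts (τ.injective.mem_periodicPts a)

/-- The condition on the left describes where all cumulants of a circular element along the cycles
of `τ` equal one. Hence its cumulant product along `τ` is the indicator of the pairings. -/
theorem forall_cycleMins_iff_isPairing (e : Fin n → Bool) (τ : Equiv.Perm (Fin n)) :
    (∀ a ∈ cycleMins τ, (cycleList τ a).map e = [false, true] ∨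
      (cycleList τ a).map e = [true, false]) ↔ IsPairing e τ := by
  constructor
  · intro h
    have key : ∀ k, τ (τ k) = k ∧ e (τ k) = !e k := by
      intro k
      obtain ⟨a, ha, i, rfl⟩ := exists_cycleMins_sameCycle τ k
      have hp : Function.minimalPeriod τ a = 2 := by
        have hl : ((cycleList τ a).map e).length = 2 := by
          rcases h a ha with h | h <;> rw [h] <;> rfl
        simpa [cycleList] using hl
      have h2 : τ (τ a) = a := by
        have := Function.iterate_minimalPeriod (f := τ) (x := a)
        rwa [hp] at this
      have he : e (τ a) = !e a := by
        have := h a ha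
        rw [cycleList, hp] at this
        simp [List.iterate] at this
        rcases this with ⟨h1, h2⟩ | ⟨h1, h2⟩ <;> rw [h1, h2] <;> rfl
      have hpow : (τ ^ i) a = a ∨ (τ ^ i) a = τ a := by
        have hsq : (τ ^ (2 : ℤ)) a = a := by simpa [zpow_ofNat, pow_two] using h2
        obtain ⟨j, rfl | rfl⟩ := i.even_or_odd'
        · left
          rw [zpow_mul]
          exact Equiv.Perm.zpow_apply_eq_self_of_apply_eq_self hsq j
        · right
          rw [add_comm, zpow_add, zpow_mul, Equiv.Perm.mul_apply,
            Equiv.Perm.zpow_apply_eq_self_of_apply_eq_self hsq j, zpow_one]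
      rcases hpow with h3 | h3 <;> rw [h3]
      · exact ⟨h2, he⟩
      · rw [h2, he]
        simp
    exact ⟨fun k => (key k).1, fun k => (key k).2⟩
  · intro h a _
    have hne : τ a ≠ a := by
      intro hτ
      have := h.2 a
      rw [hτ] at this
      simp at this
    have hp : Function.minimalPeriod τ a = 2 := by
      have hdvd : Function.minimalPeriod τ a ∣ 2 :=
        Function.IsPeriodicPt.minimalPeriod_dvd (h.1 a)
      rcases (Nat.dvd_prime Nat.prime_two).1 hdvd with h1 | h1
      · exact absurd (Function.minimalPeriod_eq_one_iff_isFixedPt.1 h1) hne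
      · exact h1
    rw [cycleList, hp]
    simp only [List.iterate, List.map_cons, List.map_nil, h.2]
    cases e a <;> simp

variable [StarRing A]

open Classical in
theorem IsStandardCircular.moment {φ : A →ₗ[ℂ] ℂ} {g : A} (hg : IsStandardCircular φ g) {m : ℕ}
    (e : Fin (m + 1) → Bool) :
    φ (List.ofFn fun k => starIf g (e k)).prod = ((∑ π : Equiv.Perm (Fin (m + 1)) with
      IsPairing e π ∧ IsNonCrossing π, (1 : ℝ) : ℝ) : ℂ) := by
  rw [moment_cumulant_ofFn]
  have h : ∀ τ : Equiv.Perm (Fin (m + 1)), ∏ a ∈ cycleMins τ,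
      freeCumulant φ ((cycleList τ a).map fun k => starIf g (e k))
      = if IsPairing e τ then 1 else 0 := by
    intro τ
    have h1 : ∀ a, freeCumulant φ ((cycleList τ a).map fun k => starIf g (e k))
        = if (cycleList τ a).map e = [false, true] ∨ (cycleList τ a).map e = [true, false]
          then 1 else 0 := by
      intro a
      have hne : (cycleList τ a).map e ≠ [] := by
        intro h
        have := congrArg List.length h
        simp only [cycleList, List.length_map, List.length_iterate, List.length_nil] at this
        exact (minimalPeriod_perm_pos τ a).ne' this
      rw [← hg _ hne, List.map_map]
      rfl
    simp_rw [h1]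
    rw [Finset.prod_ite_zero, Finset.prod_const_one]
    simp only [forall_cycleMins_iff_isPairing]
  simp_rw [h]
  rw [Finset.sum_ite, Finset.sum_const_zero, add_zero, Finset.filter_filter]
  push_cast
  refine Finset.sum_congr (Finset.filter_congr fun τ _ => and_comm) fun _ _ => rfl

open Classical in
theorem IsFreePoisson.moment {φ : A →ₗ[ℂ] ℂ} {c : ℝ} {w : A} (hw : IsFreePoisson φ c w) {m : ℕ}
    (e : Fin (m + 1) → Bool) :
    φ (List.ofFn fun k => starIf w (e k)).prod = ((∑ τ : Equiv.Perm (Fin (m + 1)) with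
      IsNonCrossing τ, c ^ numCycles τ : ℝ) : ℂ) := by
  have hstar : (fun k => starIf w (e k)) = fun _ => w := by
    ext k
    rw [starIf, hw.1, ite_self]
  rw [hstar, moment_cumulant_ofFn]
  push_cast
  refine Finset.sum_congr rfl fun τ _ => ?_
  rw [← card_cycleMins, ← Finset.prod_const]
  refine Finset.prod_congr rfl fun a _ => ?_
  rw [List.map_const', cycleList, List.length_iterate]
  exact hw.2 _ (minimalPeriod_perm_pos τ a)

end Cumulants

/-! ### Limits of the moments of a single matrix -/

section SingleLimit

variable {s : ℕ} {Ω : Type*} [MeasurableSpace Ω] {P : Measure Ω} [IsProbabilityMeasure P]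
  {f : Fin s × ℕ × ℕ → Ω → ℂ} {A : Type*} [Ring A] [Algebra ℂ A] [StarRing A] {φ : A →ₗ[ℂ] ℂ}

theorem permAverage_const (s N : ℕ) (x : ℂ) : permAverage s N (fun _ => x) = x := by
  rw [permAverage, Finset.sum_const, Finset.card_univ, Fintype.card_fun, Fintype.card_perm,
    Fintype.card_fin, Fintype.card_fin, nsmul_eq_mul, Nat.cast_pow, inv_mul_cancel_left₀]
  exact pow_ne_zero _ (Nat.cast_ne_zero.2 N.factorial_ne_zero)

/-- Convergence is a hypothesis, to be supplied by the loop equations. For a pairing `m + 1 = 2 #π`,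
so equality of the exponents in the genus expansion is the non-crossing condition. -/
theorem circular_moment_eq_limit (hf : IsIndepComplexGaussian P f) {g : A}
    (hg : IsStandardCircular φ g) (r : Fin s) {m : ℕ} (e : Fin (m + 1) → Bool) {ℓ : ℂ}
    (h : Tendsto (fun N => circularMoment hf N [List.ofFn fun k => (Sum.inr r, e k)]) atTop
      (𝓝 ℓ)) : φ (List.ofFn fun k => starIf g (e k)).prod = ℓ := by
  classical
  rw [hg.moment, eq_comm, eq_sum_of_tendsto (t := Finset.univ.filter fun π => IsPairing e π)
    (a := fun _ _ => 1) (α := fun _ => 1) (N := fun N => N)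
    (b := fun π => numCycles (π⁻¹ * finRotate (m + 1))) (d := fun π => numCycles π + 1) (ℓ := ℓ)
    (fun _ => tendsto_const_nhds) (fun _ => one_pos) tendsto_id]
  · rw [Finset.filter_filter]
    congr 2
    refine Finset.filter_congr fun π _ => and_congr_right fun hπ => ?_
    have := two_mul_numCycles hπ
    rw [IsNonCrossing]
    omega
  · refine h.congr' ?_
    filter_upwards [eventually_ne_atTop 0] with N hN
    rw [circularMoment]
    simp_rw [traceMoment_circular hf hN]
    exact permAverage_const _ _ _

theorem freePoisson_moment_eq_limit (hf : IsIndepComplexGaussian P f) {c : ℝ} (hc : 0 < c) {w : A}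
    (hw : IsFreePoisson φ c w) {M N : ℕ → ℕ} (hN : Tendsto N atTop atTop)
    (hMN : Tendsto (fun q => (M q : ℝ) / (N q : ℝ)) atTop (𝓝 c))
    (r : Fin s) {m : ℕ} (e : Fin (m + 1) → Bool) {ℓ : ℂ}
    (h : Tendsto (fun q => wishartMoment hf (M q) (N q) [List.ofFn fun k => (Sum.inr r, e k)]) atTop
      (𝓝 ℓ)) : φ (List.ofFn fun k => starIf w (e k)).prod = ℓ := by
  classical
  rw [hw.moment, eq_comm, eq_sum_of_tendsto (t := Finset.univ)
    (a := fun τ q => ((M q : ℝ) / N q) ^ numCycles τ) (α := fun τ => c ^ numCycles τ) (N := N)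
    (b := fun τ => numCycles τ + numCycles (τ⁻¹ * finRotate (m + 1))) (d := fun _ => m + 1 + 1)
    (ℓ := ℓ) (fun τ => hMN.pow _) (fun _ => pow_pos hc _) hN]
  · congr 2
    exact Finset.filter_congr fun τ _ => Iff.rfl
  · refine h.congr' ?_
    filter_upwards [hN.eventually_ne_atTop 0] with q hq
    rw [wishartMoment]
    simp_rw [traceMoment_wishart hf _ hq]
    exact permAverage_const _ _ _

end SingleLimit

/-! ### Fixed points of words in random permutations -/

section RandomPermutations

variable {ι α : Type*}

/-- The permutation of a letter of the free group. -/
def letterPerm (σ : ι → Equiv.Perm α) (a : ι × Bool) : Equiv.Perm α :=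
  if a.2 then σ a.1 else (σ a.1)⁻¹

/-- The permutation of a word of the free group. -/
def wordPerm (σ : ι → Equiv.Perm α) (w : List (ι × Bool)) : Equiv.Perm α :=
  (w.map (letterPerm σ)).prod

@[simp] theorem wordPerm_cons (σ : ι → Equiv.Perm α) (a : ι × Bool) (w : List (ι × Bool)) (x : α) :
    wordPerm σ (a :: w) x = letterPerm σ a (wordPerm σ w x) := by
  simp [wordPerm]

theorem letterPerm_not (σ : ι → Equiv.Perm α) (r : ι) (b : Bool) :
    letterPerm σ (r, !b) = (letterPerm σ (r, b))⁻¹ := by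
  cases b <;> simp [letterPerm]

/-- The points that are visited on the way from `x` to `wordPerm σ w x`. -/
def trail (σ : ι → Equiv.Perm α) (x : α) (w : List (ι × Bool)) : List α :=
  w.tails.map fun t => wordPerm σ t x

theorem trail_cons (σ : ι → Equiv.Perm α) (x : α) (a : ι × Bool) (w : List (ι × Bool)) :
    trail σ x (a :: w) = wordPerm σ (a :: w) x :: trail σ x w := by
  simp [trail]

theorem length_trail (σ : ι → Equiv.Perm α) (x : α) (w : List (ι × Bool)) :
    (trail σ x w).length = w.length + 1 := by
  simp [trail]

theorem mem_trail {σ : ι → Equiv.Perm α} {x : α} {w t : List (ι × Bool)} (h : t <:+ w) :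
    wordPerm σ t x ∈ trail σ x w :=
  List.mem_map.2 ⟨t, (List.mem_tails _ _).2 h, rfl⟩

variable [DecidableEq ι] [DecidableEq α]

/-- The family of permutations that arises from `σ` if the value of the letter `a` is changed by
the transposition of its value at `z` and `y`. -/
def redirect (σ : ι → Equiv.Perm α) (a : ι × Bool) (z y : α) : ι → Equiv.Perm α :=
  Function.update σ a.1 (letterPerm (fun _ => Equiv.swap (letterPerm σ a z) y * letterPerm σ a)
    (a.1, a.2))

theorem letterPerm_redirect_self (σ : ι → Equiv.Perm α) (a : ι × Bool) (z y : α) :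
    letterPerm (redirect σ a z y) a = Equiv.swap (letterPerm σ a z) y * letterPerm σ a := by
  obtain ⟨r, b⟩ := a
  cases b <;> simp [redirect, letterPerm]

theorem letterPerm_redirect_of_ne (σ : ι → Equiv.Perm α) {a c : ι × Bool} (h : c.1 ≠ a.1)
    (z y : α) : letterPerm (redirect σ a z y) c = letterPerm σ c := by
  simp [redirect, letterPerm, h]

theorem redirect_redirect (σ : ι → Equiv.Perm α) (a : ι × Bool) (z y : α) :
    redirect (redirect σ a z y) a z (letterPerm σ a z) = σ := by
  have h : letterPerm (redirect (redirect σ a z y) a z (letterPerm σ a z)) a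
      = letterPerm σ a := by
    rw [letterPerm_redirect_self, letterPerm_redirect_self]
    simp [Equiv.swap_comm, ← mul_assoc]
  funext r
  by_cases hr : r = a.1
  · subst hr
    obtain ⟨r, b⟩ := a
    cases b
    · simpa [letterPerm] using h
    · simpa [letterPerm] using h
  · simp [redirect, hr]

/-- The redirected letter differs from `a` only at the end `z` of the trail and at the preimage of
`y`. Before its end the trail does not meet `z`, and it never meets `y`. The inverse letter could
notice the change only in a step that arrives at `z`, which would be the leading letter of `w`,
against reducedness. -/
theorem wordPerm_redirect {σ : ι → Equiv.Perm α} {x y : α} {a : ι × Bool} {w : List (ι × Bool)}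
    (hred : FreeGroup.IsReduced (a :: w)) (hnd : (trail σ x w).Nodup) (hy : y ∉ trail σ x w) :
    ∀ t, t <:+ w → wordPerm (redirect σ a (wordPerm σ w x) y) t x = wordPerm σ t x := by
  have hinj : ∀ t t', t <:+ w → t' <:+ w → wordPerm σ t x = wordPerm σ t' x → t = t' :=
    fun t t' ht ht' h => List.inj_on_of_nodup_map hnd ((List.mem_tails _ _).2 ht)
      ((List.mem_tails _ _).2 ht') h
  intro t
  induction t with
  | nil => intro _; rfl
  | cons c t ih =>
    intro hct
    have ht : t <:+ w := (List.suffix_cons c t).trans hct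
    have hne : t ≠ w := by
      rintro rfl
      exact absurd hct.length_le (by simp)
    rw [wordPerm_cons, ih ht, wordPerm_cons]
    by_cases hc : c.1 = a.1
    · by_cases hb : c.2 = a.2
      · have hca : c = a := Prod.ext hc hb
        subst hca
        rw [letterPerm_redirect_self, Equiv.Perm.mul_apply]
        refine Equiv.swap_apply_of_ne_of_ne ?_ ?_
        · intro h
          exact hne (hinj _ _ ht List.suffix_rfl ((letterPerm σ c).injective h))
        · intro h
          refine hy ?_
          rw [← h, ← wordPerm_cons]
          exact mem_trail hct
      · obtain ⟨r, b⟩ := a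
        have hca : c = (r, !b) := Prod.ext hc (by
          cases hb' : c.2 <;> cases b <;> simp_all)
        subst hca
        rw [letterPerm_not, letterPerm_not, letterPerm_redirect_self, mul_inv_rev,
          Equiv.Perm.mul_apply, Equiv.swap_inv]
        congr 1
        refine Equiv.swap_apply_of_ne_of_ne ?_ ?_
        · intro h
          have h1 : wordPerm σ ((r, !b) :: t) x = wordPerm σ w x := by
            rw [wordPerm_cons, letterPerm_not, h]
            simp
          have h2 := hinj _ _ hct List.suffix_rfl h1
          subst h2
          have := (List.isChain_cons_cons.1 hred).1 rfl
          simp at this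
        · intro h
          exact hy (h ▸ mem_trail ht)
    · rw [letterPerm_redirect_of_ne _ hc]

variable [Fintype ι] [Fintype α]

-- A switching argument. Given a family `σ` whose next step returns to the trail and a point `y` off
-- the trail, redirect that step to `y` and record the old target. The trail is unchanged, so the
-- recorded target is one of its `w.length + 1` points, and the pair can be reconstructed.
open Classical in
theorem card_mul_le_of_isReduced (x : α) {a : ι × Bool} {w : List (ι × Bool)}
    (hred : FreeGroup.IsReduced (a :: w)) :
    (Finset.univ.filter fun σ : ι → Equiv.Perm α =>
      (trail σ x w).Nodup ∧ wordPerm σ (a :: w) x ∈ trail σ x w).card *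
        (Fintype.card α - (w.length + 1))
      ≤ (w.length + 1) * Fintype.card (ι → Equiv.Perm α) := by
  set B := Finset.univ.filter fun σ : ι → Equiv.Perm α =>
    (trail σ x w).Nodup ∧ wordPerm σ (a :: w) x ∈ trail σ x w with hB
  have h1 : (B.sigma fun σ => ((trail σ x w).toFinset)ᶜ).card
      = B.card * (Fintype.card α - (w.length + 1)) := by
    rw [Finset.card_sigma, Finset.sum_const_nat]
    intro σ hσ
    rw [Finset.card_compl, List.toFinset_card_of_nodup (Finset.mem_filter.1 hσ).2.1, length_trail]
  have h2 : ((Finset.univ : Finset (ι → Equiv.Perm α)).sigma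
      fun σ => (trail σ x w).toFinset).card
      ≤ (w.length + 1) * Fintype.card (ι → Equiv.Perm α) := by
    rw [Finset.card_sigma, mul_comm]
    refine Finset.sum_le_card_nsmul _ _ _ fun σ _ => ?_
    exact (List.toFinset_card_le _).trans (length_trail σ x w).le
  rw [← h1]
  refine le_trans (Finset.card_le_card_of_injOn
    (fun p => ⟨redirect p.1 a (wordPerm p.1 w x) p.2, wordPerm p.1 (a :: w) x⟩) ?_ ?_) h2
  · rintro ⟨σ, y⟩ hp
    simp only [Finset.coe_sigma, Set.mem_sigma_iff, Finset.mem_coe, hB, Finset.mem_filter,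
      Finset.mem_univ, true_and, Finset.mem_compl, List.mem_toFinset] at hp
    simp only [Finset.coe_sigma, Set.mem_sigma_iff, Finset.mem_coe, Finset.mem_univ, true_and,
      List.mem_toFinset]
    have htr : trail (redirect σ a (wordPerm σ w x) y) x w = trail σ x w :=
      List.map_congr_left fun t ht =>
        wordPerm_redirect hred hp.1.1 hp.2 t ((List.mem_tails _ _).1 ht)
    rw [htr]
    exact hp.1.2
  -- The end of the trail can be read off from the redirected family; redirecting it to the recorded
  -- target restores `σ`, and `y` is the redirected value there.
  · rintro ⟨σ, y⟩ hp ⟨σ', y'⟩ hp' heq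
    simp only [Finset.coe_sigma, Set.mem_sigma_iff, Finset.mem_coe, hB, Finset.mem_filter,
      Finset.mem_univ, true_and, Finset.mem_compl, List.mem_toFinset] at hp hp'
    simp only [Sigma.mk.injEq, heq_eq_eq] at heq
    obtain ⟨he, hv⟩ := heq
    have hz := wordPerm_redirect hred hp.1.1 hp.2 w List.suffix_rfl
    have hz' := wordPerm_redirect hred hp'.1.1 hp'.2 w List.suffix_rfl
    have hzz : wordPerm σ w x = wordPerm σ' w x := by rw [← hz, ← hz', he]
    have hσ : σ = σ' := by
      rw [← redirect_redirect σ a (wordPerm σ w x) y,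
        ← redirect_redirect σ' a (wordPerm σ' w x) y', he, ← wordPerm_cons, ← wordPerm_cons, hv,
        hzz]
    subst hσ
    have hy : ∀ y, letterPerm (redirect σ a (wordPerm σ w x) y) a (wordPerm σ w x) = y := by
      intro y
      rw [letterPerm_redirect_self]
      simp
    have hyy : y = y' := by rw [← hy y, he, hy]
    rw [hyy]

-- Union bound over the letter at which the trail first meets itself; the induction closes by `k² +
-- (k + 1) ≤ (k + 1)²`.
open Classical in
theorem card_not_nodup_trail_mul_le (x : α) {w : List (ι × Bool)} (hred : FreeGroup.IsReduced w) :
    (Finset.univ.filter fun σ : ι → Equiv.Perm α => ¬(trail σ x w).Nodup).card *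
        (Fintype.card α - w.length)
      ≤ w.length ^ 2 * Fintype.card (ι → Equiv.Perm α) := by
  induction w with
  | nil => simp [trail]
  | cons a w ih =>
    have hw : FreeGroup.IsReduced w := List.IsChain.tail hred
    have hsub : (Finset.univ.filter fun σ : ι → Equiv.Perm α => ¬(trail σ x (a :: w)).Nodup) ⊆
        (Finset.univ.filter fun σ : ι → Equiv.Perm α => ¬(trail σ x w).Nodup) ∪
        (Finset.univ.filter fun σ : ι → Equiv.Perm α =>
          (trail σ x w).Nodup ∧ wordPerm σ (a :: w) x ∈ trail σ x w) := by
      intro σ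
      simp only [Finset.mem_filter, Finset.mem_univ, true_and, Finset.mem_union, trail_cons,
        List.nodup_cons]
      tauto
    have hcard := (Finset.card_le_card hsub).trans (Finset.card_union_le _ _)
    have h1 := ih hw
    have h2 := card_mul_le_of_isReduced (α := α) x hred
    have h3 : Fintype.card α - (w.length + 1) ≤ Fintype.card α - w.length := by omega
    rw [List.length_cons]
    set T := Fintype.card (ι → Equiv.Perm α)
    calc _ ≤ (_ + _) * (Fintype.card α - (w.length + 1)) := Nat.mul_le_mul_right _ hcard
      _ ≤ w.length ^ 2 * T + (w.length + 1) * T := by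
        rw [add_mul]
        exact add_le_add ((Nat.mul_le_mul_left _ h3).trans h1) h2
      _ ≤ (w.length + 1) ^ 2 * T := by nlinarith [Nat.zero_le (w.length * T)]

open Classical in
/-- A nontrivial reduced word in random permutations has few fixed points on average. -/
theorem sum_card_fixed_mul_le {w : List (ι × Bool)} (hred : FreeGroup.IsReduced w) (hw : w ≠ []) :
    (∑ σ : ι → Equiv.Perm α, (Finset.univ.filter fun x => wordPerm σ w x = x).card) *
        (Fintype.card α - w.length)
      ≤ Fintype.card α * (w.length ^ 2 * Fintype.card (ι → Equiv.Perm α)) := by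
  have hcomm : ∑ σ : ι → Equiv.Perm α, (Finset.univ.filter fun x => wordPerm σ w x = x).card
      = ∑ x : α, (Finset.univ.filter fun σ : ι → Equiv.Perm α => wordPerm σ w x = x).card := by
    simp only [Finset.card_filter]
    exact Finset.sum_comm
  rw [hcomm, Finset.sum_mul, ← smul_eq_mul (a := Fintype.card α)]
  refine Finset.sum_le_card_nsmul _ _ _ fun x _ => ?_
  refine le_trans (Nat.mul_le_mul_right _ (Finset.card_le_card ?_))
    (card_not_nodup_trail_mul_le x hred)
  intro σ
  simp only [Finset.mem_filter, Finset.mem_univ, true_and]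
  -- At a fixed point the two ends of the trail agree, although they belong to different suffixes of
  -- the nonempty word.
  intro hx hnd
  have := List.inj_on_of_nodup_map hnd ((List.mem_tails _ _).2 (List.suffix_rfl (l := w)))
    ((List.mem_tails _ _).2 (List.nil_suffix (l := w))) (by simpa [wordPerm] using hx)
  exact hw this

end RandomPermutations

/-! ### Freeness and loop equations -/

section Alternating

variable {A ι : Type*} [Ring A] [Algebra ℂ A] {φ : A →ₗ[ℂ] ℂ} {B : ι → Subalgebra ℂ A}

/-- Alternating lists of centred elements. -/
def IsAlternating (φ : A →ₗ[ℂ] ℂ) (B : ι → Subalgebra ℂ A) (l : List (ι × A)) : Prop :=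
  (∀ p ∈ l, p.2 ∈ B p.1 ∧ φ p.2 = 0) ∧ (l.map Prod.fst).IsChain (· ≠ ·)

theorem IsAlternating.cons {l : List (ι × A)} (hl : IsAlternating φ B l) {i : ι} {a : A}
    (ha : a ∈ B i) (ha0 : φ a = 0) (hc : (i :: l.map Prod.fst).IsChain (· ≠ ·)) :
    IsAlternating φ B ((i, a) :: l) := by
  refine ⟨?_, by simpa using hc⟩
  rintro p hp
  rcases List.mem_cons.1 hp with rfl | hp
  · exact ⟨ha, ha0⟩
  · exact hl.1 p hp

theorem IsAlternating.of_cons {l : List (ι × A)} {p : ι × A} (hl : IsAlternating φ B (p :: l)) :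
    IsAlternating φ B l :=
  ⟨fun q hq => hl.1 q (List.mem_cons_of_mem _ hq), by
    have := hl.2
    rw [List.map_cons] at this
    exact this.tail⟩

theorem IsAlternating.concat {l : List (ι × A)} (hl : IsAlternating φ B l) {i : ι} {a : A}
    (ha : a ∈ B i) (ha0 : φ a = 0) (hc : (l.map Prod.fst ++ [i]).IsChain (· ≠ ·)) :
    IsAlternating φ B (l ++ [(i, a)]) := by
  refine ⟨?_, by simpa using hc⟩
  rintro p hp
  rcases List.mem_append.1 hp with hp | hp
  · exact hl.1 p hp
  · rw [List.mem_singleton.1 hp]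
    exact ⟨ha, ha0⟩

theorem IsFree.map_prod_eq_zero (h : IsFree φ B) {l : List (ι × A)} (hl : IsAlternating φ B l)
    (hne : l ≠ []) : φ (l.map Prod.snd).prod = 0 := by
  obtain ⟨n, hn⟩ : ∃ n, l.length = n + 1 :=
    Nat.exists_eq_succ_of_ne_zero (by simpa using hne)
  have key := h n (fun i => (l.get (Fin.cast hn.symm i)).1)
    (fun i => (l.get (Fin.cast hn.symm i)).2)
    (fun i => (hl.1 _ (List.get_mem _ _)).1) (fun i => (hl.1 _ (List.get_mem _ _)).2) (by
      intro i
      have := List.isChain_iff_getElem.1 hl.2 i (by simp [hn])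
      simpa using this)
  have hlist : List.ofFn (fun i => (l.get (Fin.cast hn.symm i)).2) = l.map Prod.snd := by
    refine List.ext_getElem (by simp [hn]) fun k h1 h2 => ?_
    rw [List.getElem_ofFn, List.getElem_map]
    rfl
  rwa [hlist] at key

theorem map_sub_algebraMap (h1 : φ 1 = 1) (a : A) : φ (a - algebraMap ℂ A (φ a)) = 0 := by
  rw [map_sub, Algebra.algebraMap_eq_smul_one, map_smul, h1, smul_eq_mul, mul_one, sub_self]

/-- The last factor need not be centred: its scalar part multiplies a product that is still
alternating, centred and nonempty. The two variants below treat the first factor and both ends. -/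
theorem IsFree.map_prod_mul_eq_zero (h : IsFree φ B) (h1 : φ 1 = 1) {l : List (ι × A)}
    (hl : IsAlternating φ B l) (hne : l ≠ []) {j : ι} {d : A} (hd : d ∈ B j)
    (hc : (l.map Prod.fst ++ [j]).IsChain (· ≠ ·)) : φ ((l.map Prod.snd).prod * d) = 0 := by
  have hl' := hl.concat (sub_mem hd ((B j).algebraMap_mem (φ d))) (map_sub_algebraMap h1 d) hc
  have := h.map_prod_eq_zero hl' (by simp)
  rw [List.map_append, List.prod_append] at this
  simp only [List.map_cons, List.map_nil, List.prod_cons, List.prod_nil, mul_one] at this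
  rw [mul_sub, map_sub, Algebra.algebraMap_eq_smul_one, mul_smul_comm, mul_one, map_smul,
    h.map_prod_eq_zero hl hne, smul_zero, sub_zero] at this
  exact this

theorem IsFree.map_mul_prod_eq_zero (h : IsFree φ B) (h1 : φ 1 = 1) {l : List (ι × A)}
    (hl : IsAlternating φ B l) (hne : l ≠ []) {i : ι} {b : A} (hb : b ∈ B i)
    (hc : (i :: l.map Prod.fst).IsChain (· ≠ ·)) : φ (b * (l.map Prod.snd).prod) = 0 := by
  have hl' := hl.cons (sub_mem hb ((B i).algebraMap_mem (φ b))) (map_sub_algebraMap h1 b) hc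
  have := h.map_prod_eq_zero hl' (by simp)
  rw [List.map_cons, List.prod_cons] at this
  rw [sub_mul, map_sub, Algebra.algebraMap_eq_smul_one, smul_mul_assoc, one_mul, map_smul,
    h.map_prod_eq_zero hl hne, smul_zero, sub_zero] at this
  exact this

theorem IsFree.map_mul_prod_mul_eq_zero (h : IsFree φ B) (h1 : φ 1 = 1) {l : List (ι × A)}
    (hl : IsAlternating φ B l) (hne : l ≠ []) {i j : ι} {b d : A} (hb : b ∈ B i) (hd : d ∈ B j)
    (hc : (i :: (l.map Prod.fst ++ [j])).IsChain (· ≠ ·)) :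
    φ (b * (l.map Prod.snd).prod * d) = 0 := by
  have hc' : (i :: l.map Prod.fst).IsChain (· ≠ ·) := by
    rw [← List.cons_append] at hc
    exact hc.left_of_append
  have hl' := hl.cons (sub_mem hb ((B i).algebraMap_mem (φ b))) (map_sub_algebraMap h1 b) hc'
  have := h.map_prod_mul_eq_zero h1 hl' (by simp) hd (by simpa using hc)
  rw [List.map_cons, List.prod_cons] at this
  rw [sub_mul, sub_mul, map_sub, Algebra.algebraMap_eq_smul_one, smul_mul_assoc, one_mul,
    smul_mul_assoc, map_smul, h.map_prod_mul_eq_zero h1 hl hne hd hc.tail, smul_zero,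
    sub_zero] at this
  exact this

end Alternating

/-! ### Free difference quotients -/

section FreeDifference

open scoped TensorProduct

variable {A L : Type*} [Ring A] [Algebra ℂ A]

/-- The matrix whose upper right entry is the value of the free difference quotient at a letter. -/
def diffMatrix (v : L → A) (Y : L → Bool) (l : L) : Matrix (Fin 2) (Fin 2) (A ⊗[ℂ] A) :=
  !![v l ⊗ₜ 1, if Y l then 1 else 0; 0, 1 ⊗ₜ v l]

/-- The homomorphism whose upper right entry is the free difference quotient. -/
def diffHom (v : L → A) (Y : L → Bool) : FreeAlgebra ℂ L →ₐ[ℂ] Matrix (Fin 2) (Fin 2) (A ⊗[ℂ] A) :=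
  FreeAlgebra.lift ℂ (diffMatrix v Y)

variable (v : L → A) (Y : L → Bool)

theorem diffHom_lower_left (p : FreeAlgebra ℂ L) : diffHom v Y p 1 0 = 0 := by
  induction p using FreeAlgebra.induction with
  | grade0 c => simp [Matrix.algebraMap_matrix_apply]
  | grade1 l => simp [diffHom, diffMatrix]
  | mul p q hp hq => simp [Matrix.mul_apply, hp, hq]
  | add p q hp hq => simp [hp, hq]

theorem diffHom_upper_left (p : FreeAlgebra ℂ L) :
    diffHom v Y p 0 0 = FreeAlgebra.lift ℂ v p ⊗ₜ 1 := by
  induction p using FreeAlgebra.induction with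
  | grade0 c => simp [Matrix.algebraMap_matrix_apply, Algebra.TensorProduct.algebraMap_apply]
  | grade1 l => simp [diffHom, diffMatrix]
  | mul p q hp hq =>
    rw [map_mul, Matrix.mul_apply, Fin.sum_univ_two, hp, hq, diffHom_lower_left]
    simp
  | add p q hp hq => simp [hp, hq, TensorProduct.add_tmul]

theorem diffHom_lower_right (p : FreeAlgebra ℂ L) :
    diffHom v Y p 1 1 = 1 ⊗ₜ FreeAlgebra.lift ℂ v p := by
  induction p using FreeAlgebra.induction with
  | grade0 c =>
    rw [AlgHom.commutes, AlgHom.commutes, Matrix.algebraMap_matrix_apply, if_pos rfl,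
      Algebra.TensorProduct.algebraMap_apply, Algebra.algebraMap_eq_smul_one,
      TensorProduct.smul_tmul]
  | grade1 l => simp [diffHom, diffMatrix]
  | mul p q hp hq =>
    rw [map_mul, Matrix.mul_apply, Fin.sum_univ_two, hp, hq, diffHom_lower_left]
    simp
  | add p q hp hq => simp [hp, hq, TensorProduct.tmul_add]

/-- The free difference quotient with respect to the letters in `Y`. -/
def freeDiff : FreeAlgebra ℂ L →ₗ[ℂ] A ⊗[ℂ] A where
  toFun p := diffHom v Y p 0 1
  map_add' p q := by simp
  map_smul' c p := by simp

theorem freeDiff_one : freeDiff v Y 1 = 0 := by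
  simp [freeDiff]

/-- This Leibniz rule is the product rule for the corner entry of upper triangular `2 × 2` matrices.
It makes the quotient available on the free algebra by the universal property alone. -/
theorem freeDiff_mul (p q : FreeAlgebra ℂ L) : freeDiff v Y (p * q) =
    (FreeAlgebra.lift ℂ v p ⊗ₜ 1) * freeDiff v Y q
      + freeDiff v Y p * (1 ⊗ₜ FreeAlgebra.lift ℂ v q) := by
  simp only [freeDiff, LinearMap.coe_mk, AddHom.coe_mk, map_mul, Matrix.mul_apply,
    Fin.sum_univ_two, diffHom_upper_left, diffHom_lower_right]

theorem freeDiff_ι (l : L) : freeDiff v Y (FreeAlgebra.ι ℂ l) = if Y l then 1 else 0 := by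
  simp [freeDiff, diffHom, diffMatrix]

/-- The sum over splits in the loop equation thus becomes linear in the word and extends from words
to polynomials, in particular to centred ones. -/
theorem freeDiff_word (Q : List L) : freeDiff v Y (Q.map (FreeAlgebra.ι ℂ)).prod =
    ((splits Y Q).map fun p => (p.1.map v).prod ⊗ₜ[ℂ] (p.2.map v).prod).sum := by
  induction Q with
  | nil => simp [splits, freeDiff_one]
  | cons a Q ih =>
    rw [List.map_cons, List.prod_cons, freeDiff_mul, ih, freeDiff_ι, FreeAlgebra.lift_ι_apply,
      splits, List.map_append, List.sum_append, add_comm, map_list_prod, List.map_map, List.map_map,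
      ← List.sum_map_mul_left]
    congr 1
    · have : (FreeAlgebra.lift ℂ v) ∘ (FreeAlgebra.ι ℂ) = v := by
        ext l
        simp
      split_ifs with ha
      · simp [this]
      · simp
    · congr 1
      refine List.map_congr_left fun p _ => ?_
      simp

end FreeDifference

/-! ### Loop equations in free families -/

section JointLoop

open scoped TensorProduct

variable {A ι : Type*} [Ring A] [Algebra ℂ A] {φ : A →ₗ[ℂ] ℂ} {B : ι → Subalgebra ℂ A}
  {v : ι × Bool → A}

/-- The polynomials in the letters with index `i`. -/
def letterAlgebra (i : ι) : Subalgebra ℂ (FreeAlgebra ℂ (ι × Bool)) :=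
  Algebra.adjoin ℂ (FreeAlgebra.ι ℂ '' {l | l.1 = i})

theorem ι_mem_letterAlgebra (l : ι × Bool) : FreeAlgebra.ι ℂ l ∈ letterAlgebra l.1 :=
  Algebra.subset_adjoin ⟨l, rfl, rfl⟩

theorem lift_mem_of_mem_letterAlgebra (hv : ∀ l, v l ∈ B l.1) {i : ι}
    {p : FreeAlgebra ℂ (ι × Bool)} (hp : p ∈ letterAlgebra i) : FreeAlgebra.lift ℂ v p ∈ B i := by
  induction hp using Algebra.adjoin_induction with
  | mem x hx =>
    obtain ⟨l, rfl, rfl⟩ := hx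
    rw [FreeAlgebra.lift_ι_apply]
    exact hv l
  | algebraMap c => simp
  | add p q _ _ hp hq => rw [map_add]; exact add_mem hp hq
  | mul p q _ _ hp hq => rw [map_mul]; exact mul_mem hp hq

/-- A linear map on the free algebra vanishes on `letterAlgebra i` if it does so at words. -/
theorem eq_zero_of_mem_letterAlgebra {M : Type*} [AddCommGroup M] [Module ℂ M]
    (E : FreeAlgebra ℂ (ι × Bool) →ₗ[ℂ] M) {i : ι}
    (hE : ∀ Q : List (ι × Bool), (∀ l ∈ Q, l.1 = i) → E (Q.map (FreeAlgebra.ι ℂ)).prod = 0)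
    {p : FreeAlgebra ℂ (ι × Bool)} (hp : p ∈ letterAlgebra i) : E p = 0 := by
  have hp' : p ∈ Subalgebra.toSubmodule (letterAlgebra i) := hp
  rw [letterAlgebra, Algebra.adjoin_eq_span] at hp'
  clear hp
  induction hp' using Submodule.span_induction with
  | mem x hx =>
    obtain ⟨l, hl, rfl⟩ := Submonoid.exists_list_of_mem_closure hx
    choose f hf using hl
    have h1 : l = (l.attach.map fun y => f y.1 y.2).map (FreeAlgebra.ι ℂ) := by
      rw [List.map_map]
      conv_lhs => rw [← List.attach_map_subtype_val l]
      exact List.map_congr_left fun y _ => (hf y.1 y.2).2.symm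
    rw [h1]
    refine hE _ fun y hy => ?_
    obtain ⟨z, _, rfl⟩ := List.mem_map.1 hy
    exact (hf z.1 z.2).1
  | zero => simp
  | add p q _ _ h h' => rw [map_add, h, h', add_zero]
  | smul c p _ h => rw [map_smul, h, smul_zero]

/-- The free algebra is spanned by the products of alternating lists of centred polynomials. -/
theorem eq_zero_of_isAlternating (h1 : φ 1 = 1) (E : FreeAlgebra ℂ (ι × Bool) →ₗ[ℂ] ℂ)
    (hE : ∀ l, IsAlternating (φ ∘ₗ (FreeAlgebra.lift ℂ v).toLinearMap) letterAlgebra l →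
      E (l.map Prod.snd).prod = 0) (p : FreeAlgebra ℂ (ι × Bool)) : E p = 0 := by
  set ψ := φ ∘ₗ (FreeAlgebra.lift ℂ v).toLinearMap with hψ
  have hψ1 : ψ 1 = 1 := by simp [hψ, h1]
  set T : Submodule ℂ (FreeAlgebra ℂ (ι × Bool)) :=
    Submodule.span ℂ {q | ∃ l, IsAlternating ψ letterAlgebra l ∧ q = (l.map Prod.snd).prod}
  have hT : ∀ l, IsAlternating ψ letterAlgebra l → (l.map Prod.snd).prod ∈ T :=
    fun l hl => Submodule.subset_span ⟨l, hl, rfl⟩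
  have hletter : ∀ (c : ι × Bool) l, IsAlternating ψ letterAlgebra l →
      FreeAlgebra.ι ℂ c * (l.map Prod.snd).prod ∈ T := by
    intro c l hl
    -- A further factor of a new index is split into its centred part and a scalar. A letter with
    -- the index of the leading factor is first merged with it, and the product is centred anew. So
    -- the span is stable under left multiplication by letters, and it contains `1`.
    have hstep : ∀ (i : ι) (x : FreeAlgebra ℂ (ι × Bool)) l, IsAlternating ψ letterAlgebra l →
        x ∈ letterAlgebra i → (i :: l.map Prod.fst).IsChain (· ≠ ·) →
        x * (l.map Prod.snd).prod ∈ T := by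
      intro i x l hl hx hc
      have h2 := hT _ (hl.cons (sub_mem hx ((letterAlgebra i).algebraMap_mem (ψ x)))
        (map_sub_algebraMap hψ1 x) hc)
      have h3 := T.smul_mem (ψ x) (hT l hl)
      have h4 := T.add_mem h2 h3
      rw [List.map_cons, List.prod_cons, sub_mul, Algebra.algebraMap_eq_smul_one, smul_mul_assoc,
        one_mul, sub_add_cancel] at h4
      exact h4
    by_cases hc : (c.1 :: l.map Prod.fst).IsChain (· ≠ ·)
    · exact hstep c.1 _ l hl (ι_mem_letterAlgebra c) hc
    · rcases l with _ | ⟨⟨i, x⟩, l⟩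
      · simp at hc
      · have hi : c.1 = i := by
          by_contra hne
          exact hc (by simpa using ⟨hne, by simpa using hl.2⟩)
        rw [List.map_cons, List.prod_cons, ← mul_assoc]
        refine hstep i _ l hl.of_cons ?_ (by simpa using hl.2)
        exact mul_mem (hi ▸ ι_mem_letterAlgebra c) (hl.1 (i, x) (by simp)).1
  have hmul : ∀ p : FreeAlgebra ℂ (ι × Bool), ∀ t ∈ T, p * t ∈ T := by
    intro p
    induction p using FreeAlgebra.induction with
    | grade0 c =>
      intro t ht
      rw [Algebra.algebraMap_eq_smul_one, smul_mul_assoc, one_mul]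
      exact T.smul_mem _ ht
    | grade1 c =>
      intro t ht
      induction ht using Submodule.span_induction with
      | mem x hx =>
        obtain ⟨l, hl, rfl⟩ := hx
        exact hletter c l hl
      | zero => simp
      | add x y _ _ hx hy => rw [mul_add]; exact T.add_mem hx hy
      | smul a x _ hx => rw [mul_smul_comm]; exact T.smul_mem _ hx
    | mul p q hp hq => intro t ht; rw [mul_assoc]; exact hp _ (hq t ht)
    | add p q hp hq => intro t ht; rw [add_mul]; exact T.add_mem (hp t ht) (hq t ht)
  have hp : p ∈ T := by
    have := hmul p 1 (by simpa using hT [] ⟨by simp, by simp⟩)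
    rwa [mul_one] at this
  induction hp using Submodule.span_induction with
  | mem x hx =>
    obtain ⟨l, hl, rfl⟩ := hx
    exact hE l hl
  | zero => simp
  | add x y _ _ hx hy => rw [map_add, hx, hy, add_zero]
  | smul a x _ hx => rw [map_smul, hx, smul_zero]

/-- The functional `a ⊗ b ↦ φ (η a) φ b`. -/
def pairFunctional (φ : A →ₗ[ℂ] ℂ) (η : A) : A ⊗[ℂ] A →ₗ[ℂ] ℂ :=
  LinearMap.mul' ℂ ℂ ∘ₗ TensorProduct.map (φ ∘ₗ LinearMap.mulLeft ℂ η) φ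

theorem pairFunctional_tmul (η a b : A) : pairFunctional φ η (a ⊗ₜ b) = φ (η * a) * φ b := by
  simp [pairFunctional]

variable {Y : ι × Bool → Bool} {r : ι} {η x : A}

theorem freeDiff_eq_zero (hY : ∀ l, Y l → l.1 = r) {i : ι} (hi : i ≠ r)
    {p : FreeAlgebra ℂ (ι × Bool)} (hp : p ∈ letterAlgebra i) : freeDiff v Y p = 0 := by
  induction hp using Algebra.adjoin_induction with
  | mem q hq =>
    obtain ⟨l, rfl, rfl⟩ := hq
    rw [freeDiff_ι, if_neg fun h => hi (hY l h)]
  | algebraMap c => rw [Algebra.algebraMap_eq_smul_one, map_smul, freeDiff_one, smul_zero]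
  | add p q _ _ hp hq => rw [map_add, hp, hq, add_zero]
  | mul p q _ _ hp hq => rw [freeDiff_mul, hp, hq, mul_zero, zero_mul, add_zero]

theorem splits_subset {M : Type*} {Y : M → Bool} {Q : List M} :
    ∀ p ∈ splits Y Q, (∀ l ∈ p.1, l ∈ Q) ∧ ∀ l ∈ p.2, l ∈ Q := by
  induction Q with
  | nil => simp [splits]
  | cons a Q ih =>
    intro p hp
    simp only [splits, List.mem_append, List.mem_map] at hp
    rcases hp with hp | ⟨q, hq, rfl⟩
    · split_ifs at hp
      · rw [List.mem_singleton.1 hp]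
        exact ⟨by simp, fun l hl => by simp [hl]⟩
      · simp at hp
    · have := ih q hq
      refine ⟨fun l hl => ?_, fun l hl => List.mem_cons_of_mem _ (this.2 l hl)⟩
      rcases List.mem_cons.1 hl with rfl | hl
      · simp
      · exact List.mem_cons_of_mem _ (this.1 l hl)

theorem prod_map_mem (hv : ∀ l, v l ∈ B l.1) {i : ι} {Q : List (ι × Bool)}
    (hQ : ∀ l ∈ Q, l.1 = i) : (Q.map v).prod ∈ B i :=
  Subalgebra.list_prod_mem _ fun a ha => by
    obtain ⟨l, hl, rfl⟩ := List.mem_map.1 ha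
    exact hQ l hl ▸ hv l

/-- At a word with index `r` the difference quotient is a sum of tensors `d ⊗ d'` from `B r`, and
the functional takes the value `φ (η a d) φ (d' b)` there. -/
theorem pairFunctional_freeDiff_eq_zero (hv : ∀ l, v l ∈ B l.1) {a b : A}
    (hab : (∀ d ∈ B r, φ (η * (a * d)) = 0) ∨ ∀ d ∈ B r, φ (d * b) = 0)
    {p : FreeAlgebra ℂ (ι × Bool)} (hp : p ∈ letterAlgebra r) :
    pairFunctional φ η ((a ⊗ₜ 1) * (freeDiff v Y p * (1 ⊗ₜ b))) = 0 := by
  refine eq_zero_of_mem_letterAlgebra (pairFunctional φ η ∘ₗ LinearMap.mulLeft ℂ (a ⊗ₜ 1) ∘ₗ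
    LinearMap.mulRight ℂ (1 ⊗ₜ b) ∘ₗ freeDiff v Y) (fun Q hQ => ?_) hp
  simp only [LinearMap.comp_apply, LinearMap.mulLeft_apply, LinearMap.mulRight_apply,
    freeDiff_word]
  rw [← List.sum_map_mul_right, ← List.sum_map_mul_left, map_list_sum, List.map_map]
  refine List.sum_eq_zero fun y hy => ?_
  obtain ⟨q, hq, rfl⟩ := List.mem_map.1 hy
  have hsub := splits_subset q hq
  have hm1 := prod_map_mem hv fun l hl => hQ l (hsub.1 l hl)
  have hm2 := prod_map_mem hv fun l hl => hQ l (hsub.2 l hl)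
  simp only [Function.comp_apply, Algebra.TensorProduct.tmul_mul_tmul, one_mul, mul_one,
    pairFunctional_tmul]
  rcases hab with h | h
  · rw [h _ hm1, zero_mul]
  · rw [h _ hm2, mul_zero]

theorem map_lift_prod (l : List (ι × FreeAlgebra ℂ (ι × Bool))) :
    FreeAlgebra.lift ℂ v (l.map Prod.snd).prod
      = ((l.map fun p => (p.1, FreeAlgebra.lift ℂ v p.2)).map Prod.snd).prod := by
  rw [map_list_prod, List.map_map, List.map_map]
  rfl

theorem IsAlternating.lift (hv : ∀ l, v l ∈ B l.1) {l : List (ι × FreeAlgebra ℂ (ι × Bool))}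
    (hl : IsAlternating (φ ∘ₗ (FreeAlgebra.lift ℂ v).toLinearMap) letterAlgebra l) :
    IsAlternating φ B (l.map fun p => (p.1, FreeAlgebra.lift ℂ v p.2)) := by
  refine ⟨fun p hp => ?_, ?_⟩
  · obtain ⟨q, hq, rfl⟩ := List.mem_map.1 hp
    exact ⟨lift_mem_of_mem_letterAlgebra hv (hl.1 q hq).1, (hl.1 q hq).2⟩
  · simpa [List.map_map, Function.comp_def] using hl.2

/-- The Leibniz rule differentiates one factor of index `r` at a time, `l₁` holding the factors
already passed. If factors follow, the right tensor leg is an alternating product with only its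
first factor uncentred and is annihilated. If none follow, some precede, and the left leg is
annihilated. -/
theorem IsFree.pairFunctional_freeDiff_prod (hfree : IsFree φ B) (h1 : φ 1 = 1)
    (hv : ∀ l, v l ∈ B l.1) (hη : η ∈ B r) (hY : ∀ l, Y l → l.1 = r)
    (l₂ l₁ : List (ι × FreeAlgebra ℂ (ι × Bool)))
    (hl : IsAlternating (φ ∘ₗ (FreeAlgebra.lift ℂ v).toLinearMap) letterAlgebra (l₁ ++ l₂))
    (hne : ¬(l₁ = [] ∧ ∃ p, l₂ = [(r, p)])) :
    pairFunctional φ η ((FreeAlgebra.lift ℂ v (l₁.map Prod.snd).prod ⊗ₜ 1) *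
      freeDiff v Y (l₂.map Prod.snd).prod) = 0 := by
  induction l₂ generalizing l₁ with
  | nil => simp [freeDiff_one]
  | cons q l₂ ih =>
    obtain ⟨i, p⟩ := q
    have hmem : ∀ q ∈ l₁ ++ (i, p) :: l₂, q.2 ∈ letterAlgebra q.1 := fun q hq => (hl.1 q hq).1
    rw [List.map_cons, List.prod_cons, freeDiff_mul, mul_add, map_add, ← mul_assoc,
      Algebra.TensorProduct.tmul_mul_tmul, mul_one, ← map_mul]
    have hfirst := ih (l₁ ++ [(i, p)]) (by simpa using hl) (by simp)
    rw [List.map_append, List.prod_append] at hfirst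
    simp only [List.map_cons, List.map_nil, List.prod_cons, List.prod_nil, mul_one] at hfirst
    rw [hfirst, zero_add]
    by_cases hi : i = r
    swap
    · rw [freeDiff_eq_zero hY hi (hmem (i, p) (by simp)), zero_mul, mul_zero, map_zero]
    subst hi
    refine pairFunctional_freeDiff_eq_zero hv ?_ (hmem (i, p) (by simp))
    have hlA := hl.lift hv
    by_cases hl₂ : l₂ = []
    · left
      subst hl₂
      intro d hd
      rw [map_lift_prod, ← mul_assoc]
      rcases l₁ with _ | ⟨⟨j, p'⟩, l₁⟩
      · exact absurd ⟨rfl, p, rfl⟩ hne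
      have hchain : (j :: (l₁.map Prod.fst ++ [i])).IsChain (· ≠ ·) := by simpa using hl.2
      have hl₁ : IsAlternating φ B
          (((j, p') :: l₁).map fun p => (p.1, FreeAlgebra.lift ℂ v p.2)) := by
        refine ⟨fun q hq => hlA.1 q (by rw [List.map_append]; exact List.mem_append_left _ hq), ?_⟩
        have := hlA.2
        rw [List.map_append, List.map_append] at this
        exact this.left_of_append
      -- If the leading factor has index `r`, it merges with `η`. Something centred remains, because
      -- two adjacent factors cannot both have index `r`.
      by_cases hj : j = i
      · subst hj
        have hl₁ne : l₁ ≠ [] := by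
          rintro rfl
          simp at hchain
        rw [List.map_cons, List.map_cons, List.prod_cons, ← mul_assoc]
        refine hfree.map_mul_prod_mul_eq_zero h1 hl₁.of_cons (by simpa using hl₁ne)
          (mul_mem hη (hl₁.1 (j, _) (by simp)).1) hd ?_
        simpa [List.map_map, Function.comp_def] using hchain
      · refine hfree.map_mul_prod_mul_eq_zero h1 hl₁ (by simp) hη hd ?_
        simp only [List.map_cons, List.map_map, Function.comp_def, List.cons_append]
        exact List.isChain_cons_cons.2 ⟨Ne.symm hj, hchain⟩
    · right
      intro d hd
      rw [map_lift_prod]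
      have hl₂A : IsAlternating φ B
          (((i, p) :: l₂).map fun p => (p.1, FreeAlgebra.lift ℂ v p.2)) := by
        refine ⟨fun q hq => hlA.1 q (by rw [List.map_append]; exact List.mem_append_right _ hq), ?_⟩
        have := hlA.2
        rw [List.map_append, List.map_append] at this
        exact this.right_of_append
      refine hfree.map_mul_prod_eq_zero h1 hl₂A.of_cons (by simpa using hl₂) hd ?_
      simpa [List.map_map, Function.comp_def] using hl₂A.2

/-- In a free family, the loop equation for one element implies the loop equation for all words. -/
theorem IsFree.loop_equation (hfree : IsFree φ B) (h1 : φ 1 = 1) (hv : ∀ l, v l ∈ B l.1)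
    (hη : η ∈ B r) (hx : x ∈ B r) (hY : ∀ l, Y l → l.1 = r) {κ : ℂ}
    (hone : ∀ Q : List (ι × Bool), (∀ l ∈ Q, l.1 = r) →
      φ (x * (Q.map v).prod) = κ * φ (Q.map v).prod +
        ((splits Y Q).map fun p => φ (η * (p.1.map v).prod) * φ (p.2.map v).prod).sum)
    (Q : List (ι × Bool)) :
    φ (x * (Q.map v).prod) = κ * φ (Q.map v).prod +
      ((splits Y Q).map fun p => φ (η * (p.1.map v).prod) * φ (p.2.map v).prod).sum := by
  set E : FreeAlgebra ℂ (ι × Bool) →ₗ[ℂ] ℂ :=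
    φ ∘ₗ LinearMap.mulLeft ℂ x ∘ₗ (FreeAlgebra.lift ℂ v).toLinearMap
      - κ • (φ ∘ₗ (FreeAlgebra.lift ℂ v).toLinearMap)
      - pairFunctional φ η ∘ₗ freeDiff v Y with hE
  have hEp : ∀ p, E p = φ (x * FreeAlgebra.lift ℂ v p) - κ * φ (FreeAlgebra.lift ℂ v p)
      - pairFunctional φ η (freeDiff v Y p) := fun p => by simp [hE]
  have hlift : ∀ Q : List (ι × Bool), FreeAlgebra.lift ℂ v (Q.map (FreeAlgebra.ι ℂ)).prod
      = (Q.map v).prod := by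
    intro Q
    rw [map_list_prod, List.map_map]
    congr 1
    exact List.map_congr_left fun l _ => FreeAlgebra.lift_ι_apply _ _
  have hEQ : ∀ Q : List (ι × Bool), E (Q.map (FreeAlgebra.ι ℂ)).prod
      = φ (x * (Q.map v).prod) - κ * φ (Q.map v).prod -
      ((splits Y Q).map fun p => φ (η * (p.1.map v).prod) * φ (p.2.map v).prod).sum := by
    intro Q
    rw [hEp, hlift, freeDiff_word, map_list_sum, List.map_map]
    simp only [Function.comp_def, pairFunctional_tmul]
  -- The defect `E` of the equation is linear, so alternating products suffice. The empty product
  -- and a single factor of index `r` fall under `hone`; for all others the three terms of `E`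
  -- vanish separately.
  have hE0 : ∀ p, E p = 0 := by
    refine eq_zero_of_isAlternating (v := v) h1 E fun l hl => ?_
    by_cases hl1 : l = []
    · have := hEQ []
      rw [hone [] (by simp)] at this
      subst hl1
      simpa using this
    by_cases hl2 : ∃ p, l = [(r, p)]
    · obtain ⟨p, rfl⟩ := hl2
      simp only [List.map_cons, List.map_nil, List.prod_cons, List.prod_nil, mul_one]
      refine eq_zero_of_mem_letterAlgebra E (fun Q hQ => ?_) (hl.1 (r, p) (by simp)).1
      rw [hEQ, hone Q hQ]
      ring
    have hlA := hl.lift hv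
    have h3 := hfree.pairFunctional_freeDiff_prod h1 hv hη hY l [] hl (by simpa using hl2)
    have h2 : φ (FreeAlgebra.lift ℂ v (l.map Prod.snd).prod) = 0 := by
      rw [map_lift_prod]
      exact hfree.map_prod_eq_zero hlA (by simpa using hl1)
    have h4 : φ (x * FreeAlgebra.lift ℂ v (l.map Prod.snd).prod) = 0 := by
      rw [map_lift_prod]
      rcases l with _ | ⟨⟨j, p⟩, l⟩
      · exact absurd rfl hl1
      have hchain : (j :: l.map Prod.fst).IsChain (· ≠ ·) := by simpa using hl.2
      by_cases hj : j = r
      · subst hj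
        rw [List.map_cons, List.map_cons, List.prod_cons, ← mul_assoc]
        refine hfree.map_mul_prod_eq_zero h1 hlA.of_cons ?_
          (mul_mem hx (hlA.1 (j, _) (by simp)).1) ?_
        · rintro h
          exact hl2 ⟨p, by simpa using h⟩
        · simpa [List.map_map, Function.comp_def] using hchain
      · refine hfree.map_mul_prod_eq_zero h1 hlA (by simp) hx ?_
        simp only [List.map_cons, List.map_map, Function.comp_def]
        exact List.isChain_cons_cons.2 ⟨Ne.symm hj, hchain⟩
    rw [List.map_nil, List.prod_nil, map_one, ← Algebra.TensorProduct.one_def, one_mul] at h3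
    rw [hEp, h2, h4, h3]
    simp
  have := hE0 (Q.map (FreeAlgebra.ι ℂ)).prod
  rw [hEQ, sub_sub, sub_eq_zero] at this
  exact this

end JointLoop

/-! ### Words in the permutation matrices -/

section PermutationWords

variable {s N : ℕ}

theorem permMat_one : permMat (1 : Equiv.Perm (Fin N)) = 1 := by
  ext i j
  simp [permMat, Matrix.one_apply, eq_comm]

theorem permMat_mul (σ τ : Equiv.Perm (Fin N)) : permMat (σ * τ) = permMat σ * permMat τ := by
  ext i j
  rw [Matrix.mul_apply, Finset.sum_eq_single (τ j)]
  · by_cases h : σ (τ j) = i <;> simp [permMat, h]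
  · intro k _ hk
    simp [permMat, hk.symm]
  · simp

theorem star_permMat (σ : Equiv.Perm (Fin N)) : star (permMat σ) = permMat σ⁻¹ := by
  ext i j
  rw [Matrix.star_apply]
  simp only [permMat, Matrix.of_apply, Equiv.Perm.inv_eq_iff_eq]
  by_cases h : σ i = j
  · simp [h]
  · simp [h, Ne.symm h]

theorem trace_permMat (σ : Equiv.Perm (Fin N)) :
    (permMat σ).trace = (Finset.univ.filter fun x => σ x = x).card := by
  rw [Matrix.trace, Finset.card_filter]
  push_cast
  rfl

/-- The letter of the free group that belongs to a permutation matrix or its adjoint. -/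
def groupLetter (l : Letter s) : Fin s × Bool := (l.1.elim id id, !l.2)

/-- The negation occurs because `true` marks the adjoint in a letter but the generator itself in the
free group. -/
theorem permPoly_eq (σ : Fin s → Equiv.Perm (Fin N)) (r : Fin s) (ε : Bool) :
    permPoly σ r ε = (permMat (letterPerm σ (r, !ε))).map MvPolynomial.C := by
  cases ε <;> simp [permPoly, starIf, letterPerm, star_permMat]

theorem wordMatrix_eq_permMat {σ : Fin s → Equiv.Perm (Fin N)}
    {X : Letter s → Matrix (Fin N) (Fin N) (GaussPoly s)}
    (hX : ∀ r ε, X (.inl r, ε) = permPoly σ r ε) {Q : List (Letter s)}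
    (hQ : Q.countP (fun l => l.1.isRight) = 0) :
    wordMatrix X Q = (permMat (wordPerm σ (Q.map groupLetter))).map MvPolynomial.C := by
  induction Q with
  | nil =>
    simp only [wordMatrix, List.map_nil, List.prod_nil, wordPerm, permMat_one]
    exact (Matrix.map_one _ (map_zero _) (map_one _)).symm
  | cons l Q ih =>
    obtain ⟨r | r, ε⟩ := l
    · rw [List.countP_cons] at hQ
      have h0 : Q.countP (fun l => l.1.isRight) = 0 := by omega
      rw [wordMatrix_cons, ih h0, hX, permPoly_eq, ← Matrix.map_mul, ← permMat_mul]
      simp [wordPerm, groupLetter]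
    · simp at hQ

/-- The average of products of normalized fixed point numbers. -/
def permMoment (N : ℕ) (S : List (List (Fin s × Bool))) : ℂ :=
  permAverage s N fun σ => (S.map fun w =>
    (N : ℂ)⁻¹ * ((Finset.univ.filter fun x => wordPerm σ w x = x).card : ℂ)).prod

theorem traceMoment_eq_of_weight_eq_zero {E : GaussPoly s →ₗ[ℂ] ℂ} (hE : E 1 = 1)
    {σ : Fin s → Equiv.Perm (Fin N)} {X : Letter s → Matrix (Fin N) (Fin N) (GaussPoly s)}
    (hX : ∀ r ε, X (.inl r, ε) = permPoly σ r ε) {S : List (List (Letter s))}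
    (hS : ∀ Q ∈ S, Q.countP (fun l => l.1.isRight) = 0) :
    traceMoment E X S = ((S.map (List.map groupLetter)).map fun w =>
      (N : ℂ)⁻¹ * ((Finset.univ.filter fun x => wordPerm σ w x = x).card : ℂ)).prod := by
  have h1 : ∀ Q ∈ S, wordTrace X Q = MvPolynomial.C ((N : ℂ)⁻¹ *
      ((Finset.univ.filter fun x => wordPerm σ (Q.map groupLetter) x = x).card : ℂ)) := by
    intro Q hQ
    have htr : ∀ Z : Matrix (Fin N) (Fin N) ℂ, (Z.map MvPolynomial.C).trace
        = (MvPolynomial.C Z.trace : GaussPoly s) := fun Z => by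
      simp [Matrix.trace]
    rw [wordTrace, wordMatrix_eq_permMat hX (hS Q hQ), htr, MvPolynomial.smul_eq_C_mul,
      ← MvPolynomial.C_mul, trace_permMat]
  rw [traceMoment, List.map_congr_left h1, List.map_map]
  have h2 : ∀ l : List ℂ, E (l.map MvPolynomial.C).prod = l.prod := by
    intro l
    rw [← map_list_prod, ← mul_one (MvPolynomial.C _), ← MvPolynomial.smul_eq_C_mul, map_smul, hE,
      smul_eq_mul, mul_one]
  rw [← h2, List.map_map]
  rfl

theorem wordPerm_eq_lift {ι α : Type*} (σ : ι → Equiv.Perm α) (w : List (ι × Bool)) :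
    wordPerm σ w = FreeGroup.lift σ (FreeGroup.mk w) := by
  rw [FreeGroup.lift_mk, wordPerm]
  congr 1
  refine List.map_congr_left fun a _ => ?_
  cases h : a.2 <;> simp [letterPerm, h]

theorem norm_prod_le_of_mem {l : List ℂ} (hl : ∀ x ∈ l, ‖x‖ ≤ 1) {x : ℂ} (hx : x ∈ l) :
    ‖l.prod‖ ≤ ‖x‖ := by
  have hle : ∀ l : List ℂ, (∀ x ∈ l, ‖x‖ ≤ 1) → ‖l.prod‖ ≤ 1 := by
    intro l hl
    induction l with
    | nil => simp
    | cons a l ih =>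
      rw [List.prod_cons, norm_mul]
      exact mul_le_one₀ (hl a (by simp)) (norm_nonneg _) (ih fun x hx => hl x (by simp [hx]))
  obtain ⟨l₁, l₂, rfl⟩ := List.append_of_mem hx
  rw [List.prod_append, List.prod_cons, norm_mul, norm_mul]
  calc ‖l₁.prod‖ * (‖x‖ * ‖l₂.prod‖) ≤ 1 * (‖x‖ * 1) := by
        gcongr
        · exact hle _ fun y hy => hl y (by simp [hy])
        · exact hle _ fun y hy => hl y (by simp [hy])
    _ = ‖x‖ := by ring

/-- All factors are proportions of fixed points and at most one, so the product is bounded by the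
factor of a single nontrivial word. -/
theorem norm_permMoment_le {S : List (List (Fin s × Bool))} {w : List (Fin s × Bool)} (hw : w ∈ S)
    (hne : FreeGroup.reduce w ≠ []) (hN : (FreeGroup.reduce w).length < N) :
    ‖permMoment N S‖ ≤
      (FreeGroup.reduce w).length ^ 2 / ((N : ℝ) - (FreeGroup.reduce w).length) := by
  set w' := FreeGroup.reduce w with hw'
  have hred : FreeGroup.IsReduced w' := by
    rw [FreeGroup.isReduced_iff_reduce_eq, hw', FreeGroup.reduce.idem]
  have hperm : ∀ σ : Fin s → Equiv.Perm (Fin N), wordPerm σ w = wordPerm σ w' := fun σ => by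
    rw [wordPerm_eq_lift, wordPerm_eq_lift, hw', FreeGroup.reduce.self]
  have hNpos : (0 : ℝ) < N := by exact_mod_cast (Nat.zero_le _).trans_lt hN
  have hfact : (0 : ℝ) < (N.factorial : ℝ) ^ s := pow_pos (by exact_mod_cast N.factorial_pos) _
  have hbound : ∀ σ : Fin s → Equiv.Perm (Fin N), ‖(S.map fun w =>
      (N : ℂ)⁻¹ * ((Finset.univ.filter fun x => wordPerm σ w x = x).card : ℂ)).prod‖
      ≤ (N : ℝ)⁻¹ * (Finset.univ.filter fun x => wordPerm σ w' x = x).card := by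
    intro σ
    refine (norm_prod_le_of_mem ?_ (List.mem_map.2 ⟨w, hw, rfl⟩)).trans ?_
    · intro x hx
      obtain ⟨v, _, rfl⟩ := List.mem_map.1 hx
      rw [norm_mul, norm_inv, Complex.norm_natCast, Complex.norm_natCast,
        inv_mul_le_iff₀ hNpos, mul_one]
      exact_mod_cast (Finset.card_le_univ _).trans (by simp)
    · rw [norm_mul, norm_inv, Complex.norm_natCast, Complex.norm_natCast, hperm]
  have hsum : ‖permMoment N S‖ ≤ ((N.factorial : ℝ) ^ s)⁻¹ * ((N : ℝ)⁻¹ *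
      ∑ σ : Fin s → Equiv.Perm (Fin N),
        ((Finset.univ.filter fun x => wordPerm σ w' x = x).card : ℝ)) := by
    rw [permMoment, permAverage, norm_mul, norm_inv, norm_pow, Complex.norm_natCast,
      Finset.mul_sum]
    exact mul_le_mul_of_nonneg_left ((norm_sum_le _ _).trans
      (Finset.sum_le_sum fun σ _ => hbound σ))
      (inv_nonneg.2 hfact.le)
  have hcount := sum_card_fixed_mul_le (α := Fin N) hred hne
  rw [Fintype.card_fin, Fintype.card_fun, Fintype.card_perm, Fintype.card_fin, Fintype.card_fin]
    at hcount
  have hcast : (∑ σ : Fin s → Equiv.Perm (Fin N),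
      ((Finset.univ.filter fun x => wordPerm σ w' x = x).card : ℝ)) * ((N : ℝ) - w'.length)
      ≤ N * (w'.length ^ 2 * (N.factorial : ℝ) ^ s) := by
    rw [← Nat.cast_sub hN.le]
    exact_mod_cast hcount
  have hpos : (0 : ℝ) < (N : ℝ) - w'.length := sub_pos.2 (by exact_mod_cast hN)
  refine hsum.trans ?_
  rw [le_div_iff₀ hpos]
  calc _ = ((N.factorial : ℝ) ^ s)⁻¹ * (N : ℝ)⁻¹ * ((∑ σ : Fin s → Equiv.Perm (Fin N),
      ((Finset.univ.filter fun x => wordPerm σ w' x = x).card : ℝ)) * ((N : ℝ) - w'.length)) := by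
        ring
    _ ≤ ((N.factorial : ℝ) ^ s)⁻¹ * (N : ℝ)⁻¹ * (N * (w'.length ^ 2 * (N.factorial : ℝ) ^ s)) :=
        mul_le_mul_of_nonneg_left hcast (by positivity)
    _ = (w'.length : ℝ) ^ 2 := by field_simp

/-- The limit of the normalized trace of a word in independent random permutation matrices. -/
def trivialIndicator (w : List (Fin s × Bool)) : ℂ := if FreeGroup.reduce w = [] then 1 else 0

/-- Factorization needs no variance estimate: if all words are trivial, every factor equals one, and
otherwise one factor of small mean makes the whole product small. -/
theorem tendsto_permMoment {N : ℕ → ℕ} (hN : Tendsto N atTop atTop)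
    (S : List (List (Fin s × Bool))) :
    Tendsto (fun q => permMoment (N q) S) atTop (𝓝 (S.map trivialIndicator).prod) := by
  by_cases h : ∀ w ∈ S, FreeGroup.reduce w = []
  · have h1 : (S.map trivialIndicator).prod = 1 := by
      refine List.prod_eq_one fun x hx => ?_
      obtain ⟨w, hw, rfl⟩ := List.mem_map.1 hx
      rw [trivialIndicator, if_pos (h w hw)]
    rw [h1]
    refine tendsto_const_nhds.congr' ?_
    filter_upwards [hN.eventually_ne_atTop 0] with q hq
    have h2 : ∀ σ : Fin s → Equiv.Perm (Fin (N q)), (S.map fun w =>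
        (N q : ℂ)⁻¹ * ((Finset.univ.filter fun x => wordPerm σ w x = x).card : ℂ)).prod = 1 := by
      intro σ
      refine List.prod_eq_one fun x hx => ?_
      obtain ⟨w, hw, rfl⟩ := List.mem_map.1 hx
      have : wordPerm σ w = 1 := by
        rw [wordPerm_eq_lift, ← FreeGroup.reduce.self, h w hw, FreeGroup.lift_mk]
        rfl
      simp [this, hq]
    rw [permMoment]
    simp_rw [h2]
    exact (permAverage_const _ _ _).symm
  · push Not at h
    obtain ⟨w, hw, hne⟩ := h
    have h1 : (S.map trivialIndicator).prod = 0 :=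
      List.prod_eq_zero (List.mem_map.2 ⟨w, hw, if_neg hne⟩)
    rw [h1]
    have h2 : Tendsto (fun q => ((FreeGroup.reduce w).length : ℝ) ^ 2 /
        ((N q : ℝ) - (FreeGroup.reduce w).length)) atTop (𝓝 0) := by
      refine Tendsto.const_div_atTop ?_ _
      exact tendsto_atTop_add_const_right _ _ (tendsto_natCast_atTop_atTop.comp hN)
    refine squeeze_zero_norm' ?_ h2
    filter_upwards [hN.eventually_gt_atTop (FreeGroup.reduce w).length] with q hq
    exact norm_permMoment_le hw hne hq

/-- For a loop sequence that is given by permutation moments at words without letters in `X`, the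
limits of the traces of such words are those of words in random permutation matrices. -/
theorem tendsto_of_eq_permMoment {N : ℕ → ℕ} (hN : Tendsto N atTop atTop)
    {D : LoopData (Letter s)} {T : ℕ → List (List (Letter s)) → ℂ}
    (hT : ∀ q S, D.weight S = 0 → T q S = permMoment (N q) (S.map (List.map groupLetter))) :
    (∀ Q, Q.countP D.X = 0 → limitOne T Q = trivialIndicator (Q.map groupLetter)) ∧
    ∀ S, D.weight S = 0 → Tendsto (fun q => T q S) atTop (𝓝 (S.map (limitOne T)).prod) := by
  have hlim : ∀ S, D.weight S = 0 → Tendsto (fun q => T q S) atTop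
      (𝓝 (S.map fun Q => trivialIndicator (Q.map groupLetter)).prod) := by
    intro S hS
    simp_rw [hT _ S hS]
    have := tendsto_permMoment hN (S.map (List.map groupLetter))
    rw [List.map_map] at this
    exact this
  have hone : ∀ Q, Q.countP D.X = 0 → limitOne T Q = trivialIndicator (Q.map groupLetter) := by
    intro Q hQ
    refine Tendsto.limUnder_eq ?_
    simpa using hlim [Q] (by simpa using hQ)
  refine ⟨hone, fun S hS => ?_⟩
  have : S.map (limitOne T) = S.map fun Q => trivialIndicator (Q.map groupLetter) := by
    refine List.map_congr_left fun Q hQ => hone Q ?_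
    exact (List.sum_eq_zero_iff.1 hS) _ (List.mem_map.2 ⟨Q, hQ, rfl⟩)
  rw [this]
  exact hlim S hS

end PermutationWords

/-! ### Words in free Haar unitaries -/

section HaarWords

variable {A : Type*} [Ring A] [StarRing A] [Algebra ℂ A] {φ : A →ₗ[ℂ] ℂ} {s : ℕ}
  {u g : Fin s → A}

/-- A Haar unitary as a unit. -/
def IsHaarUnitary.unit {u : A} (hu : IsHaarUnitary φ u) : Aˣ :=
  ⟨u, star u, hu.mul_star_self, hu.star_mul_self⟩

/-- The value of a letter of the free group. -/
def groupValue (u : Fin s → A) (a : Fin s × Bool) : A := if a.2 then u a.1 else star (u a.1)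

theorem map_groupValue_pow (hu : ∀ r, IsHaarUnitary φ (u r)) (a : Fin s × Bool) {n : ℕ}
    (hn : n ≠ 0) : φ (groupValue u a ^ n) = 0 := by
  rw [groupValue]
  split_ifs
  · exact (hu a.1).map_pow n hn
  · exact (hu a.1).map_star_pow n hn

theorem prod_groupValue_reduce (hu : ∀ r, IsHaarUnitary φ (u r)) (w : List (Fin s × Bool)) :
    (w.map (groupValue u)).prod = ((FreeGroup.reduce w).map (groupValue u)).prod := by
  have h : ∀ w : List (Fin s × Bool), (w.map (groupValue u)).prod
      = ((FreeGroup.lift (fun r => (hu r).unit) (FreeGroup.mk w) : Aˣ) : A) := by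
    intro w
    rw [FreeGroup.lift_mk, ← Units.coeHom_apply, map_list_prod, List.map_map]
    congr 1
    refine List.map_congr_left fun a _ => ?_
    cases ha : a.2 <;> simp [groupValue, ha, IsHaarUnitary.unit]
  rw [h, h, FreeGroup.reduce.self]

variable [StarModule ℂ A]

/-- Reduced words are alternating products of powers of Haar unitaries. -/
theorem exists_isAlternating (hu : ∀ r, IsHaarUnitary φ (u r)) (a : Fin s × Bool)
    (w : List (Fin s × Bool)) (hw : FreeGroup.IsReduced (a :: w)) :
    ∃ (n : ℕ) (l : List ((Fin s ⊕ Fin s) × A)), n ≠ 0 ∧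
      IsAlternating φ (fun i => (StarAlgebra.adjoin ℂ {Sum.elim u g i}).toSubalgebra)
        ((Sum.inl a.1, groupValue u a ^ n) :: l) ∧
      ((a :: w).map (groupValue u)).prod = groupValue u a ^ n * (l.map Prod.snd).prod := by
  have hmem : ∀ (a : Fin s × Bool) (n : ℕ), groupValue u a ^ n ∈
      (StarAlgebra.adjoin ℂ {Sum.elim u g (Sum.inl a.1)}).toSubalgebra := by
    intro a n
    have h1 : u a.1 ∈ StarAlgebra.adjoin ℂ {Sum.elim u g (Sum.inl a.1)} :=
      StarAlgebra.subset_adjoin ℂ _ (by simp)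
    refine pow_mem ?_ n
    rw [groupValue]
    split_ifs
    · exact h1
    · exact (show star (u a.1) ∈ StarAlgebra.adjoin ℂ {Sum.elim u g (Sum.inl a.1)} from
        star_mem h1)
  induction w generalizing a with
  | nil =>
    refine ⟨1, [], one_ne_zero, ⟨?_, by simp⟩, by simp⟩
    intro p hp
    rw [List.mem_singleton.1 hp]
    exact ⟨hmem a 1, map_groupValue_pow hu a one_ne_zero⟩
  | cons b w ih =>
    obtain ⟨hab, hw'⟩ := FreeGroup.isReduced_cons_cons.1 hw
    obtain ⟨n, l, hn, hl, hprod⟩ := ih b hw'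
    by_cases h : a.1 = b.1
    -- Reducedness gives a repeated generator the same exponent, so the leading power grows instead
    -- of cancelling.
    · have hab' : a = b := Prod.ext h (hab h)
      subst hab'
      refine ⟨n + 1, l, n.succ_ne_zero, ?_, ?_⟩
      · exact hl.of_cons.cons (hmem a _) (map_groupValue_pow hu a n.succ_ne_zero)
          (by simpa using hl.2)
      · rw [List.map_cons, List.prod_cons, hprod, ← mul_assoc, ← pow_succ']
    · refine ⟨1, (Sum.inl b.1, groupValue u b ^ n) :: l, one_ne_zero, ?_, ?_⟩
      · refine hl.cons (hmem a 1) (map_groupValue_pow hu a one_ne_zero) ?_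
        rw [List.map_cons]
        refine List.isChain_cons_cons.2 ⟨by simpa using h, by simpa using hl.2⟩
      · rw [List.map_cons, List.prod_cons, hprod, pow_one, List.map_cons, List.prod_cons]

theorem map_starMonomial_of_countP_eq_zero (h1 : φ 1 = 1) (hu : ∀ r, IsHaarUnitary φ (u r))
    (hfree : IsStarFree φ (Sum.elim u g)) {Q : List (Letter s)}
    (hQ : Q.countP (fun l => l.1.isRight) = 0) :
    φ (starMonomial (Sum.elim u g) Q) = trivialIndicator (Q.map groupLetter) := by
  have hval : starMonomial (Sum.elim u g) Q
      = ((Q.map groupLetter).map (groupValue u)).prod := by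
    rw [starMonomial, List.map_map]
    congr 1
    refine List.map_congr_left fun l hl => ?_
    obtain ⟨r | r, ε⟩ := l
    · cases ε <;> simp [starIf, groupLetter, groupValue]
    · exact absurd (List.countP_eq_zero.1 hQ _ hl) (by simp)
  rw [hval, prod_groupValue_reduce hu, trivialIndicator]
  split_ifs with h
  · rw [h]
    simpa using h1
  · have hred : FreeGroup.IsReduced (FreeGroup.reduce (Q.map groupLetter)) := by
      rw [FreeGroup.isReduced_iff_reduce_eq, FreeGroup.reduce.idem]
    obtain ⟨a, w, hw⟩ := List.exists_cons_of_ne_nil h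
    rw [hw] at hred ⊢
    obtain ⟨n, l, _, hl, hprod⟩ := exists_isAlternating (g := g) hu a w hred
    rw [hprod]
    simpa using hfree.map_prod_eq_zero hl (by simp)

end HaarWords

/-! ### Identification of the limits -/

section Identification

variable {A : Type*} [Ring A] [StarRing A] [Algebra ℂ A] [StarModule ℂ A] {φ : A →ₗ[ℂ] ℂ} {s : ℕ}
  {u g : Fin s → A}

theorem starMonomial_cons {ι B : Type*} [Monoid B] [Star B] (x : ι → B) (l : ι × Bool)
    (Q : List (ι × Bool)) :
    starMonomial x (l :: Q) = starIf (x l.1) l.2 * starMonomial x Q := by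
  simp [starMonomial]

theorem starMonomial_append {ι B : Type*} [Monoid B] [Star B] (x : ι → B)
    (Q R : List (ι × Bool)) :
    starMonomial x (Q ++ R) = starMonomial x Q * starMonomial x R := by
  simp [starMonomial]

theorem starIf_mem_adjoin {ι : Type*} (x : ι → A) (l : ι × Bool) :
    starIf (x l.1) l.2 ∈ (StarAlgebra.adjoin ℂ {x l.1}).toSubalgebra := by
  have h : x l.1 ∈ StarAlgebra.adjoin ℂ {x l.1} := StarAlgebra.subset_adjoin ℂ _ rfl
  rw [starIf]
  split_ifs
  · exact (show star (x l.1) ∈ StarAlgebra.adjoin ℂ {x l.1} from star_mem h)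
  · exact h

/-- A `*`-free family of Haar unitaries and elements whose individual distributions are the limits
of a loop sequence has the limit of the loop sequence as its joint distribution. -/
theorem map_starMonomial_eq_limitOne (hφ : IsTracialState φ) (hu : ∀ r, IsHaarUnitary φ (u r))
    (hfree : IsStarFree φ (Sum.elim u g)) {D : LoopData (Letter s)} {κ : ℕ → Letter s → ℂ}
    {κ' : Letter s → ℂ} {δ : ℕ → ℂ} {T : ℕ → List (List (Letter s)) → ℂ}
    (hT : LoopSequence D κ κ' δ T) (hX : D.X = fun l => l.1.isRight)
    (hY : ∀ x l, D.Y x l → l.1 = x.1) (hη : ∀ x, ∀ l ∈ D.η x, l.1 = x.1) {N : ℕ → ℕ}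
    (hN : Tendsto N atTop atTop)
    (hperm : ∀ q S, D.weight S = 0 → T q S = permMoment (N q) (S.map (List.map groupLetter)))
    (hone : ∀ (r : Fin s) (m : ℕ) (e : Fin (m + 1) → Bool) (ℓ : ℂ),
      Tendsto (fun q => T q [List.ofFn fun k => (Sum.inr r, e k)]) atTop (𝓝 ℓ) →
      φ (List.ofFn fun k => starIf (g r) (e k)).prod = ℓ) (Q : List (Letter s)) :
    φ (starMonomial (Sum.elim u g) Q) = limitOne T Q := by
  obtain ⟨hbase, h0⟩ := tendsto_of_eq_permMoment hN hperm
  have hℓ := hT.satisfiesOne h0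
  have hbase' : ∀ Q : List (Letter s), Q.countP D.X = 0 →
      φ (starMonomial (Sum.elim u g) Q) = limitOne T Q := by
    intro Q hQ
    rw [hbase Q hQ]
    exact map_starMonomial_of_countP_eq_zero hφ.map_one hu hfree (hX ▸ hQ)
  -- At words in one Gaussian or Wishart matrix the loop equations provide the convergence that
  -- `hone` asks for.
  have hsingle : ∀ (r : Fin s) (Q : List (Letter s)), (∀ l ∈ Q, l.1 = Sum.inr r) →
      φ (starMonomial (Sum.elim u g) Q) = limitOne T Q := by
    intro r Q hQ
    rcases Q with _ | ⟨x, Q⟩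
    · exact hbase' [] (by simp)
    · have hlist : (x :: Q) = List.ofFn fun k : Fin (Q.length + 1) =>
          ((Sum.inr r, ((x :: Q).get k).2) : Letter s) := by
        refine List.ext_getElem (by simp) fun k h1 h2 => ?_
        rw [List.getElem_ofFn]
        exact Prod.ext (hQ _ (List.getElem_mem _)) rfl
      have hlim := hT.tendsto h0 [x :: Q]
      rw [List.map_singleton, List.prod_singleton] at hlim
      rw [← hone r Q.length (fun k => ((x :: Q).get k).2) (limitOne T (x :: Q)) (hlist ▸ hlim)]
      conv_lhs => rw [hlist]
      rw [starMonomial, List.map_ofFn]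
      rfl
  -- Both sides are cyclically invariant and agree at words in the unitaries, so it suffices that
  -- `φ` satisfies the limiting loop equations.
  refine LoopData.SatisfiesOne.unique (D := D) (κ' := κ') ?_ hℓ ?_ hT.limitOne_rotate hbase' Q
  · rintro ⟨r | r, ε⟩ Q hx
    · simp [hX] at hx
    set x : Letter s := (Sum.inr r, ε)
    have key := hfree.loop_equation (r := Sum.inr r) (v := fun l => starIf (Sum.elim u g l.1) l.2)
      (x := starIf (g r) ε) (η := starMonomial (Sum.elim u g) (D.η x)) (Y := D.Y x) (κ := κ' x)
      hφ.map_one (starIf_mem_adjoin _) ?_ (starIf_mem_adjoin (Sum.elim u g) x) (hY x) ?_ Q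
    · simp only [starMonomial_cons, starMonomial_append]
      exact key
    · exact prod_map_mem (v := fun l : Letter s => starIf (Sum.elim u g l.1) l.2)
        (B := fun i => (StarAlgebra.adjoin ℂ {Sum.elim u g i}).toSubalgebra)
        (starIf_mem_adjoin _) (hη x)
    · intro Q hQ
      -- The loop equation of a single element is not derived from its cumulants: it holds for the
      -- matrix limits, and `hsingle` carries it over, since all words in it involve only the index
      -- `r`.
      have h1 := hℓ x Q hx
      rw [← hsingle r (x :: Q) (by simpa [x] using hQ), ← hsingle r Q hQ, starMonomial_cons] at h1
      refine h1.trans ?_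
      congr 2
      refine List.map_congr_left fun p hp => ?_
      obtain ⟨hp1, hp2⟩ := splits_subset p hp
      rw [← hsingle r p.2 fun l hl => hQ l (hp2 l hl), ← hsingle r (D.η x ++ p.1) ?_,
        starMonomial_append]
      · rfl
      · intro l hl
        rcases List.mem_append.1 hl with hl | hl
        · exact hη x l hl
        · exact hQ l (hp1 l hl)
  · intro P Q
    rw [starMonomial_append, starMonomial_append, hφ.tracial]

variable {Ω : Type*} [MeasurableSpace Ω] {P : Measure Ω} [IsProbabilityMeasure P]
  {f : Fin s × ℕ × ℕ → Ω → ℂ}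

theorem countP_eq_zero_of_weight_eq_zero {L : Type*} {D : LoopData L} {S : List (List L)}
    (hS : D.weight S = 0) : ∀ Q ∈ S, Q.countP D.X = 0 := fun Q hQ =>
  List.sum_eq_zero_iff.1 hS _ (List.mem_map.2 ⟨Q, hQ, rfl⟩)

theorem circularMoment_of_weight_eq_zero (hf : IsIndepComplexGaussian P f) (N : ℕ)
    {S : List (List (Letter s))} (hS : (circularLoop s).weight S = 0) :
    circularMoment hf N S = permMoment N (S.map (List.map groupLetter)) := by
  rw [circularMoment, permMoment]
  congr 1
  funext σ
  exact traceMoment_eq_of_weight_eq_zero (gaussianExp_one hf) (fun _ _ => rfl)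
    (countP_eq_zero_of_weight_eq_zero hS)

theorem wishartMoment_of_weight_eq_zero (hf : IsIndepComplexGaussian P f) (M N : ℕ)
    {S : List (List (Letter s))} (hS : (wishartLoop s).weight S = 0) :
    wishartMoment hf M N S = permMoment N (S.map (List.map groupLetter)) := by
  rw [wishartMoment, permMoment]
  congr 1
  funext σ
  exact traceMoment_eq_of_weight_eq_zero (gaussianExp_one hf) (fun _ _ => rfl)
    (countP_eq_zero_of_weight_eq_zero hS)

theorem tendsto_circularMoment (hf : IsIndepComplexGaussian P f) (hφ : IsTracialState φ)
    (hu : ∀ r, IsHaarUnitary φ (u r)) (hg : ∀ r, IsStandardCircular φ (g r))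
    (hfree : IsStarFree φ (Sum.elim u g)) (Q : List (Letter s)) :
    Tendsto (fun N => circularMoment hf N [Q]) atTop (𝓝 (φ (starMonomial (Sum.elim u g) Q))) := by
  have hT := circularMoment_loopSequence hf
  have hperm := fun N S hS => circularMoment_of_weight_eq_zero (S := S) hf N hS
  rw [map_starMonomial_eq_limitOne hφ hu hfree hT rfl
    (fun x l hl => by simp only [circularLoop, decide_eq_true_eq] at hl; rw [hl])
    (fun x l hl => by simp [circularLoop] at hl) tendsto_id hperm
    fun r m e ℓ h => circular_moment_eq_limit hf (hg r) r e h]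
  simpa using hT.tendsto (tendsto_of_eq_permMoment tendsto_id hperm).2 [Q]

theorem tendsto_wishartMoment (hf : IsIndepComplexGaussian P f) (hφ : IsTracialState φ)
    (hu : ∀ r, IsHaarUnitary φ (u r)) {c : ℝ} (hc : 0 < c) (hg : ∀ r, IsFreePoisson φ c (g r))
    (hfree : IsStarFree φ (Sum.elim u g)) {M N : ℕ → ℕ} (hN : Tendsto N atTop atTop)
    (hMN : Tendsto (fun q => (M q : ℝ) / (N q : ℝ)) atTop (𝓝 c)) (Q : List (Letter s)) :
    Tendsto (fun q => wishartMoment hf (M q) (N q) [Q]) atTop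
      (𝓝 (φ (starMonomial (Sum.elim u g) Q))) := by
  have hT := wishartMoment_loopSequence hf hN hMN
  have hperm := fun q S hS => wishartMoment_of_weight_eq_zero (S := S) hf (M q) (N q) hS
  rw [map_starMonomial_eq_limitOne hφ hu hfree hT rfl
    (fun x l hl => by simpa [wishartLoop] using hl)
    (fun x l hl => by simp only [wishartLoop, List.mem_singleton] at hl; rw [hl]) hN hperm
    fun r m e ℓ h => freePoisson_moment_eq_limit hf hc (hg r) hN hMN r e h]
  simpa using hT.tendsto (tendsto_of_eq_permMoment hN hperm).2 [Q]

end Identification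

/-! ### Random matrices and polynomial models -/

section Transfer

variable {s N : ℕ} {Ω : Type*} {f : Fin s × ℕ × ℕ → Ω → ℂ}

theorem evalAt_wordTrace {ω : Ω} {Y : Letter s → Matrix (Fin N) (Fin N) (GaussPoly s)}
    {x : Fin s ⊕ Fin s → Matrix (Fin N) (Fin N) ℂ}
    (h : ∀ l, (Y l).map (evalAt f ω) = starIf (x l.1) l.2) (Q : List (Letter s)) :
    evalAt f ω (wordTrace Y Q) = normTrace (starMonomial x Q) := by
  have hm : (wordMatrix Y Q).map (evalAt f ω) = starMonomial x Q := by
    induction Q with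
    | nil => exact Matrix.map_one _ (map_zero _) (map_one _)
    | cons l Q ih => rw [wordMatrix_cons, starMonomial_cons, Matrix.map_mul, h, ih]
  rw [wordTrace, map_smul, normTrace, ← hm, smul_eq_mul, one_div, Matrix.trace, Matrix.trace,
    map_sum]
  rfl

theorem map_evalAt_permPoly (ω : Ω) (σ : Fin s → Equiv.Perm (Fin N)) (r : Fin s) (ε : Bool) :
    (permPoly σ r ε).map (evalAt f ω) = starIf (permMat (σ r)) ε := by
  ext i j
  simp [permPoly, evalAt]

theorem map_evalAt_circularModel (ω : Ω) (σ : Fin s → Equiv.Perm (Fin N)) (l : Letter s) :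
    (circularModel N σ l).map (evalAt f ω) =
      starIf (Sum.elim (fun r => permMat (σ r)) (fun r => gaussianMatrix f N r ω) l.1) l.2 := by
  obtain ⟨r | r, ε⟩ := l
  · exact map_evalAt_permPoly ω σ r ε
  · ext i j
    cases ε
    · simp [circularModel, starIf, gaussianMatrix, cornerMatrix, entryIndex, evalAt_cvar_false]
    · simp [circularModel, starIf, gaussianMatrix, cornerMatrix, entryIndex, evalAt_cvar_true,
        Matrix.star_apply]

theorem star_wishartMatrix (M : ℕ) (r : Fin s) (ω : Ω) :
    star (wishartMatrix f M N r ω) = wishartMatrix f M N r ω := by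
  simp [wishartMatrix, Matrix.star_eq_conjTranspose]

theorem map_evalAt_wishartModel (M : ℕ) (ω : Ω) (σ : Fin s → Equiv.Perm (Fin N)) (l : Letter s) :
    (wishartModel M N σ l).map (evalAt f ω) =
      starIf (Sum.elim (fun r => permMat (σ r)) (fun r => wishartMatrix f M N r ω) l.1) l.2 := by
  obtain ⟨r | r, ε⟩ := l
  · exact map_evalAt_permPoly ω σ r ε
  · have h : starIf (wishartMatrix f M N r ω) ε = wishartMatrix f M N r ω := by
      cases ε
      · rfl
      · exact star_wishartMatrix M r ω
    simp only [Sum.elim_inr, h]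
    ext i j
    simp [wishartModel, wishartMatrix, cornerMatrix, Matrix.mul_apply, evalAt_cvar_false,
      evalAt_cvar_true]

theorem permMat_injective : Function.Injective (permMat (N := N)) := by
  intro σ τ h
  ext j
  have := congrFun (congrFun h (σ j)) j
  simp only [permMat, Matrix.of_apply, if_true] at this
  by_contra hne
  rw [if_neg fun h => hne (by rw [h])] at this
  exact one_ne_zero this

variable [MeasurableSpace Ω]

theorem measurable_matrix {m n : Type*} {X : Ω → Matrix m n ℂ} :
    Measurable X ↔ ∀ i j, Measurable fun ω => X ω i j :=
  measurable_pi_iff.trans (forall_congr' fun _ => measurable_pi_iff)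

theorem measurable_matrix_apply {m n : Type*} (i : m) (j : n) :
    Measurable fun Z : Matrix m n ℂ => Z i j :=
  measurable_matrix.1 measurable_id i j

theorem measurableSet_singleton_matrix (Z : Matrix (Fin N) (Fin N) ℂ) : MeasurableSet {Z} :=
  MeasurableSet.singleton (α := Fin N → Fin N → ℂ) Z

theorem measurable_starMonomial {ι : Type*} {X : ι → Ω → Matrix (Fin N) (Fin N) ℂ}
    (hX : ∀ i, Measurable (X i)) (w : List (ι × Bool)) :
    Measurable fun ω => starMonomial (fun i => X i ω) w := by
  induction w with
  | nil => exact measurable_const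
  | cons l w ih =>
    rw [measurable_matrix]
    intro i j
    simp only [starMonomial_cons, Matrix.mul_apply]
    refine Finset.measurable_fun_sum _ fun k _ => Measurable.mul ?_ (measurable_matrix.1 ih k j)
    rcases l with ⟨l, ε⟩
    cases ε
    · exact measurable_matrix.1 (hX l) i k
    · exact Complex.continuous_conj.measurable.comp (measurable_matrix.1 (hX l) k i)

theorem measurable_normTrace : Measurable (normTrace (N := N)) :=
  (Finset.measurable_fun_sum _ fun i _ => measurable_matrix_apply i i).const_mul _

theorem IsIndepComplexGaussian.measurable_cornerMatrix {P : Measure Ω}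
    (hf : IsIndepComplexGaussian P f) (M N : ℕ) (r : Fin s) :
    Measurable (cornerMatrix f M N r) :=
  measurable_matrix.2 fun _ _ => hf.measurable _

theorem IsIndepComplexGaussian.measurable_gaussianMatrix {P : Measure Ω}
    (hf : IsIndepComplexGaussian P f) (N : ℕ) (r : Fin s) : Measurable (gaussianMatrix f N r) :=
  measurable_matrix.2 fun i j =>
    (measurable_matrix.1 (hf.measurable_cornerMatrix N N r) i j).const_mul _

theorem IsIndepComplexGaussian.measurable_wishartMatrix {P : Measure Ω}
    (hf : IsIndepComplexGaussian P f) (M N : ℕ) (r : Fin s) :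
    Measurable (wishartMatrix f M N r) := by
  refine measurable_matrix.2 fun i j => ?_
  simp only [wishartMatrix, Matrix.smul_apply, Matrix.mul_apply, Matrix.conjTranspose_apply,
    smul_eq_mul]
  refine (Finset.measurable_fun_sum _ fun k _ => Measurable.mul ?_ ?_).const_mul _
  · exact Complex.continuous_conj.measurable.comp
      (measurable_matrix.1 (hf.measurable_cornerMatrix M N r) k i)
  · exact measurable_matrix.1 (hf.measurable_cornerMatrix M N r) k j

variable {P : Measure Ω} {U X : Fin s → Ω → Matrix (Fin N) (Fin N) ℂ}

/-- The event that the random permutation matrices are those of a given family. -/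
def permEvent (U : Fin s → Ω → Matrix (Fin N) (Fin N) ℂ) (σ : Fin s → Equiv.Perm (Fin N)) :
    Set Ω :=
  ⋂ r, U r ⁻¹' {permMat (σ r)}

theorem measurableSet_permEvent (hU : ∀ r, IsUniformPermMatrix P (U r))
    (σ : Fin s → Equiv.Perm (Fin N)) : MeasurableSet (permEvent U σ) :=
  MeasurableSet.iInter fun r => (hU r).measurable (measurableSet_singleton_matrix _)

/-- The permutation matrices take finitely many values and the events of the single values are
disjoint. On each of them the trace is a polynomial in the Gaussian variables. -/
theorem normTrace_eq_sum_indicator (hU : ∀ r, IsUniformPermMatrix P (U r))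
    (w : List (Letter s)) (ω : Ω) :
    normTrace (starMonomial (fun i => Sum.elim U X i ω) w) =
      ∑ σ : Fin s → Equiv.Perm (Fin N), (permEvent U σ).indicator (fun ω =>
        normTrace (starMonomial (Sum.elim (fun r => permMat (σ r)) fun r => X r ω) w)) ω := by
  choose σ hσ using fun r => (hU r).mem ω
  rw [Finset.sum_eq_single σ]
  · rw [Set.indicator_of_mem (by simpa [permEvent] using hσ)]
    congr 2
    funext i
    rcases i with r | r
    · exact hσ r
    · rfl
  · intro τ _ hτ
    refine Set.indicator_of_notMem (fun h => hτ (funext fun r => permMat_injective ?_)) _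
    rw [← hσ r]
    exact (Set.mem_iInter.1 h r).symm
  · simp

theorem measureReal_permEvent [IsProbabilityMeasure P] (hU : ∀ r, IsUniformPermMatrix P (U r))
    (hind : iIndepFun U P) (σ : Fin s → Equiv.Perm (Fin N)) :
    P.real (permEvent U σ) = ((N.factorial : ℝ) ^ s)⁻¹ := by
  have h := hind.measure_inter_preimage_eq_mul Finset.univ
    (sets := fun r => {permMat (σ r)}) fun r _ => measurableSet_singleton_matrix _
  simp only [Finset.mem_univ, Set.iInter_true] at h
  rw [Measure.real, permEvent, h, ENNReal.toReal_prod]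
  have h1 : ∀ r, (P (U r ⁻¹' {permMat (σ r)})).toReal = 1 / (N.factorial : ℝ) :=
    fun r => (hU r).uniform (σ r)
  simp [h1]

theorem indepFun_tuples (hU : ∀ r, Measurable (U r)) (hX : ∀ r, Measurable (X r))
    (hind : iIndepFun (Sum.elim U X) P) :
    IndepFun (fun ω r => U r ω) (fun ω r => X r ω) P := by
  have hm : ∀ i, Measurable (Sum.elim U X i) := by
    rintro (r | r)
    · exact hU r
    · exact hX r
  have h := hind.indepFun_finset (Finset.univ.map Function.Embedding.inl)
    (Finset.univ.map Function.Embedding.inr) (by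
      rw [Finset.disjoint_left]
      intro i hi hi'
      obtain ⟨a, _, rfl⟩ := Finset.mem_map.1 hi
      simp at hi') hm
  exact h.comp (φ := fun x r => x ⟨Sum.inl r, by simp⟩) (ψ := fun x r => x ⟨Sum.inr r, by simp⟩)
    (measurable_pi_lambda _ fun r => measurable_pi_apply _)
    (measurable_pi_lambda _ fun r => measurable_pi_apply _)

variable [IsProbabilityMeasure P]
  {Y : (Fin s → Equiv.Perm (Fin N)) → Letter s → Matrix (Fin N) (Fin N) (GaussPoly s)}

theorem integrable_normTrace_of_model (hf : IsIndepComplexGaussian P f)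
    (hU : ∀ r, IsUniformPermMatrix P (U r))
    (hY : ∀ ω σ l, (Y σ l).map (evalAt f ω) =
      starIf (Sum.elim (fun r => permMat (σ r)) (fun r => X r ω) l.1) l.2) (w : List (Letter s)) :
    Integrable (fun ω => normTrace (starMonomial (fun i => Sum.elim U X i ω) w)) P := by
  simp only [normTrace_eq_sum_indicator hU w]
  refine integrable_finsetSum _ fun σ _ => Integrable.indicator ?_ (measurableSet_permEvent hU σ)
  simp only [← evalAt_wordTrace (hY _ σ) w]
  exact (hf.hasAllMoments_evalAt _).integrable

/-- Each event is independent of the matrices `X` and has probability `(N!)^(-s)`, so the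
expectation is the average over constant permutations. -/
theorem integral_normTrace_of_model (hf : IsIndepComplexGaussian P f)
    (hU : ∀ r, IsUniformPermMatrix P (U r)) (hX : ∀ r, Measurable (X r))
    (hind : iIndepFun (Sum.elim U X) P)
    (hY : ∀ ω σ l, (Y σ l).map (evalAt f ω) =
      starIf (Sum.elim (fun r => permMat (σ r)) (fun r => X r ω) l.1) l.2) (w : List (Letter s)) :
    ∫ ω, normTrace (starMonomial (fun i => Sum.elim U X i ω) w) ∂P =
      permAverage s N fun σ => traceMoment (gaussianExp hf) (Y σ) [w] := by
  have hindU : iIndepFun U P :=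
    iIndepFun.precomp (g := Sum.inl) (f := Sum.elim U X) Sum.inl_injective hind
  simp only [normTrace_eq_sum_indicator hU w]
  have hint : ∀ σ : Fin s → Equiv.Perm (Fin N), Integrable (fun ω =>
      normTrace (starMonomial (Sum.elim (fun r => permMat (σ r)) fun r => X r ω) w)) P := by
    intro σ
    simp only [← evalAt_wordTrace (hY _ σ) w]
    exact (hf.hasAllMoments_evalAt _).integrable
  rw [integral_finsetSum _ fun σ _ => (hint σ).indicator (measurableSet_permEvent hU σ),
    permAverage, Finset.mul_sum]
  refine Finset.sum_congr rfl fun σ _ => ?_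
  have hmoment : traceMoment (gaussianExp hf) (Y σ) [w] = ∫ ω,
      normTrace (starMonomial (Sum.elim (fun r => permMat (σ r)) fun r => X r ω) w) ∂P := by
    simp only [← evalAt_wordTrace (hY _ σ) w]
    rw [traceMoment, List.map_singleton, List.prod_singleton]
    rfl
  have hpre : permEvent U σ = (fun ω r => U r ω) ⁻¹' {fun r => permMat (σ r)} := by
    ext ω
    simp [permEvent, funext_iff]
  have hsingle : MeasurableSet {fun r => permMat (σ r)} :=
    MeasurableSet.singleton (α := Fin s → Fin N → Fin N → ℂ) _
  have hψ : Measurable fun x : Fin s → Matrix (Fin N) (Fin N) ℂ =>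
      normTrace (starMonomial (Sum.elim (fun r => permMat (σ r)) x) w) := by
    have h := measurable_starMonomial (Ω := Fin s → Matrix (Fin N) (Fin N) ℂ)
      (X := Sum.elim (fun r _ => permMat (σ r)) fun r x => x r) (by
        rintro (r | r)
        · exact measurable_const
        · exact measurable_pi_apply r) w
    have heq : ∀ x : Fin s → Matrix (Fin N) (Fin N) ℂ,
        (fun i => Sum.elim (fun r _ => permMat (σ r)) (fun r x => x r) i x) =
          Sum.elim (fun r => permMat (σ r)) x := fun x => by
      funext i
      rcases i with r | r <;> rfl
    simp only [heq] at h
    exact measurable_normTrace.comp h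
  have hone : Measurable (Set.indicator {fun r => permMat (σ r)} fun _ => (1 : ℂ)) :=
    measurable_const.indicator hsingle
  have hindep := (indepFun_tuples (fun r => (hU r).measurable) hX hind).comp hone hψ
  have hprod := hindep.integral_fun_mul_eq_mul_integral
    (hone.comp (measurable_pi_lambda _ fun r => (hU r).measurable)).aestronglyMeasurable
    (hint σ).aestronglyMeasurable
  have hind1 : ∀ ω, Set.indicator {fun r => permMat (σ r)} (fun _ => (1 : ℂ)) (fun r => U r ω)
      = (permEvent U σ).indicator (fun _ => (1 : ℂ)) ω := by
    intro ω
    rw [hpre]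
    rfl
  simp only [Function.comp_apply, hind1] at hprod
  rw [hmoment]
  have hconst : ∫ ω, (permEvent U σ).indicator (fun _ => (1 : ℂ)) ω ∂P
      = ((N.factorial : ℂ) ^ s)⁻¹ := by
    rw [integral_indicator_const _ (measurableSet_permEvent hU σ), measureReal_permEvent hU hindU]
    simp
  rw [hconst] at hprod
  rw [← hprod]
  refine integral_congr_ae (ae_of_all _ fun ω => ?_)
  by_cases h : ω ∈ permEvent U σ <;> simp [h]

/-- Integrability is demanded at every index, but the assumptions on the permutation matrices start
at `N = 1`; the empty matrix has trace zero. -/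
theorem integrable_normTrace_zero {ι : Type*} (hN : N = 0)
    (x : Ω → ι → Matrix (Fin N) (Fin N) ℂ) (w : List (ι × Bool)) :
    Integrable (fun ω => normTrace (starMonomial (x ω) w)) P := by
  subst hN
  simp [normTrace]

end Transfer

end FreePerm

end

/-! ### The theorem -/

theorem theorem1 {Ω : Type*} [MeasurableSpace Ω] (P : Measure Ω) [IsProbabilityMeasure P]
    (s : ℕ)
    -- the Gaussian random variables and the random permutation matrices
    (f : Fin s × ℕ × ℕ → Ω → ℂ) (hf : FreePerm.IsIndepComplexGaussian P f)
    (U : (N : ℕ) → Fin s → Ω → Matrix (Fin N) (Fin N) ℂ)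
    (hU : ∀ N, 1 ≤ N → ∀ r, FreePerm.IsUniformPermMatrix P (U N r))
    (hUG : ∀ N, 1 ≤ N → iIndepFun (Sum.elim (U N) (FreePerm.gaussianMatrix f N)) P)
    (hUW : ∀ M N, 1 ≤ M → 1 ≤ N → iIndepFun (Sum.elim (U N) (FreePerm.wishartMatrix f M N)) P)
    -- the limit families, in a tracial `*`-probability space
    {A : Type*} [Ring A] [StarRing A] [Algebra ℂ A] [StarModule ℂ A]
    (φ : A →ₗ[ℂ] ℂ) (hφ : FreePerm.IsTracialState φ) (c : ℝ) (hc : 0 < c)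
    (u g w : Fin s → A)
    (hu : ∀ r, FreePerm.IsHaarUnitary φ (u r))
    (hg : ∀ r, FreePerm.IsStandardCircular φ (g r))
    (hw : ∀ r, FreePerm.IsFreePoisson φ c (w r))
    (hug : FreePerm.IsStarFree φ (Sum.elim u g))
    (huw : FreePerm.IsStarFree φ (Sum.elim u w)) :
    (FreePerm.ConvergesInStarDistribution P φ (fun N => N)
        (fun N => Sum.elim (U N) (FreePerm.gaussianMatrix f N)) (Sum.elim u g) ∧
      FreePerm.IsAsymptoticallyStarFree P φ (fun N => N)
        (fun N => Sum.elim (U N) (FreePerm.gaussianMatrix f N)) (Sum.elim u g)) ∧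
    (∀ M N : ℕ → ℕ, Tendsto M atTop atTop → Tendsto N atTop atTop →
      Tendsto (fun q => (M q : ℝ) / (N q : ℝ)) atTop (𝓝 c) →
      FreePerm.ConvergesInStarDistribution P φ N
        (fun q => Sum.elim (U (N q)) (FreePerm.wishartMatrix f (M q) (N q))) (Sum.elim u w) ∧
      FreePerm.IsAsymptoticallyStarFree P φ N
        (fun q => Sum.elim (U (N q)) (FreePerm.wishartMatrix f (M q) (N q)))
        (Sum.elim u w)) := by
  have hcircular : FreePerm.ConvergesInStarDistribution P φ (fun N => N)
      (fun N => Sum.elim (U N) (FreePerm.gaussianMatrix f N)) (Sum.elim u g) := by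
    refine fun Q => ⟨fun N => ?_, ?_⟩
    · rcases Nat.eq_zero_or_pos N with hN | hN
      · exact FreePerm.integrable_normTrace_zero hN _ Q
      · exact FreePerm.integrable_normTrace_of_model hf (hU N hN)
          (fun ω σ l => FreePerm.map_evalAt_circularModel ω σ l) Q
    · refine (FreePerm.tendsto_circularMoment hf hφ hu hg hug Q).congr' ?_
      filter_upwards [eventually_ge_atTop 1] with N hN
      exact (FreePerm.integral_normTrace_of_model hf (hU N hN)
        (hf.measurable_gaussianMatrix N) (hUG N hN)
        (fun ω σ l => FreePerm.map_evalAt_circularModel ω σ l) Q).symm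
  have hwishart : ∀ M N : ℕ → ℕ, Tendsto M atTop atTop → Tendsto N atTop atTop →
      Tendsto (fun q => (M q : ℝ) / (N q : ℝ)) atTop (𝓝 c) →
      FreePerm.ConvergesInStarDistribution P φ N
        (fun q => Sum.elim (U (N q)) (FreePerm.wishartMatrix f (M q) (N q))) (Sum.elim u w) := by
    refine fun M N hM hN hMN Q => ⟨fun q => ?_, ?_⟩
    · rcases Nat.eq_zero_or_pos (N q) with hq | hq
      · exact FreePerm.integrable_normTrace_zero hq _ Q
      · exact FreePerm.integrable_normTrace_of_model hf (hU (N q) hq)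
          (fun ω σ l => FreePerm.map_evalAt_wishartModel (M q) ω σ l) Q
    · refine (FreePerm.tendsto_wishartMoment hf hφ hu hc hw huw hN hMN Q).congr' ?_
      -- Independence is assumed for positive sizes only, so the expectations are identified with
      -- the model moments eventually, which is enough for the limit.
      filter_upwards [hM.eventually_ge_atTop 1, hN.eventually_ge_atTop 1] with q hMq hNq
      exact (FreePerm.integral_normTrace_of_model hf (hU (N q) hNq)
        (hf.measurable_wishartMatrix (M q) (N q)) (hUW (M q) (N q) hMq hNq)
        (fun ω σ l => FreePerm.map_evalAt_wishartModel (M q) ω σ l) Q).symm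
  exact ⟨⟨hcircular, hcircular, hug⟩, fun M N hM hN hMN =>
    ⟨hwishart M N hM hN hMN, hwishart M N hM hN hMN, huw⟩⟩
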